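/- **Theorem (growth of the universal enveloping algebra).** Let $\Bbbk$ be a field, $X$ a finite-dimensional commutative $\Bbbk$-algebra, and $L$ a self-similar Lie algebra over $\Bbbk$ with alphabet $X$: a Lie algebra with a homomorphism $\psi:L\to (X\otimes L)\rtimes\operatorname{Der}X$, restricted (with $\psi$ preserving the $p$-mapping) if $\operatorname{char}\Bbbk=p>0$. It acts on $T(X)=\bigoplus_n X^{\otimes n}$ by $a\cdot 1=0$ and $a\cdot(x\otimes w)=\sum_i xy_i\otimes (a_i\cdot w)+\delta(x)\otimes w$ for $\psi(a)=\sum_i y_i\otimes a_i+\delta$; assume that this action is faithful. Assume that $L$ is contracting: there is a finite-dimensional subspace $N\le L$ such that for every $a\in L$ one has $\psi^n(a)\in X^{\otimes n}\otimes N\oplus\operatorname{Der}(X^{\otimes n})$ for all large $n$. Assume that $L$ is $\mathbb R_+$-graded with dilation $\lambda>1$: $X$ and $L$ are graded by real numbers (as a ring, respectively as a restricted Lie algebra), the degrees of $L$ are $\ge 0$, and for $a$ homogeneous and $\psi(a)=\sum y_i\otimes a_i+\delta$ as above one has $\deg y_i+\lambda\deg a_i=\deg a=\deg\delta$. Assume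 finally that $L$ is generated, as a restricted Lie algebra, by finitely many homogeneous elements of positive degree. Let $U(L)$ be the universal enveloping algebra (the restricted one if $\operatorname{char}\Bbbk>0$) with the induced grading, and let $L_{\le d}$ and $U(L)_{\le d}$ be the spans of the homogeneous elements of degree $\le d$. Let $\theta=\operatorname{GKdim}L=\sup_S\limsup_n \log\dim(S^{\le n})/\log n$, where $S$ runs through the finite-dimensional subspaces of $L$ and $S^{\le n}$ is spanned by the products of at most $n$ elements of $S$ (a $p$-th power counting as $p$ factors). Put $\theta_0=\log(\dim X)/\log\lambda$ (with $\log 0:=0$), and write $f\precsim g$ if there is $C>0$ with $f(d)\le C\,g(Cd)$ for all real $d\ge1$. Then all $L_{\le d}$ and $U(L)_{\le d}$ are finite-dimensional, $0\le\theta\le\theta_0<\infty$, and: 1. $U(L)$ has subexponential growth: $\frac1d\log\dim U(L)_{\le d}\to0$ as $d\to\infty$. More precisely, $\dim U(L)_{\le d}\precsim \exp\big(d^{\eta/(\eta+1)}\big)$ for every $\eta>\theta$, and also for $\eta=\theta_0$. If $\theta>0$ and $\dim L_{\le d}\precsim d^\theta$, then moreover $\dim U(L)_{\le d}\precsim\exp\big(d^{\theta/(\theta+1)}\big)$.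 2. Suppose that $L$ is regularly weakly branched, that is: $X=\Bbbk[x]/(x^m)$ with $m\ge 1$ carries the derivation $\partial_x=d/dx$, and the image of $L$ in $\operatorname{Der}X$ is $\Bbbk\partial_x$; $L$ is recurrent, i.e. with $\varepsilon:X\to\Bbbk$ the augmentation, $(\varepsilon\otimes1)\psi$ maps the kernel of $L\to\operatorname{Der}X$ onto $L$; $L$ is transitive, i.e. $U(L)\cdot (x^{m-1})^{\otimes n}=X^{\otimes n}$ for all $n$; and there is a non-zero ideal $K$ of $L$ with $X\otimes K\le\psi(K)$. Then $\theta=\theta_0>0$ and the exponent is attained and sharp: $$\dim U(L)_{\le d}\precsim \exp\big(d^{\theta/(\theta+1)}\big)\quad\text{and}\quad \exp\big(d^{\theta/(\theta+1)}\big)\precsim\dim U(L)_{\le d}.$$ -/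

import Mathlib

open scoped TensorProduct

noncomputable section

namespace SelfSimilarLie

/-! ### Restricted Lie algebras -/

section Restricted

variable (k : Type*) {M : Type*} [Field k] [LieRing M] [LieAlgebra k M]

/-- Jacobson's Lie polynomial `s_i(a, b)`: `i * s_i(a, b)` is the coefficient of `t ^ (i - 1)` in
`ad (t a + b) ^ (p - 1) (a)`. The subset `T` records in which of the `p - 1` factors one picks
the summand `t a`. -/
def jacobsonTerm (p i : ℕ) (a b : M) : M :=
  (i : k)⁻¹ • ∑ T ∈ (Finset.univ : Finset (Fin (p - 1))).powersetCard (i - 1),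
    (List.ofFn fun j : Fin (p - 1) =>
      if j ∈ T then LieAlgebra.ad k M a else LieAlgebra.ad k M b).prod a

/-- `f` is a `p`-mapping `a ↦ a ^ p` on the Lie algebra `M` over a field of characteristic `p`
(the usual axioms of a restricted Lie algebra). -/
structure IsPMap (p : ℕ) (f : M → M) : Prop where
  smul : ∀ (c : k) (a : M), f (c • a) = c ^ p • f a
  ad_pow : ∀ a : M, LieAlgebra.ad k M (f a) = LieAlgebra.ad k M a ^ p
  add : ∀ a b : M, f (a + b) = f a + f b + ∑ i ∈ Finset.Icc 1 (p - 1), jacobsonTerm k p i a b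

end Restricted

/-! ### Wreath products and self-similarity structures -/

section Wreath

variable (k X L : Type*) [Field k] [CommRing X] [Algebra k X] [LieRing L] [LieAlgebra k L]

/-- A derivation of `X` acts on `X ⊗ L` by deriving the first coordinate. -/
def derAction : Derivation k X X →ₗ⁅k⁆ LieDerivation k (X ⊗[k] L) (X ⊗[k] L) where
  toFun δ :=
    { toLinearMap := (δ : X →ₗ[k] X).rTensor L
      leibniz' := by
        intro u v
        induction u with
        | zero => simp
        | add u₁ u₂ h₁ h₂ => simp only [add_lie, map_add, h₁, h₂, lie_add]; abel
        | tmul x a =>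
          induction v with
          | zero => simp
          | add v₁ v₂ h₁ h₂ => simp only [add_lie, map_add, h₁, h₂, lie_add]; abel
          | tmul y b =>
            simp only [LieAlgebra.ExtendScalars.bracket_tmul, LinearMap.rTensor_tmul,
              Derivation.coeFn_coe, Derivation.leibniz, smul_eq_mul, TensorProduct.add_tmul]
            rw [← lie_skew b a, TensorProduct.tmul_neg, sub_neg_eq_add] }
  map_add' δ ε := by
    ext u
    simp [LinearMap.rTensor_add]
  map_smul' c δ := by
    ext u
    simp [LinearMap.rTensor_smul]
  map_lie' := by
    intro δ ε
    ext u
    induction u with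
    | zero => simp
    | add u₁ u₂ h₁ h₂ => simp only [map_add, h₁, h₂]
    | tmul x a =>
      change (⁅δ, ε⁆ x) ⊗ₜ[k] a = _
      rw [LieDerivation.commutator_apply, Derivation.commutator_apply, TensorProduct.sub_tmul]
      rfl

/-- The wreath product `L ≀ Der X = (X ⊗ L) ⋊ Der X`. -/
abbrev Wreath : Type _ := (X ⊗[k] L) ⋊⁅derAction k X L⁆ (Derivation k X X)

variable {k X L}

/-- The component of `ψ` in `X ⊗ L`. -/
def coord (ψ : L →ₗ⁅k⁆ Wreath k X L) : L →ₗ[k] X ⊗[k] L :=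
  LieAlgebra.SemiDirectSum.projl (derAction k X L) ∘ₗ (ψ : L →ₗ[k] Wreath k X L)

/-- The component of `ψ` in `Der X`. -/
def top (ψ : L →ₗ⁅k⁆ Wreath k X L) : L →ₗ[k] Derivation k X X :=
  (LieAlgebra.SemiDirectSum.projr (derAction k X L) : Wreath k X L →ₗ[k] Derivation k X X) ∘ₗ
    (ψ : L →ₗ[k] Wreath k X L)

/-- In positive characteristic `p`: `pw` is a `p`-mapping of `L`, and the self-similarity structure
`ψ` preserves `p`-mappings, where `L ≀ Der X` carries the `p`-mapping `q` that extends the natural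
ones `(x ⊗ a) ^ p = x ^ p ⊗ a ^ p` on `X ⊗ L` and `δ ↦ δ ^ p` on `Der X`.
In characteristic `0` there is no condition (and `pw` plays no role). -/
def IsRestricted (p : ℕ) (pw : L → L) (ψ : L →ₗ⁅k⁆ Wreath k X L) : Prop :=
  p ≠ 0 → IsPMap k p pw ∧ ∃ q : Wreath k X L → Wreath k X L, IsPMap k p q ∧
    (∀ (x : X) (a : L), q ⟨x ⊗ₜ[k] a, 0⟩ = ⟨(x ^ p) ⊗ₜ[k] pw a, 0⟩) ∧
    (∀ δ : Derivation k X X,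
      (q ⟨0, δ⟩).left = 0 ∧ ∀ x : X, (q ⟨0, δ⟩).right x = (⇑δ)^[p] x) ∧
    ∀ a : L, ψ (pw a) = q (ψ a)

/-! ### The natural action on the tensor algebra `T(X)` -/

/-- For `φ : L → T(X)`, `a ↦ a · w`, this is the map
`a ↦ a · (x ⊗ w) = ∑ x y_i ⊗ (a_i · w) + (δ x) ⊗ w` where `ψ a = ∑ y_i ⊗ a_i + δ`. -/
def actStepAux (ψ : L →ₗ⁅k⁆ Wreath k X L) (x : X) (w : TensorAlgebra k X)
    (φ : L →ₗ[k] TensorAlgebra k X) : L →ₗ[k] TensorAlgebra k X :=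
  TensorProduct.lift ((LinearMap.mul k (TensorAlgebra k X)).compl₁₂
      (TensorAlgebra.ι k ∘ₗ LinearMap.mulLeft k x) φ) ∘ₗ coord ψ +
    { toFun := fun a => TensorAlgebra.ι k (top ψ a x) * w
      map_add' := fun a b => by simp [add_mul]
      map_smul' := fun c a => by simp }

/-- The linear map `(w, φ) ↦ (x ⊗ w, actStepAux ψ x w φ)`, linear in the letter `x`. -/
def actStep (ψ : L →ₗ⁅k⁆ Wreath k X L) :
    X →ₗ[k] Module.End k (TensorAlgebra k X × (L →ₗ[k] TensorAlgebra k X)) :=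
  LinearMap.mk₂ k
    (fun x P => (TensorAlgebra.ι k x * P.1, actStepAux ψ x P.1 P.2))
    (by
      intro x y P
      refine Prod.ext (by simp [add_mul]) (LinearMap.ext fun a => ?_)
      simp only [actStepAux, LinearMap.add_apply, LinearMap.comp_apply, Prod.mk_add_mk,
        LinearMap.coe_mk, AddHom.coe_mk, map_add, add_mul]
      generalize coord ψ a = u
      have : TensorProduct.lift ((LinearMap.mul k (TensorAlgebra k X)).compl₁₂
            (TensorAlgebra.ι k ∘ₗ LinearMap.mulLeft k (x + y)) P.2) u =
          TensorProduct.lift ((LinearMap.mul k (TensorAlgebra k X)).compl₁₂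
            (TensorAlgebra.ι k ∘ₗ LinearMap.mulLeft k x) P.2) u +
          TensorProduct.lift ((LinearMap.mul k (TensorAlgebra k X)).compl₁₂
            (TensorAlgebra.ι k ∘ₗ LinearMap.mulLeft k y) P.2) u := by
        induction u with
        | zero => simp
        | add u v hu hv => simp only [map_add, hu, hv]; abel
        | tmul z b => simp [add_mul]
      rw [this]; abel)
    (by
      intro c x P
      refine Prod.ext (by simp) (LinearMap.ext fun a => ?_)
      simp only [actStepAux, LinearMap.add_apply, LinearMap.comp_apply, Prod.smul_mk,
        LinearMap.coe_mk, AddHom.coe_mk, LinearMap.smul_apply, Derivation.map_smul, map_smul,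
        smul_mul_assoc, smul_add]
      congr 1
      generalize coord ψ a = u
      induction u with
      | zero => simp
      | add u v hu hv => simp only [map_add, hu, hv, smul_add]
      | tmul z b => simp)
    (by
      intro x P Q
      refine Prod.ext (by simp [mul_add]) (LinearMap.ext fun a => ?_)
      simp only [actStepAux, LinearMap.add_apply, LinearMap.comp_apply, Prod.mk_add_mk,
        LinearMap.coe_mk, AddHom.coe_mk, Prod.fst_add, Prod.snd_add, mul_add]
      generalize coord ψ a = u
      have : TensorProduct.lift ((LinearMap.mul k (TensorAlgebra k X)).compl₁₂
            (TensorAlgebra.ι k ∘ₗ LinearMap.mulLeft k x) (P.2 + Q.2)) u =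
          TensorProduct.lift ((LinearMap.mul k (TensorAlgebra k X)).compl₁₂
            (TensorAlgebra.ι k ∘ₗ LinearMap.mulLeft k x) P.2) u +
          TensorProduct.lift ((LinearMap.mul k (TensorAlgebra k X)).compl₁₂
            (TensorAlgebra.ι k ∘ₗ LinearMap.mulLeft k x) Q.2) u := by
        induction u with
        | zero => simp
        | add u v hu hv => simp only [map_add, hu, hv]; abel
        | tmul z b => simp [mul_add]
      rw [this]; abel)
    (by
      intro c x P
      refine Prod.ext (by simp) (LinearMap.ext fun a => ?_)
      simp only [actStepAux, LinearMap.add_apply, LinearMap.comp_apply, Prod.smul_mk,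
        LinearMap.coe_mk, AddHom.coe_mk, LinearMap.smul_apply, Prod.smul_fst, Prod.smul_snd,
        mul_smul_comm, smul_add]
      congr 1
      generalize coord ψ a = u
      induction u with
      | zero => simp
      | add u v hu hv => simp only [map_add, hu, hv, smul_add]
      | tmul z b => simp)

/-- The pair `(w, a ↦ a · w)`, built letter by letter. -/
def actPair (ψ : L →ₗ⁅k⁆ Wreath k X L) (w : TensorAlgebra k X) :
    TensorAlgebra k X × (L →ₗ[k] TensorAlgebra k X) :=
  TensorAlgebra.lift k (actStep ψ) w (1, 0)

theorem actPair_ι_mul (ψ : L →ₗ⁅k⁆ Wreath k X L) (x : X) (w : TensorAlgebra k X) :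
    actPair ψ (TensorAlgebra.ι k x * w) = actStep ψ x (actPair ψ w) := by
  simp [actPair]

/-- The natural action of `L` on `T(X)` by `k`-linear endomorphisms. -/
def act (ψ : L →ₗ⁅k⁆ Wreath k X L) : L →ₗ[k] Module.End k (TensorAlgebra k X) where
  toFun a :=
    { toFun := fun w => (actPair ψ w).2 a
      map_add' := fun v w => by simp [actPair]
      map_smul' := fun c w => by simp [actPair] }
  map_add' a b := LinearMap.ext fun w => map_add (actPair ψ w).2 a b
  map_smul' c a := LinearMap.ext fun w => map_smul (actPair ψ w).2 c a

/-- `a · 1 = 0`. -/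
theorem act_one (ψ : L →ₗ⁅k⁆ Wreath k X L) (a : L) : act ψ a 1 = 0 := by
  simp [act, actPair]

theorem actPair_fst (ψ : L →ₗ⁅k⁆ Wreath k X L) (w : TensorAlgebra k X) :
    (actPair ψ w).1 = w := by
  have key : ∀ w v : TensorAlgebra k X, (actPair ψ v).1 = v →
      (actPair ψ (w * v)).1 = w * v := by
    intro w
    induction w using TensorAlgebra.induction with
    | algebraMap r =>
      intro v hv
      rw [← Algebra.smul_def]
      have h : actPair ψ (r • v) = r • actPair ψ v := by simp [actPair]
      rw [h, Prod.smul_fst, hv]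
    | ι x =>
      intro v hv
      rw [actPair_ι_mul]
      simp [actStep, hv]
    | mul a b ha hb =>
      intro v hv
      rw [mul_assoc]
      exact ha _ (hb v hv)
    | add a b ha hb =>
      intro v hv
      have h : actPair ψ (a * v + b * v) = actPair ψ (a * v) + actPair ψ (b * v) := by
        simp [actPair]
      rw [add_mul, h, Prod.fst_add, ha v hv, hb v hv]
  simpa using key w 1 (by simp [actPair])

/-- `a · (x ⊗ w) = ∑ x y_i ⊗ (a_i · w) + (δ x) ⊗ w` where `ψ a = ∑ y_i ⊗ a_i + δ`. -/
theorem act_ι_mul (ψ : L →ₗ⁅k⁆ Wreath k X L) (a : L) (x : X) (w : TensorAlgebra k X) :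
    act ψ a (TensorAlgebra.ι k x * w) =
      TensorProduct.lift ((LinearMap.mul k (TensorAlgebra k X)).compl₁₂
        (TensorAlgebra.ι k ∘ₗ LinearMap.mulLeft k x) ((act ψ).flip w)) (coord ψ a) +
      TensorAlgebra.ι k (top ψ a x) * w := by
  have h : act ψ a (TensorAlgebra.ι k x * w) =
      (actPair ψ (TensorAlgebra.ι k x * w)).2 a := rfl
  have h2 : (actPair ψ w).2 = (act ψ).flip w := rfl
  rw [h, actPair_ι_mul]
  simp only [actStep, LinearMap.mk₂_apply, actStepAux, LinearMap.add_apply, LinearMap.comp_apply,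
    LinearMap.coe_mk, AddHom.coe_mk, actPair_fst, h2]

/-- The self-similar Lie algebra is faithful: its natural action on `T(X)` is faithful. -/
def IsFaithful (ψ : L →ₗ⁅k⁆ Wreath k X L) : Prop :=
  ∀ a : L, (∀ w : TensorAlgebra k X, act ψ a w = 0) → a = 0

/-! ### Contraction -/

/-- The component of the `n`-fold iterate `ψ ^ n` in `X ^ ⊗ n ⊗ L`, where `X ^ ⊗ n` is seen as the
degree-`n` part of `T(X)`. If `ψ a = ∑ y_i ⊗ a_i + δ` then
`ψ ^ (n + 1) a = ∑ y_i ⊗ ψ ^ n a_i + ⋯`. -/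
def iter (ψ : L →ₗ⁅k⁆ Wreath k X L) : ℕ → (L →ₗ[k] TensorAlgebra k X ⊗[k] L)
  | 0 => TensorProduct.mk k (TensorAlgebra k X) L 1
  | n + 1 => TensorProduct.lift
      ((LinearMap.rTensorHom L ∘ₗ LinearMap.mul k (TensorAlgebra k X) ∘ₗ
        TensorAlgebra.ι k).compl₂ (iter ψ n)) ∘ₗ coord ψ

/-- Contraction: for a finite-dimensional `N ≤ L` and every `a`, one has
`ψ ^ n a ∈ X ^ ⊗ n ⊗ N ⊕ Der (X ^ ⊗ n)` for all large `n`. -/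
def IsContracting (ψ : L →ₗ⁅k⁆ Wreath k X L) : Prop :=
  ∃ N : Submodule k L, FiniteDimensional k N ∧ ∀ a : L, ∃ n₀ : ℕ, ∀ n ≥ n₀,
    iter ψ n a ∈ LinearMap.range (N.subtype.lTensor (TensorAlgebra k X))

/-! ### Gradings -/

/-- Compatible gradings, by real numbers and with dilation `lam`, of the alphabet `X` (as a ring)
and of `L` (as a restricted Lie algebra): for `a` homogeneous of degree `d` and
`ψ a = ∑ y_i ⊗ a_i + δ` one has `deg y_i + lam * deg a_i = d = deg δ`. -/
structure IsGraded (p : ℕ) (pw : L → L) (ψ : L →ₗ⁅k⁆ Wreath k X L) (lam : ℝ)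
    (𝒳 : ℝ → Submodule k X) (ℒ : ℝ → Submodule k L) : Prop where
  alphabet_internal : DirectSum.IsInternal 𝒳
  alphabet_graded : SetLike.GradedMonoid 𝒳
  internal : DirectSum.IsInternal ℒ
  lie_mem : ∀ {i j : ℝ} {a b : L}, a ∈ ℒ i → b ∈ ℒ j → ⁅a, b⁆ ∈ ℒ (i + j)
  pw_mem : p ≠ 0 → ∀ {i : ℝ} {a : L}, a ∈ ℒ i → pw a ∈ ℒ (p * i)
  coord_mem : ∀ {d : ℝ} {a : L}, a ∈ ℒ d → coord ψ a ∈
    ⨆ (i : ℝ) (j : ℝ) (_ : i + lam * j = d),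
      LinearMap.range (TensorProduct.map (𝒳 i).subtype (ℒ j).subtype)
  top_mem : ∀ {d : ℝ} {a : L}, a ∈ ℒ d → ∀ {i : ℝ} {x : X}, x ∈ 𝒳 i → top ψ a x ∈ 𝒳 (i + d)

/-- `L` is generated, as a restricted Lie algebra, by finitely many homogeneous elements of
positive degree. -/
def GeneratedInPositiveDegree (p : ℕ) (pw : L → L) (ℒ : ℝ → Submodule k L) : Prop :=
  ∃ S : Finset L, (∀ s ∈ S, ∃ d > 0, s ∈ ℒ d) ∧
    ∀ H : LieSubalgebra k L, (∀ s ∈ S, s ∈ H) → (p ≠ 0 → ∀ a ∈ H, pw a ∈ H) → H = ⊤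

end Wreath

/-! ### Gelfand-Kirillov dimension -/

section GK

variable (k : Type*) {L : Type*} [Field k] [LieRing L] [LieAlgebra k L]

/-- Membership in `S ^ n`, the span of the `n`-fold products of elements of `S`; in characteristic
`p > 0`, the space `S ^ (p * n)` also contains the `p`-th powers of the elements of `S ^ n`. -/
inductive MemPow (p : ℕ) (pw : L → L) (S : Submodule k L) : ℕ → L → Prop
  | of {a : L} : a ∈ S → MemPow p pw S 1 a
  | zero {n : ℕ} : MemPow p pw S n 0
  | add {n : ℕ} {a b : L} : MemPow p pw S n a → MemPow p pw S n b → MemPow p pw S n (a + b)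
  | smul {n : ℕ} (c : k) {a : L} : MemPow p pw S n a → MemPow p pw S n (c • a)
  | lie {m n : ℕ} {a b : L} :
      MemPow p pw S m a → MemPow p pw S n b → MemPow p pw S (m + n) ⁅a, b⁆
  | pw {n : ℕ} {a : L} : p ≠ 0 → MemPow p pw S n a → MemPow p pw S (p * n) (pw a)

/-- The subspace `S ^ n`. -/
def powSpace (p : ℕ) (pw : L → L) (S : Submodule k L) (n : ℕ) : Submodule k L where
  carrier := {a | MemPow k p pw S n a}
  add_mem' := MemPow.add
  zero_mem' := MemPow.zero
  smul_mem' := fun c _ h => MemPow.smul c h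

/-- The span of all products of at most `n` elements of `S`. -/
def powSpaceLE (p : ℕ) (pw : L → L) (S : Submodule k L) (n : ℕ) : Submodule k L :=
  ⨆ m ∈ Finset.Icc 1 n, powSpace k p pw S m

/-- The (upper) Gelfand-Kirillov dimension of the restricted Lie algebra `L`. -/
def gkDim (p : ℕ) (pw : L → L) : EReal :=
  ⨆ (S : Submodule k L) (_ : FiniteDimensional k S),
    Filter.limsup (fun n : ℕ =>
      ((Real.log (Module.finrank k (powSpaceLE k p pw S n)) / Real.log n : ℝ) : EReal))
      Filter.atTop

end GK

/-! ### The universal enveloping algebra and its growth -/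

section Enveloping

variable (k : Type*) {L : Type*} [Field k] [LieRing L] [LieAlgebra k L]

/-- The relations `a ^ p = pw a` for `a ∈ L`; there are none in characteristic `0`. -/
inductive PowRel (p : ℕ) (pw : L → L) :
    UniversalEnvelopingAlgebra k L → UniversalEnvelopingAlgebra k L → Prop
  | pow_eq (a : L) : p ≠ 0 → PowRel p pw
      (UniversalEnvelopingAlgebra.ι k a ^ p) (UniversalEnvelopingAlgebra.ι k (pw a))

/-- The universal enveloping algebra `U(L)`: the restricted one in positive characteristic, the
ordinary one in characteristic `0`. -/
abbrev Env (p : ℕ) (pw : L → L) : Type _ := RingQuot (PowRel k p pw)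

/-- The canonical map `L → U(L)`. -/
def envι (p : ℕ) (pw : L → L) (a : L) : Env k p pw :=
  RingQuot.mkAlgHom k (PowRel k p pw) (UniversalEnvelopingAlgebra.ι k a)

variable {k}

/-- The span `L_{≤ d}` of the homogeneous elements of `L` of degree at most `d`. -/
def degLE (ℒ : ℝ → Submodule k L) (d : ℝ) : Submodule k L := ⨆ e ≤ d, ℒ e

/-- The homogeneous component of degree `d` of `U(L)`: the span of the products `a_1 ⋯ a_m` with
`a_i` homogeneous of degree `d_i` and `d_1 + ⋯ + d_m = d` (the empty product has degree `0`). -/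
def envDeg (p : ℕ) (pw : L → L) (ℒ : ℝ → Submodule k L) (d : ℝ) :
    Submodule k (Env k p pw) :=
  Submodule.span k {u | ∃ l : List (ℝ × L), (∀ t ∈ l, t.2 ∈ ℒ t.1) ∧
    (l.map Prod.fst).sum = d ∧ (l.map fun t => envι k p pw t.2).prod = u}

/-- The span `U(L)_{≤ d}` of the homogeneous elements of `U(L)` of degree at most `d`. -/
def envDegLE (p : ℕ) (pw : L → L) (ℒ : ℝ → Submodule k L) (d : ℝ) :
    Submodule k (Env k p pw) := ⨆ e ≤ d, envDeg p pw ℒ e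

/-- `f ≾ g`: there is a constant `C > 0` with `f d ≤ C * g (C * d)` for all `d ≥ 1`. -/
def GrowthLE (f g : ℝ → ℝ) : Prop := ∃ C > 0, ∀ d ≥ 1, f d ≤ C * g (C * d)

end Enveloping

/-! ### Weakly branched self-similar Lie algebras -/

section Branched

variable {k X L : Type*} [Field k] [CommRing X] [Algebra k X] [LieRing L] [LieAlgebra k L]

/-- With respect to an augmentation `ε : X → k`: the map `(ε ⊗ 1) ψ : ker π → L` is onto, where
`π : L → Der X` is the projection. -/
def IsRecurrent (ψ : L →ₗ⁅k⁆ Wreath k X L) (ε : X →ₐ[k] k) : Prop :=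
  ∀ b : L, ∃ a : L, top ψ a = 0 ∧
    TensorProduct.lid k L ((ε : X →ₗ[k] k).rTensor L (coord ψ a)) = b

/-- Every `v ∈ X ^ ⊗ n` is of the form `u · (θ ⊗ ⋯ ⊗ θ)` with `u ∈ U(L)`; the action of `U(L)` on
`T(X)` is through the subalgebra of `End T(X)` generated by the image of `L`. -/
def IsTransitive (ψ : L →ₗ⁅k⁆ Wreath k X L) (θ : X) : Prop :=
  ∀ (n : ℕ), ∀ v ∈ LinearMap.range (TensorAlgebra.ι k (M := X)) ^ n,
    ∃ u ∈ Algebra.adjoin k (Set.range (act ψ)), u (TensorAlgebra.ι k θ ^ n) = v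

/-- `L` is regularly weakly branched: the alphabet is `X = k[x]/(x ^ m)` with `m ≥ 1`, the image of
`L` in `Der X` is `k ∂_x`, `L` is recurrent and transitive (with `θ = x ^ (m - 1)`), and there is a
non-zero ideal `K` of `L` with `X ⊗ K ≤ ψ(K)`. -/
def IsRegularlyWeaklyBranched (ψ : L →ₗ⁅k⁆ Wreath k X L) : Prop :=
  ∃ (m : ℕ) (e : AdjoinRoot (Polynomial.X ^ m : Polynomial k) ≃ₐ[k] X)
    (D : Derivation k X X) (ε : X →ₐ[k] k),
    1 ≤ m ∧ D (e (AdjoinRoot.root _)) = 1 ∧ LinearMap.range (top ψ) = Submodule.span k {D} ∧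
    IsRecurrent ψ ε ∧ IsTransitive ψ (e (AdjoinRoot.root _) ^ (m - 1)) ∧
    ∃ K : LieIdeal k L, K ≠ ⊥ ∧
      ∀ u ∈ LinearMap.range ((K.toSubmodule.subtype).lTensor X), ∃ b ∈ K, ψ b = ⟨u, 0⟩

end Branched

end SelfSimilarLie

end

/-!
Upper bound: `ψ` is injective and its first component maps `L_{≤ d}` into `X ⊗ L_{≤ (d + c) / λ}`
for some constant `c`, while `Der X` is finite-dimensional. Hence `f d = dim L_{≤ d}` satisfies
`f d ≤ dim X * f ((d + c) / λ) + D`, which gives `f d ≤ C * d ^ θ₀`. As `L` is generated in degrees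
at least some `δ > 0`, the space `L_{≤ d}` lies in the span of the products of at most `d / δ`
generators, so `f d ≤ C * d ^ η` for every `η > θ` as well. Exchanging factors shows that the
ordered monomials in a homogeneous basis `(aᵢ)` of `L` span `U(L)`. For every `s > 0` those of
degree at most `d` number at most `exp (s * d)` times the product of the geometric series
`∑ₙ exp (-s * n * deg aᵢ)`, that is, at most `exp (s * d + A * s ^ (-η))`, and
`s = d ^ (-1 / (η + 1))` balances the two summands.

Lower bound: on the branching subspace `K` the recursion holds in the opposite direction, so
`f d ≥ r * d ^ θ₀`. The square-free ordered monomials in a basis of `L` are linearly independent in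
`U(L)`. For this, let the coproduct `a ↦ ρ a ⊗ 1 + 1 ⊗ a` act on `U(L)`, where `ρ` is the faithful
representation on `T(X)`, and contract its first tensor factor with linear forms that vanish at `1`
and are dual to the operators `ρ aᵢ`: each contraction removes one basis element from a monomial, up
to terms in which two or more are removed. Hence `N` basis elements of degree at most `D` give
`2 ^ N` independent monomials of degree at most `N * D`; now take `D = d ^ (1 / (θ + 1))` and let
`N` be a multiple of `d ^ (θ / (θ + 1))`.
-/

noncomputable section

namespace SelfSimilarLie

/-! ### Jacobson's formula -/

section Jacobson

theorem sum_powersetCard_succ_insert {α M : Type*} [DecidableEq α] [AddCommMonoid M]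
    {a : α} {s : Finset α} (ha : a ∉ s) (n : ℕ) (f : Finset α → M) :
    ∑ T ∈ (insert a s).powersetCard (n + 1), f T =
      ∑ T ∈ s.powersetCard (n + 1), f T + ∑ T ∈ s.powersetCard n, f (insert a T) := by
  have hmem : ∀ {r}, ∀ T ∈ s.powersetCard r, a ∉ T := fun T hT h =>
    ha ((Finset.mem_powersetCard.1 hT).1 h)
  rw [Finset.powersetCard_succ_insert ha, Finset.sum_union, Finset.sum_image]
  · intro T hT T' hT' h
    rw [← Finset.erase_insert (hmem T hT), ← Finset.erase_insert (hmem T' hT'), h]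
  · refine Finset.disjoint_left.2 fun T hT hT' => ?_
    obtain ⟨T', -, rfl⟩ := Finset.mem_image.1 hT'
    exact hmem _ hT (Finset.mem_insert_self _ _)

/-- The sum of all words of length `n` in `x` and `y` that contain `x` exactly `s` times, i.e. the
coefficient of `t ^ s` in `(t x + y) ^ n`. -/
def wordSum {E : Type*} [Ring E] (x y : E) (n s : ℕ) : E :=
  ∑ T ∈ (Finset.univ : Finset (Fin n)).powersetCard s,
    (List.ofFn fun j : Fin n => if j ∈ T then x else y).prod

section WordSum

variable {E : Type*} [Ring E] (x y : E) (n s : ℕ)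

theorem mul_wordSum_eq_sum_map_succ : y * wordSum x y n s =
    ∑ T ∈ ((Finset.univ : Finset (Fin n)).map (Fin.succEmb n)).powersetCard s,
      (List.ofFn fun j : Fin (n + 1) => if j ∈ T then x else y).prod := by
  rw [Finset.powersetCard_map, Finset.sum_map, wordSum, Finset.mul_sum]
  refine Finset.sum_congr rfl fun T _ => ?_
  simp [List.ofFn_succ]

theorem mul_wordSum_eq_sum_map_insert_zero : x * wordSum x y n s =
    ∑ T ∈ ((Finset.univ : Finset (Fin n)).map (Fin.succEmb n)).powersetCard s,
      (List.ofFn fun j : Fin (n + 1) => if j ∈ insert 0 T then x else y).prod := by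
  rw [Finset.powersetCard_map, Finset.sum_map, wordSum, Finset.mul_sum]
  refine Finset.sum_congr rfl fun T _ => ?_
  simp [List.ofFn_succ, Fin.succ_ne_zero]

theorem wordSum_succ_zero : wordSum x y (n + 1) 0 = y * wordSum x y n 0 := by
  simp [wordSum]

theorem wordSum_succ_succ :
    wordSum x y (n + 1) (s + 1) = x * wordSum x y n s + y * wordSum x y n (s + 1) := by
  have huniv : (Finset.univ : Finset (Fin (n + 1))) =
      insert 0 ((Finset.univ : Finset (Fin n)).map (Fin.succEmb n)) := by
    ext i
    refine Fin.cases ?_ (fun j => ?_) i <;> simp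
  rw [mul_wordSum_eq_sum_map_succ, mul_wordSum_eq_sum_map_insert_zero, wordSum, huniv,
    sum_powersetCard_succ_insert (by simp), add_comm]

theorem jacobsonTerm_eq_smul_wordSum {k M : Type*} [Field k] [LieRing M] [LieAlgebra k M]
    (p i : ℕ) (a b : M) : jacobsonTerm k p i a b = (i : k)⁻¹ •
      wordSum (LieAlgebra.ad k M a) (LieAlgebra.ad k M b) (p - 1) (i - 1) a := by
  rw [jacobsonTerm, wordSum, LinearMap.sum_apply]

end WordSum

theorem choose_prime_sub_one_cast {E : Type*} [Ring E] {p : ℕ} (hp : p.Prime) (hpE : (p : E) = 0)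
    {j : ℕ} (hj : j < p) : ((p - 1).choose j : E) = (-1) ^ j := by
  induction j with
  | zero => simp
  | succ j ih =>
    have pascal : p.choose (j + 1) = (p - 1).choose j + (p - 1).choose (j + 1) := by
      conv_lhs => rw [← Nat.sub_add_cancel hp.one_le, Nat.choose_succ_succ]
    obtain ⟨r, hr⟩ := hp.dvd_choose_self (Nat.succ_ne_zero j) hj
    have hsum : ((p - 1).choose j : E) + (p - 1).choose (j + 1) = 0 := by
      rw [← Nat.cast_add, ← pascal, hr, Nat.cast_mul, hpE, zero_mul]
    rw [ih (by lia)] at hsum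
    rw [pow_succ, mul_neg_one, eq_neg_of_add_eq_zero_right hsum]

theorem sub_pow_prime_sub_one_of_commute {E : Type*} [Ring E] {p : ℕ} (hp : p.Prime)
    (hpE : (p : E) = 0) {x y : E} (hxy : Commute x y) :
    (x - y) ^ (p - 1) = ∑ j ∈ Finset.range p, x ^ j * y ^ (p - 1 - j) := by
  rw [sub_eq_add_neg, hxy.neg_right.add_pow, Nat.sub_add_cancel hp.one_le]
  refine Finset.sum_congr rfl fun j hj => ?_
  have hj := Finset.mem_range.1 hj
  have hsign : (-1 : E) ^ (p - 1 - j) * (-1) ^ (p - 1 - j) = 1 := by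
    rw [← pow_add, Even.neg_one_pow ⟨_, rfl⟩]
  rw [← Nat.choose_symm (by lia), choose_prime_sub_one_cast hp hpE (by lia), neg_pow,
    ((Commute.neg_one_left (y ^ (p - 1 - j))).pow_left _).eq, mul_assoc, mul_assoc, hsign, mul_one]

attribute [local instance] LieRing.ofAssociativeRing

variable {k M A : Type*} [Field k] [LieRing M] [LieAlgebra k M] [Ring A] [Algebra k A]

theorem ad_pow_prime_sub_one {p : ℕ} (hp : p.Prime) (hpA : (p : A) = 0) (x g : A) :
    (LieAlgebra.ad k A x ^ (p - 1)) g = ∑ j ∈ Finset.range p, x ^ j * g * x ^ (p - 1 - j) := by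
  have hpEnd : (p : Module.End k A) = 0 := by
    ext u
    simp [hpA]
  have had : LieAlgebra.ad k A x = LinearMap.mulLeft k x - LinearMap.mulRight k x :=
    congrFun (LieAlgebra.ad_eq_lmul_left_sub_lmul_right A) x
  rw [had, sub_pow_prime_sub_one_of_commute hp hpEnd (LinearMap.commute_mulLeft_right x x),
    LinearMap.sum_apply]
  refine Finset.sum_congr rfl fun j _ => ?_
  simp [LinearMap.pow_mulLeft, LinearMap.pow_mulRight, mul_assoc]

open Polynomial

theorem derivative_pow_eq_sum (g : A[X]) (n : ℕ) :
    derivative (g ^ n) = ∑ j ∈ Finset.range n, g ^ j * derivative g * g ^ (n - 1 - j) := by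
  induction n with
  | zero => simp
  | succ n ih =>
    rw [pow_succ, derivative_mul, ih, Finset.sum_range_succ, Finset.sum_mul]
    congr 1
    · refine Finset.sum_congr rfl fun j hj => ?_
      have := Finset.mem_range.1 hj
      rw [mul_assoc, ← pow_succ]
      congr 2
      lia
    · simp

theorem add_pow_eq_add_sum_coeff (a b : A) {n : ℕ} (hn : 0 < n) :
    (a + b) ^ n =
      a ^ n + b ^ n + ∑ i ∈ Finset.Icc 1 (n - 1), ((C a * X + C b) ^ n).coeff i := by
  set h : A[X] := C a * X + C b with hh
  have hdeg : (h ^ n).natDegree ≤ n :=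
    natDegree_pow_le.trans ((Nat.mul_le_mul_left n natDegree_linear_le).trans_eq (mul_one n))
  -- Evaluation at the central element `1` is multiplicative although `A` is not commutative.
  have heval : (h ^ n).eval 1 = (a + b) ^ n := by
    refine (map_pow (eval₂RingHom' (RingHom.id A) 1 fun a => Commute.one_right _) h n).trans ?_
    congr 1
    change h.eval 1 = _
    simp [hh]
  have hbot : (h ^ n).coeff 0 = b ^ n := by
    refine (map_pow (constantCoeff (R := A)) h n).trans ?_
    simp [hh]
  have htop : (h ^ n).coeff n = a ^ n := by
    simpa [hh] using coeff_pow_of_natDegree_le (p := h) (n := 1) (m := n) natDegree_linear_le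
  have hIcc : Finset.Icc 1 (n - 1) = Finset.Ico (0 + 1) n := by
    ext i
    simp only [Finset.mem_Icc, Finset.mem_Ico]
    lia
  rw [← heval, eval_eq_sum_range' (Nat.lt_succ_of_le hdeg)]
  simp only [one_pow, mul_one]
  rw [Finset.sum_range_succ, htop, Finset.range_eq_Ico, Finset.sum_eq_sum_Ico_succ_bot hn, hbot,
    hIcc]
  abel

theorem map_wordSum_ad (σ : M →ₗ⁅k⁆ A) (a b c : M) (n s : ℕ) :
    σ (wordSum (LieAlgebra.ad k M a) (LieAlgebra.ad k M b) n s c) =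
      ((LieAlgebra.ad k A[X] (C (σ a) * X + C (σ b)) ^ n) (C (σ c))).coeff s := by
  induction n generalizing s with
  | zero => cases s <;> simp [wordSum]
  | succ n ih =>
    have hX : ∀ (u : A) (g : A[X]), C u * X * g = C u * g * X := fun u g => by
      rw [mul_assoc, X_mul, mul_assoc]
    rw [pow_succ', Module.End.mul_apply, LieAlgebra.ad_apply, LieRing.of_associative_ring_bracket]
    cases s with
    | zero =>
      simp [wordSum_succ_zero, LieRing.of_associative_ring_bracket, ih, add_mul, mul_add, hX,
        ← mul_assoc]
    | succ s =>
      simp [wordSum_succ_succ, LieRing.of_associative_ring_bracket, ih, add_mul, mul_add, hX,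
        ← mul_assoc, coeff_mul_X]
      abel

theorem map_jacobsonTerm {p : ℕ} [CharP k p] (hp : p.Prime) (σ : M →ₗ⁅k⁆ A) (a b : M) {i : ℕ}
    (hi : i ∈ Finset.Icc 1 (p - 1)) :
    σ (jacobsonTerm k p i a b) = ((C (σ a) * X + C (σ b)) ^ p).coeff i := by
  obtain ⟨hi1, hip⟩ := Finset.mem_Icc.1 hi
  set h : A[X] := C (σ a) * X + C (σ b) with hh
  have hpA : (p : A[X]) = 0 := by
    rw [← map_natCast (algebraMap k A[X]), CharP.cast_eq_zero, map_zero]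
  have hderiv : derivative (h ^ p) = (LieAlgebra.ad k A[X] h ^ (p - 1)) (C (σ a)) := by
    rw [ad_pow_prime_sub_one hp hpA, derivative_pow_eq_sum]
    simp [hh]
  have hi0 : (i : k) ≠ 0 := by
    rw [Ne, CharP.cast_eq_zero_iff k p]
    exact Nat.not_dvd_of_pos_of_lt hi1 (by have := hp.one_le; lia)
  have hcast : ((i - 1 : ℕ) : A) + 1 = algebraMap k A (i : k) := by
    rw [map_natCast, ← Nat.cast_succ, Nat.succ_eq_add_one, Nat.sub_add_cancel hi1]
  rw [jacobsonTerm_eq_smul_wordSum, map_smul, map_wordSum_ad σ, ← hh, ← hderiv,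
    coeff_derivative, hcast, Nat.sub_add_cancel hi1, ← Algebra.commutes, ← Algebra.smul_def,
    smul_smul, inv_mul_cancel₀ hi0, one_smul]

theorem map_add_pow_prime {p : ℕ} [CharP k p] (hp : p.Prime) (σ : M →ₗ⁅k⁆ A) (a b : M) :
    (σ a + σ b) ^ p = σ a ^ p + σ b ^ p +
      σ (∑ i ∈ Finset.Icc 1 (p - 1), jacobsonTerm k p i a b) := by
  rw [add_pow_eq_add_sum_coeff _ _ hp.pos, map_sum,
    Finset.sum_congr rfl fun i hi => map_jacobsonTerm hp σ a b hi]

end Jacobson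

/-! ### The natural action is a restricted representation -/

section Action

attribute [local instance] LieRing.ofAssociativeRing

variable {k X L : Type*} [Field k] [CommRing X] [Algebra k X] [LieRing L] [LieAlgebra k L]

theorem tensorAlgebra_induction_left {P : TensorAlgebra k X → Prop} (one : P 1)
    (add : ∀ v w, P v → P w → P (v + w)) (smul : ∀ (c : k) w, P w → P (c • w))
    (ι_mul : ∀ x w, P w → P (TensorAlgebra.ι k x * w)) (w : TensorAlgebra k X) : P w := by
  suffices hmul : ∀ w v : TensorAlgebra k X, P v → P (w * v) by simpa using hmul w 1 one
  intro w
  induction w using TensorAlgebra.induction with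
  | algebraMap r => intro v hv; rw [← Algebra.smul_def]; exact smul r v hv
  | ι x => exact ι_mul x
  | mul a b ha hb => intro v hv; rw [mul_assoc]; exact ha _ (hb v hv)
  | add a b ha hb => intro v hv; rw [add_mul]; exact add _ _ (ha v hv) (hb v hv)

theorem wreath_induction {P : Wreath k X L → Prop} (tmul : ∀ (x : X) (a : L), P ⟨x ⊗ₜ a, 0⟩)
    (der : ∀ δ, P ⟨0, δ⟩) (add : ∀ u v, P u → P v → P (u + v)) (u : Wreath k X L) : P u := by
  obtain ⟨t, δ⟩ := u
  have hsplit : (⟨t, δ⟩ : Wreath k X L) = ⟨t, 0⟩ + ⟨0, δ⟩ := by simp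
  rw [hsplit]
  refine add _ _ ?_ (der δ)
  clear hsplit
  induction t with
  | zero => exact der 0
  | tmul x a => exact tmul x a
  | add s t hs ht =>
    have hadd : (⟨s + t, 0⟩ : Wreath k X L) = ⟨s, 0⟩ + ⟨t, 0⟩ := by simp
    rw [hadd]
    exact add _ _ hs ht

theorem wreath_lie_tmul_tmul (x y : X) (a b : L) :
    ⁅(⟨x ⊗ₜ a, 0⟩ : Wreath k X L), (⟨y ⊗ₜ b, 0⟩ : Wreath k X L)⁆ = ⟨(x * y) ⊗ₜ ⁅a, b⁆, 0⟩ := by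
  simp

theorem wreath_lie_der_tmul (δ : Derivation k X X) (x : X) (a : L) :
    ⁅(⟨0, δ⟩ : Wreath k X L), (⟨x ⊗ₜ a, 0⟩ : Wreath k X L)⁆ = ⟨δ x ⊗ₜ a, 0⟩ := by
  have hδ : derAction k X L δ (x ⊗ₜ a) = δ x ⊗ₜ a := rfl
  simp [hδ]

theorem wreath_lie_der_der (δ ε : Derivation k X X) :
    ⁅(⟨0, δ⟩ : Wreath k X L), (⟨0, ε⟩ : Wreath k X L)⁆ = ⟨0, ⁅δ, ε⁆⟩ := by
  simp

/-- The action of the wreath product on `X ⊗ T(X)`, where `L` acts on the factor `T(X)` through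
`act ψ` and `X` acts on itself by multiplication. Concatenation intertwines it, along `ψ`, with
`act ψ`; see `act_consTensor`. -/
def wreathAct (ψ : L →ₗ⁅k⁆ Wreath k X L) :
    Wreath k X L →ₗ[k] Module.End k (X ⊗[k] TensorAlgebra k X) :=
  TensorProduct.homTensorHomMap (RingHom.id k) X (TensorAlgebra k X) X (TensorAlgebra k X) ∘ₗ
      TensorProduct.map (LinearMap.mul k X) (act ψ) ∘ₗ
      LieAlgebra.SemiDirectSum.projl (derAction k X L) +
    { toFun := fun u => (u.right : X →ₗ[k] X).rTensor (TensorAlgebra k X)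
      map_add' := fun u v => by
        rw [← LinearMap.rTensor_add]
        rfl
      map_smul' := fun c u => by
        rw [RingHom.id_apply, ← LinearMap.rTensor_smul]
        rfl }

theorem wreathAct_tmul (ψ : L →ₗ⁅k⁆ Wreath k X L) (y : X) (a : L) :
    wreathAct ψ ⟨y ⊗ₜ a, 0⟩ = TensorProduct.map (LinearMap.mul k X y) (act ψ a) := by
  ext
  simp [wreathAct]

theorem wreathAct_der (ψ : L →ₗ⁅k⁆ Wreath k X L) (δ : Derivation k X X) :
    wreathAct ψ ⟨0, δ⟩ = (δ : X →ₗ[k] X).rTensor (TensorAlgebra k X) := by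
  ext
  simp [wreathAct]

variable (k X) in
/-- Concatenation of a letter and a tensor. -/
def consTensor : X ⊗[k] TensorAlgebra k X →ₗ[k] TensorAlgebra k X :=
  TensorProduct.lift (LinearMap.mul k (TensorAlgebra k X) ∘ₗ TensorAlgebra.ι k)

theorem consTensor_tmul (x : X) (w : TensorAlgebra k X) :
    consTensor k X (x ⊗ₜ w) = TensorAlgebra.ι k x * w := by
  simp [consTensor]

theorem act_consTensor (ψ : L →ₗ⁅k⁆ Wreath k X L) (a : L) (z : X ⊗[k] TensorAlgebra k X) :
    act ψ a (consTensor k X z) = consTensor k X (wreathAct ψ (ψ a) z) := by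
  induction z with
  | zero => simp
  | add u v hu hv => simp only [map_add, hu, hv]
  | tmul x w =>
    rw [consTensor_tmul, act_ι_mul]
    change TensorProduct.lift _ (ψ a).left + TensorAlgebra.ι k ((ψ a).right x) * w = _
    generalize ψ a = u
    induction u using wreath_induction with
    | tmul y b => simp [wreathAct_tmul, consTensor_tmul, mul_comm]
    | der δ => simp [wreathAct_der, consTensor_tmul]
    | add u v hu hv =>
      rw [map_add, LinearMap.add_apply, map_add, ← hu, ← hv]
      simp only [LieAlgebra.SemiDirectSum.add_eq_mk, map_add, Derivation.add_apply, add_mul]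
      abel

theorem wreathAct_lie_tmul (ψ : L →ₗ⁅k⁆ Wreath k X L) {w : TensorAlgebra k X}
    (hw : ∀ a b, act ψ ⁅a, b⁆ w = ⁅act ψ a, act ψ b⁆ w) (u v : Wreath k X L) (x : X) :
    wreathAct ψ ⁅u, v⁆ (x ⊗ₜ w) = ⁅wreathAct ψ u, wreathAct ψ v⁆ (x ⊗ₜ w) := by
  have der_tmul : ∀ (δ : Derivation k X X) (y : X) (a : L),
      wreathAct ψ ⁅(⟨0, δ⟩ : Wreath k X L), (⟨y ⊗ₜ a, 0⟩ : Wreath k X L)⁆ (x ⊗ₜ w) =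
        ⁅wreathAct ψ ⟨0, δ⟩, wreathAct ψ ⟨y ⊗ₜ a, 0⟩⁆ (x ⊗ₜ w) := fun δ y a => by
    rw [wreath_lie_der_tmul]
    simp [LieRing.of_associative_ring_bracket, wreathAct_tmul, wreathAct_der,
      TensorProduct.add_tmul, mul_comm]
  induction u using wreath_induction with
  | add u u' h h' => simp only [add_lie, map_add, LinearMap.add_apply, h, h']
  | tmul y a =>
    induction v using wreath_induction with
    | add v v' h h' => simp only [lie_add, map_add, LinearMap.add_apply, h, h']
    | tmul z b =>
      simp only [wreath_lie_tmul_tmul, LieRing.of_associative_ring_bracket, wreathAct_tmul,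
        TensorProduct.map_tmul, hw, TensorProduct.tmul_sub, LinearMap.mul_apply',
        LinearMap.sub_apply, Module.End.mul_apply]
      rw [mul_assoc, mul_left_comm z y x]
    | der δ =>
      rw [← lie_skew, map_neg, LinearMap.neg_apply, der_tmul, ← lie_skew, LinearMap.neg_apply,
        neg_neg]
  | der δ =>
    induction v using wreath_induction with
    | add v v' h h' => simp only [lie_add, map_add, LinearMap.add_apply, h, h']
    | tmul y a => exact der_tmul δ y a
    | der ε =>
      simp only [wreath_lie_der_der, LieRing.of_associative_ring_bracket, wreathAct_der,
        LinearMap.sub_apply, Module.End.mul_apply, LinearMap.rTensor_tmul, Derivation.coeFn_coe,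
        Derivation.commutator_apply, TensorProduct.sub_tmul]

theorem act_lie (ψ : L →ₗ⁅k⁆ Wreath k X L) (a b : L) : act ψ ⁅a, b⁆ = ⁅act ψ a, act ψ b⁆ := by
  ext w
  induction w using tensorAlgebra_induction_left generalizing a b with
  | one => simp [LieRing.of_associative_ring_bracket, act_one]
  | add v w hv hw => simp only [map_add, hv, hw]
  | smul c w hw => simp only [map_smul, hw]
  | ι_mul x w hw =>
    rw [← consTensor_tmul, act_consTensor, LieHom.map_lie, wreathAct_lie_tmul ψ hw]
    simp only [LieRing.of_associative_ring_bracket, LinearMap.sub_apply, Module.End.mul_apply,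
      map_sub, act_consTensor]

/-- The natural action `act ψ` as a homomorphism of Lie algebras. -/
def actHom (ψ : L →ₗ⁅k⁆ Wreath k X L) : L →ₗ⁅k⁆ Module.End k (TensorAlgebra k X) :=
  { act ψ with map_lie' := act_lie ψ _ _ }

theorem actHom_ne_one (ψ : L →ₗ⁅k⁆ Wreath k X L) (a : L) : actHom ψ a ≠ 1 := by
  intro ha
  have h_one : (0 : TensorAlgebra k X) = 1 := (act_one ψ a).symm.trans (LinearMap.congr_fun ha 1)
  exact zero_ne_one h_one

/-- The action `wreathAct ψ` as a homomorphism of Lie algebras. -/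
def wreathActHom (ψ : L →ₗ⁅k⁆ Wreath k X L) :
    Wreath k X L →ₗ⁅k⁆ Module.End k (X ⊗[k] TensorAlgebra k X) :=
  { wreathAct ψ with
    map_lie' := fun {u v} => TensorProduct.ext' fun x w =>
      wreathAct_lie_tmul ψ (fun a b => LinearMap.congr_fun (act_lie ψ a b) w) u v x }

theorem act_pow_consTensor (ψ : L →ₗ⁅k⁆ Wreath k X L) (a : L) (z : X ⊗[k] TensorAlgebra k X)
    (n : ℕ) :
    (act ψ a ^ n) (consTensor k X z) = consTensor k X ((wreathAct ψ (ψ a) ^ n) z) := by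
  induction n with
  | zero => simp
  | succ n ih =>
    rw [pow_succ', Module.End.mul_apply, ih, act_consTensor, pow_succ', Module.End.mul_apply]

section Restricted

variable {p : ℕ} [CharP k p] {pw : L → L} {ψ : L →ₗ⁅k⁆ Wreath k X L}

theorem wreathAct_pMap_tmul (hp : p.Prime) {q : Wreath k X L → Wreath k X L}
    (hq : IsPMap k p q) (hq_tmul : ∀ (x : X) (a : L), q ⟨x ⊗ₜ[k] a, 0⟩ = ⟨(x ^ p) ⊗ₜ[k] pw a, 0⟩)
    (hq_der : ∀ δ : Derivation k X X,
      (q ⟨0, δ⟩).left = 0 ∧ ∀ x : X, (q ⟨0, δ⟩).right x = (⇑δ)^[p] x)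
    {w : TensorAlgebra k X} (hw : ∀ a, act ψ (pw a) w = (act ψ a ^ p) w)
    (u : Wreath k X L) (x : X) :
    wreathAct ψ (q u) (x ⊗ₜ w) = (wreathAct ψ u ^ p) (x ⊗ₜ w) := by
  induction u using wreath_induction with
  | tmul y b =>
    have hpow : LinearMap.mul k X y ^ p = LinearMap.mul k X (y ^ p) := LinearMap.pow_mulLeft k X y p
    rw [hq_tmul, wreathAct_tmul, wreathAct_tmul, TensorProduct.map_pow, hpow]
    simp [hw]
  | der δ =>
    have hqδ : q ⟨0, δ⟩ = ⟨0, (q ⟨0, δ⟩).right⟩ :=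
      LieAlgebra.SemiDirectSum.ext (hq_der δ).1 rfl
    rw [hqδ, wreathAct_der, wreathAct_der, LinearMap.rTensor_pow]
    simp only [LinearMap.rTensor_tmul, Module.End.pow_apply, Derivation.coeFn_coe, (hq_der δ).2]
  | add u v hu hv =>
    have jacobson : (wreathAct ψ u + wreathAct ψ v) ^ p = wreathAct ψ u ^ p + wreathAct ψ v ^ p +
        wreathAct ψ (∑ i ∈ Finset.Icc 1 (p - 1), jacobsonTerm k p i u v) :=
      map_add_pow_prime hp (wreathActHom ψ) u v
    rw [hq.add, map_add, map_add, map_add, jacobson]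
    simp only [LinearMap.add_apply, hu, hv]

theorem act_pw (hp : p ≠ 0) (hres : IsRestricted p pw ψ) (a : L) :
    act ψ (pw a) = act ψ a ^ p := by
  have hprime : p.Prime := (CharP.char_is_prime_or_zero k p).resolve_right hp
  obtain ⟨-, q, hq, hq_tmul, hq_der, hψ⟩ := hres hp
  ext w
  induction w using tensorAlgebra_induction_left generalizing a with
  | one =>
    rw [act_one, ← Nat.sub_add_cancel hprime.one_le, pow_succ, Module.End.mul_apply, act_one,
      map_zero]
  | add v w hv hw => simp only [map_add, hv, hw]
  | smul c w hw => simp only [map_smul, hw]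
  | ι_mul x w hw =>
    rw [← consTensor_tmul, act_consTensor, act_pow_consTensor, hψ,
      wreathAct_pMap_tmul hprime hq hq_tmul hq_der hw]

end Restricted

section Faithful

variable {ψ : L →ₗ⁅k⁆ Wreath k X L}

theorem IsFaithful.actHom_injective (hfaith : IsFaithful ψ) : Function.Injective (actHom ψ) :=
  (injective_iff_map_eq_zero _).2 fun a ha => hfaith a fun w => LinearMap.congr_fun ha w

theorem IsFaithful.injective (hfaith : IsFaithful ψ) : Function.Injective ψ := by
  refine (injective_iff_map_eq_zero _).2 fun a ha => hfaith a fun w => ?_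
  induction w using tensorAlgebra_induction_left with
  | one => exact act_one ψ a
  | add v w hv hw => rw [map_add, hv, hw, add_zero]
  | smul c w hw => rw [map_smul, hw, smul_zero]
  | ι_mul x w _ =>
    rw [← consTensor_tmul, act_consTensor, ha, map_zero, LinearMap.zero_apply, map_zero]

end Faithful

end Action

/-! ### Multiplicative families and generation -/

section Generation

variable {k L : Type*} [Field k] [LieRing L] [LieAlgebra k L] {p : ℕ} {pw : L → L}

theorem IsPMap.map_zero (hp : p ≠ 0) (h : IsPMap k p pw) : pw 0 = 0 := by
  have := h.smul 0 0
  rwa [zero_smul, zero_pow hp, zero_smul] at this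

section Sums

variable {ι κ : Type*} {P : ι → Submodule k L} {Q : κ → Submodule k L} {R : Submodule k L}

theorem lie_mem_of_mem_iSup (h : ∀ i j, ∀ a ∈ P i, ∀ b ∈ Q j, ⁅a, b⁆ ∈ R) {a b : L}
    (ha : a ∈ ⨆ i, P i) (hb : b ∈ ⨆ j, Q j) : ⁅a, b⁆ ∈ R := by
  induction ha using Submodule.iSup_induction' with
  | zero => simp
  | add x y _ _ hx hy => rw [add_lie]; exact add_mem hx hy
  | mem i x hx =>
    induction hb using Submodule.iSup_induction' with
    | zero => simp
    | add y z _ _ hy hz => rw [lie_add]; exact add_mem hy hz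
    | mem j y hy => exact h i j x hx y hy

theorem pw_mem_of_mem_iSup (hp : p ≠ 0) (hpm : IsPMap k p pw) (h : ∀ i, ∀ a ∈ P i, pw a ∈ R)
    (hjac : ∀ a ∈ ⨆ i, P i, ∀ b ∈ ⨆ i, P i, ∀ r, jacobsonTerm k p r a b ∈ R) {a : L}
    (ha : a ∈ ⨆ i, P i) : pw a ∈ R := by
  induction ha using Submodule.iSup_induction' with
  | zero => rw [hpm.map_zero hp]; exact zero_mem _
  | mem i x hx => exact h i x hx
  | add x y hx hy hx' hy' =>
    rw [hpm.add]
    exact add_mem (add_mem hx' hy') (sum_mem fun r _ => hjac x hx y hy r)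

theorem mem_of_mem_iSup_of_le {ℒ : ι → Submodule k L} (hind : iSupIndep ℒ)
    (hP : ∀ i, P i ≤ ℒ i) {i : ι} {a : L} (ha : a ∈ ℒ i) (ha' : a ∈ ⨆ j, P j) : a ∈ P i := by
  have hsplit : ⨆ j, P j ≤ P i ⊔ ⨆ (j) (_ : j ≠ i), ℒ j := by
    refine iSup_le fun j => ?_
    by_cases hj : j = i
    · exact hj ▸ le_sup_left
    · exact (hP j).trans (le_trans (le_iSup₂_of_le j hj le_rfl) le_sup_right)
  obtain ⟨x, hx, y, hy, rfl⟩ := Submodule.mem_sup.1 (hsplit ha')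
  have hy0 : y = 0 :=
    Submodule.disjoint_def.1 (hind i) y (by simpa using sub_mem ha (hP i hx)) hy
  rwa [hy0, add_zero]

end Sums

section Words

variable {ι : Type*} [AddCommMonoid ι] {P : ι → Submodule k L}

theorem wordSum_ad_mem (hP : ∀ {i j : ι} {a b : L}, a ∈ P i → b ∈ P j → ⁅a, b⁆ ∈ P (i + j))
    {i j : ι} {a b c : L} (ha : a ∈ P i) (hb : b ∈ P i) (hc : c ∈ P j) (n s : ℕ) :
    wordSum (LieAlgebra.ad k L a) (LieAlgebra.ad k L b) n s c ∈ P (n • i + j) := by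
  induction n generalizing s with
  | zero => cases s <;> simp [wordSum, hc]
  | succ n ih =>
    rw [succ_nsmul', add_assoc]
    cases s with
    | zero => rw [wordSum_succ_zero]; exact hP hb (ih 0)
    | succ s => rw [wordSum_succ_succ]; exact add_mem (hP ha (ih s)) (hP hb (ih (s + 1)))

theorem jacobsonTerm_mem (hP : ∀ {i j : ι} {a b : L}, a ∈ P i → b ∈ P j → ⁅a, b⁆ ∈ P (i + j))
    {i : ι} {a b : L} (ha : a ∈ P i) (hb : b ∈ P i) (hp : p ≠ 0) (r : ℕ) :
    jacobsonTerm k p r a b ∈ P (p • i) := by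
  rw [jacobsonTerm_eq_smul_wordSum, ← Nat.sub_add_cancel (Nat.one_le_iff_ne_zero.2 hp),
    succ_nsmul, Nat.add_sub_cancel]
  exact Submodule.smul_mem _ _ (wordSum_ad_mem hP ha hb ha _ _)

end Words

variable (p pw) in
/-- A family of subspaces of a restricted Lie algebra, indexed by an additive monoid, that is
compatible with the bracket and with the `p`-mapping: a grading, a filtration, or the family
`n ↦ S ^ n`. In characteristic `0` (that is, for `p = 0`) only the bracket counts. -/
structure IsMultiplicative {ι : Type*} [AddMonoid ι] (P : ι → Submodule k L) : Prop where
  lie_mem : ∀ {i j : ι} {a b : L}, a ∈ P i → b ∈ P j → ⁅a, b⁆ ∈ P (i + j)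
  pw_mem : p ≠ 0 → ∀ {i : ι} {a : L}, a ∈ P i → pw a ∈ P (p • i)

namespace IsMultiplicative

theorem inf {ι : Type*} [AddMonoid ι] {P Q : ι → Submodule k L}
    (hP : IsMultiplicative p pw P) (hQ : IsMultiplicative p pw Q) :
    IsMultiplicative p pw fun i => P i ⊓ Q i :=
  ⟨fun ha hb => ⟨hP.lie_mem ha.1 hb.1, hQ.lie_mem ha.2 hb.2⟩,
    fun hp _ _ ha => ⟨hP.pw_mem hp ha.1, hQ.pw_mem hp ha.2⟩⟩

end IsMultiplicative

theorem component_le_of_generated {ι : Type*} [AddMonoid ι] {ℒ Q : ι → Submodule k L}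
    (hpm : p ≠ 0 → IsPMap k p pw) (hind : iSupIndep ℒ) (hℒ : IsMultiplicative p pw ℒ)
    (hQ : IsMultiplicative p pw Q) {S : Set L}
    (hS : ∀ H : LieSubalgebra k L, (∀ s ∈ S, s ∈ H) → (p ≠ 0 → ∀ a ∈ H, pw a ∈ H) → H = ⊤)
    (hSQ : ∀ s ∈ S, ∃ d, s ∈ ℒ d ∧ s ∈ Q d) (d : ι) : ℒ d ≤ Q d := by
  let P : ι → Submodule k L := fun d => ℒ d ⊓ Q d
  have hP : IsMultiplicative p pw P := hℒ.inf hQ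
  have hPlie : ∀ {a b : L}, a ∈ ⨆ d, P d → b ∈ ⨆ d, P d → ⁅a, b⁆ ∈ ⨆ d, P d :=
    lie_mem_of_mem_iSup fun i j _ ha _ hb => Submodule.mem_iSup_of_mem (i + j) (hP.lie_mem ha hb)
  let H : LieSubalgebra k L := { (⨆ d, P d : Submodule k L) with lie_mem' := hPlie }
  have hH : H = ⊤ := by
    refine hS H (fun s hs => ?_) fun hp a ha => ?_
    · obtain ⟨d, hd⟩ := hSQ s hs
      exact Submodule.mem_iSup_of_mem (p := P) d hd
    · refine pw_mem_of_mem_iSup hp (hpm hp)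
        (fun i a ha => Submodule.mem_iSup_of_mem (p • i) (hP.pw_mem hp ha))
        (fun a ha b hb r => ?_) ha
      exact jacobsonTerm_mem (P := fun _ : PUnit => ⨆ d, P d) hPlie (i := PUnit.unit) ha hb hp r
  intro a ha
  have haP : a ∈ ⨆ d, P d := by
    change a ∈ H
    rw [hH]
    trivial
  exact (mem_of_mem_iSup_of_le hind (fun _ => inf_le_left) ha haP).2

/-- The subspaces spanned by the products of at least one and at most `t / δ` elements of `S`, for
real `t`: the filtration that `S` generates when all its elements are given the degree `δ`. -/
def powFiltration (p : ℕ) (pw : L → L) (S : Submodule k L) (δ t : ℝ) : Submodule k L :=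
  ⨆ m : {m : ℕ // 1 ≤ m ∧ m * δ ≤ t}, powSpace k p pw S m

theorem powSpace_le_powFiltration {S : Submodule k L} {δ t : ℝ} {m : ℕ} (hm : 1 ≤ m)
    (hmt : m * δ ≤ t) : powSpace k p pw S m ≤ powFiltration p pw S δ t :=
  le_iSup (fun m : {m : ℕ // 1 ≤ m ∧ m * δ ≤ t} => powSpace k p pw S m) ⟨m, hm, hmt⟩

theorem lie_mem_powFiltration {S : Submodule k L} {δ s t : ℝ} {a b : L}
    (ha : a ∈ powFiltration p pw S δ s) (hb : b ∈ powFiltration p pw S δ t) :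
    ⁅a, b⁆ ∈ powFiltration p pw S δ (s + t) := by
  unfold powFiltration at ha hb
  refine lie_mem_of_mem_iSup (fun m n a ha b hb => ?_) ha hb
  refine powSpace_le_powFiltration (m.2.1.trans (Nat.le_add_right _ _)) ?_ (MemPow.lie ha hb)
  push_cast
  linarith [m.2.2, n.2.2]

theorem pw_mem_powFiltration (hp : p ≠ 0) (hpm : IsPMap k p pw) {S : Submodule k L} {δ t : ℝ}
    {a : L} (ha : a ∈ powFiltration p pw S δ t) : pw a ∈ powFiltration p pw S δ (p • t) := by
  have hjac : ∀ a ∈ powFiltration p pw S δ t, ∀ b ∈ powFiltration p pw S δ t, ∀ r,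
      jacobsonTerm k p r a b ∈ powFiltration p pw S δ (p • t) := fun a ha b hb r =>
    jacobsonTerm_mem (P := powFiltration p pw S δ) lie_mem_powFiltration ha hb hp r
  refine pw_mem_of_mem_iSup hp hpm (fun m a ha => ?_) hjac ha
  refine powSpace_le_powFiltration (Nat.one_le_iff_ne_zero.2 (mul_ne_zero hp (by lia))) ?_
    (MemPow.pw hp ha)
  rw [nsmul_eq_mul, Nat.cast_mul, mul_assoc]
  exact mul_le_mul_of_nonneg_left m.2.2 (Nat.cast_nonneg p)

theorem isMultiplicative_powFiltration (hpm : p ≠ 0 → IsPMap k p pw) (S : Submodule k L)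
    (δ : ℝ) : IsMultiplicative p pw (powFiltration p pw S δ) :=
  ⟨lie_mem_powFiltration, fun hp _ _ => pw_mem_powFiltration hp (hpm hp)⟩

theorem component_le_powFiltration (hpm : p ≠ 0 → IsPMap k p pw) {ℒ : ℝ → Submodule k L}
    (hind : iSupIndep ℒ) (hℒ : IsMultiplicative p pw ℒ) {S : Set L}
    (hS : ∀ H : LieSubalgebra k L, (∀ s ∈ S, s ∈ H) → (p ≠ 0 → ∀ a ∈ H, pw a ∈ H) → H = ⊤)
    {δ : ℝ} (hSδ : ∀ s ∈ S, ∃ d ≥ δ, s ∈ ℒ d) (d : ℝ) :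
    ℒ d ≤ powFiltration p pw (Submodule.span k S) δ d := by
  refine component_le_of_generated hpm hind hℒ (isMultiplicative_powFiltration hpm _ δ) hS
    (fun s hs => ?_) d
  obtain ⟨d, hd, hsd⟩ := hSδ s hs
  exact ⟨d, hsd, powSpace_le_powFiltration le_rfl (by simpa using hd)
    (MemPow.of (Submodule.subset_span hs))⟩

/-! ### Finite-dimensionality of the spaces `S ^ n` -/

theorem powSpace_zero (hpm : p ≠ 0 → IsPMap k p pw) (S : Submodule k L) :
    powSpace k p pw S 0 = ⊥ := by
  have eq_zero : ∀ {n : ℕ} {a : L}, MemPow k p pw S n a → n = 0 → a = 0 := by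
    intro n a h hn
    induction h with
    | of _ => simp at hn
    | zero => rfl
    | add _ _ iha ihb => rw [iha hn, ihb hn, add_zero]
    | smul c _ iha => rw [iha hn, smul_zero]
    | lie _ _ iha _ => rw [iha (by lia), zero_lie]
    | pw hp _ iha =>
      rw [iha ((Nat.mul_eq_zero.1 hn).resolve_left hp), (hpm hp).map_zero hp]
  exact (Submodule.eq_bot_iff _).2 fun a ha => eq_zero ha rfl

variable (p pw) in
/-- The span of the brackets of `S ^ i` with `S ^ j` for `i + j = n`. -/
def bracketSpan (S : Submodule k L) (n : ℕ) : Submodule k L :=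
  ⨆ ij ∈ Finset.HasAntidiagonal.antidiagonal n,
    Submodule.map₂ (LieModule.toEnd k L L : L →ₗ[k] Module.End k L)
      (powSpace k p pw S ij.1) (powSpace k p pw S ij.2)

theorem lie_mem_bracketSpan {S : Submodule k L} {i j n : ℕ} (hij : i + j = n) {a b : L}
    (ha : a ∈ powSpace k p pw S i) (hb : b ∈ powSpace k p pw S j) :
    ⁅a, b⁆ ∈ bracketSpan p pw S n :=
  Submodule.mem_iSup_of_mem (i, j) (Submodule.mem_iSup_of_mem
    (Finset.HasAntidiagonal.mem_antidiagonal.2 hij) (Submodule.apply_mem_map₂ _ ha hb))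

theorem jacobsonTerm_mem_bracketSpan (hp : 2 ≤ p) {S : Submodule k L} {m : ℕ} {a b : L}
    (ha : a ∈ powSpace k p pw S m) (hb : b ∈ powSpace k p pw S m) (r : ℕ) :
    jacobsonTerm k p r a b ∈ bracketSpan p pw S (p * m) := by
  obtain ⟨q, rfl⟩ := Nat.exists_eq_add_of_le' hp
  have hword : ∀ s, wordSum (LieAlgebra.ad k L a) (LieAlgebra.ad k L b) q s a ∈
      powSpace k (q + 2) pw S (q • m + m) := wordSum_ad_mem MemPow.lie ha hb ha q
  have hdeg : m + (q • m + m) = (q + 2) * m := by rw [smul_eq_mul]; ring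
  rw [jacobsonTerm_eq_smul_wordSum]
  refine Submodule.smul_mem _ _ ?_
  change wordSum (LieAlgebra.ad k L a) (LieAlgebra.ad k L b) (q + 1) (r - 1) a ∈ _
  cases r - 1 with
  | zero => rw [wordSum_succ_zero]; exact lie_mem_bracketSpan hdeg hb (hword 0)
  | succ s =>
    rw [wordSum_succ_succ]
    exact add_mem (lie_mem_bracketSpan hdeg ha (hword s))
      (lie_mem_bracketSpan hdeg hb (hword (s + 1)))

theorem pw_mem_of_mem_span (hpm : IsPMap k p pw) (hp : 2 ≤ p) {S : Submodule k L} {m : ℕ}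
    {B : Set L} (hB : Submodule.span k B = powSpace k p pw S m) {a : L}
    (ha : a ∈ powSpace k p pw S m) :
    pw a ∈ bracketSpan p pw S (p * m) ⊔ Submodule.span k (pw '' B) := by
  have hspan : ⨆ b : B, Submodule.span k {(b : L)} = powSpace k p pw S m := by
    rw [← hB, Submodule.span_eq_iSup_of_singleton_spans B]
    exact iSup_subtype'' B fun x => Submodule.span k {x}
  rw [← hspan] at ha
  refine pw_mem_of_mem_iSup (by lia) hpm (fun b a ha => ?_) (fun x hx y hy r => ?_) ha
  · obtain ⟨c, rfl⟩ := Submodule.mem_span_singleton.1 ha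
    rw [hpm.smul]
    exact Submodule.mem_sup_right
      (Submodule.smul_mem _ _ (Submodule.subset_span ⟨b, b.2, rfl⟩))
  · rw [hspan] at hx hy
    exact Submodule.mem_sup_left (jacobsonTerm_mem_bracketSpan hp hx hy r)

theorem powSpace_le_sup (hpm : p ≠ 0 → IsPMap k p pw) (hp : p ≠ 0 → 2 ≤ p) {S : Submodule k L}
    {n : ℕ} (hn : 0 < n) {B : ℕ → Set L}
    (hB : ∀ m < n, Submodule.span k (B m) = powSpace k p pw S m) :
    powSpace k p pw S n ≤
      S ⊔ (bracketSpan p pw S n ⊔ ⨆ m ∈ Finset.range n, Submodule.span k (pw '' B m)) := by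
  suffices key : ∀ m a, MemPow k p pw S m a → m = n → a ∈
      S ⊔ (bracketSpan p pw S n ⊔ ⨆ m ∈ Finset.range n, Submodule.span k (pw '' B m)) from
    fun a ha => key n a ha rfl
  intro m a h hm
  induction h with
  | of h => exact Submodule.mem_sup_left h
  | zero => exact zero_mem _
  | add _ _ iha ihb => exact add_mem (iha hm) (ihb hm)
  | smul c _ iha => exact Submodule.smul_mem _ c (iha hm)
  | lie ha hb _ _ =>
    exact Submodule.mem_sup_right (Submodule.mem_sup_left (lie_mem_bracketSpan hm ha hb))
  | @pw m a hp0 ha _ =>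
    have hmn : m < n := by have := hp hp0; nlinarith
    have hle : Submodule.span k (pw '' B m) ≤
        ⨆ m ∈ Finset.range n, Submodule.span k (pw '' B m) :=
      le_iSup₂_of_le m (Finset.mem_range.2 hmn) le_rfl
    have hpw := pw_mem_of_mem_span (hpm hp0) (hp hp0) (hB m hmn) ha
    rw [hm] at hpw
    exact Submodule.mem_sup_right (sup_le_sup_left hle _ hpw)

theorem bracketSpan_fg (hpm : p ≠ 0 → IsPMap k p pw) {S : Submodule k L} {n : ℕ}
    (hfg : ∀ m < n, (powSpace k p pw S m).FG) : (bracketSpan p pw S n).FG := by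
  refine Submodule.fg_biSup _ _ fun ⟨i, j⟩ hij => ?_
  have hij := Finset.HasAntidiagonal.mem_antidiagonal.1 hij
  obtain rfl | hi := Nat.eq_zero_or_pos i
  · rw [powSpace_zero hpm, Submodule.map₂_bot_left]
    exact Submodule.fg_bot
  obtain rfl | hj := Nat.eq_zero_or_pos j
  · rw [powSpace_zero hpm, Submodule.map₂_bot_right]
    exact Submodule.fg_bot
  exact (hfg i (by lia)).map₂ _ (hfg j (by lia))

theorem powSpace_fg [CharP k p] (hpm : p ≠ 0 → IsPMap k p pw) {S : Submodule k L} (hS : S.FG)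
    (n : ℕ) : (powSpace k p pw S n).FG := by
  induction n using Nat.strong_induction_on with
  | _ n ih =>
  obtain rfl | hn := Nat.eq_zero_or_pos n
  · rw [powSpace_zero hpm]
    exact Submodule.fg_bot
  have hp : p ≠ 0 → 2 ≤ p := fun hp => ((CharP.char_is_prime_or_zero k p).resolve_right hp).two_le
  have hbracket := bracketSpan_fg hpm ih
  choose! B hB using ih
  have hfg := hS.sup (hbracket.sup (Submodule.fg_biSup (Finset.range n) _ fun m _ =>
    Submodule.fg_span ((B m).finite_toSet.image pw)))
  have := (Submodule.fg_iff_finiteDimensional _).1 hfg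
  exact (Submodule.fg_iff_finiteDimensional _).2
    (Submodule.finiteDimensional_of_le (powSpace_le_sup hpm hp hn hB))

theorem powSpaceLE_finiteDimensional [CharP k p] (hpm : p ≠ 0 → IsPMap k p pw)
    {S : Submodule k L} (hS : S.FG) (n : ℕ) : FiniteDimensional k (powSpaceLE k p pw S n) :=
  (Submodule.fg_iff_finiteDimensional _).1
    (Submodule.fg_biSup _ _ fun m _ => powSpace_fg hpm hS m)

end Generation

/-! ### Growth of graded self-similar Lie algebras -/

section RealGrowth

theorem pow_rpow_logb {lam m : ℝ} (hlam : 1 < lam) (hm : 0 < m) (n : ℕ) :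
    (lam ^ n) ^ Real.logb lam m = m ^ n := by
  have h0 : 0 < lam := one_pos.trans hlam
  rw [← Real.rpow_natCast, ← Real.rpow_mul h0.le, mul_comm, Real.rpow_mul h0.le,
    Real.rpow_logb h0 hlam.ne' hm, Real.rpow_natCast]

variable {f : ℝ → ℝ} {m lam c : ℝ}

theorem exists_le_rpow_of_le_mul_add (hf : Monotone f) (hf0 : ∀ d, 0 ≤ f d) (hm : 2 ≤ m)
    (hlam : 1 < lam) (hc : 0 ≤ c) {D : ℝ} (hD : 0 ≤ D)
    (h : ∀ d, f d ≤ m * f ((d + c) / lam) + D) :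
    ∃ C > 0, ∀ d ≥ 1, f d ≤ C * d ^ Real.logb lam m := by
  have h1 : 0 < lam - 1 := by linarith
  -- `e` is the fixed point of `d ↦ (d + c) / lam`
  set e := c / (lam - 1) with he
  have hiter : ∀ n : ℕ, f (e + lam ^ n) + D ≤ m ^ n * (f (e + 1) + D) := by
    intro n
    induction n with
    | zero => simp
    | succ n ih =>
      have h2 : (e + lam ^ (n + 1) + c) / lam = e + lam ^ n := by
        rw [he]
        field_simp
        ring
      have h3 := h (e + lam ^ (n + 1))
      rw [h2] at h3
      calc f (e + lam ^ (n + 1)) + D ≤ m * f (e + lam ^ n) + 2 * D := by linarith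
        _ ≤ m * f (e + lam ^ n) + m * D := by gcongr
        _ = m * (f (e + lam ^ n) + D) := by ring
        _ ≤ m * (m ^ n * (f (e + 1) + D)) := by gcongr
        _ = m ^ (n + 1) * (f (e + 1) + D) := by ring
  have hA : 0 ≤ f (e + 1) + D := add_nonneg (hf0 _) hD
  refine ⟨m * (f (e + 1) + D + 1), by nlinarith, fun d hd => ?_⟩
  obtain ⟨n, hn1, hn2⟩ := exists_nat_pow_near hd hlam
  have he0 : 0 ≤ e := by positivity
  have hθ : 0 ≤ Real.logb lam m := Real.logb_nonneg hlam (by linarith)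
  calc f d ≤ f (e + lam ^ (n + 1)) := hf (by linarith)
    _ ≤ m ^ (n + 1) * (f (e + 1) + D) := by linarith [hiter (n + 1)]
    _ ≤ m ^ (n + 1) * (f (e + 1) + D + 1) :=
      mul_le_mul_of_nonneg_left (by linarith) (by positivity)
    _ = m * (f (e + 1) + D + 1) * (lam ^ n) ^ Real.logb lam m := by
      rw [pow_rpow_logb hlam (by linarith)]
      ring
    _ ≤ m * (f (e + 1) + D + 1) * d ^ Real.logb lam m := by gcongr

theorem exists_rpow_le_of_mul_le (hf : Monotone f) (hm : 1 ≤ m) (hlam : 1 < lam) {t₀ : ℝ}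
    (ht₀ : 0 < t₀) (h1 : 1 ≤ f t₀) (h : ∀ t ≥ t₀, m * f t ≤ f (lam * t)) :
    ∃ r > 0, ∀ d ≥ t₀, r * d ^ Real.logb lam m ≤ f d := by
  have hm0 : 0 < m := one_pos.trans_le hm
  have hiter : ∀ n : ℕ, m ^ n ≤ f (lam ^ n * t₀) := by
    intro n
    induction n with
    | zero => simpa using h1
    | succ n ih =>
      have h2 : t₀ ≤ lam ^ n * t₀ := le_mul_of_one_le_left ht₀.le (one_le_pow₀ hlam.le)
      calc m ^ (n + 1) = m * m ^ n := pow_succ' _ _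
        _ ≤ m * f (lam ^ n * t₀) := by gcongr
        _ ≤ f (lam * (lam ^ n * t₀)) := h _ h2
        _ = f (lam ^ (n + 1) * t₀) := by rw [pow_succ', mul_assoc]
  set θ := Real.logb lam m
  have hθ : 0 ≤ θ := Real.logb_nonneg hlam hm
  refine ⟨(t₀ ^ θ * m)⁻¹, by positivity, fun d hd => ?_⟩
  have hd0 : 0 < d := ht₀.trans_le hd
  obtain ⟨n, hn1, hn2⟩ := exists_nat_pow_near ((one_le_div ht₀).2 hd) hlam
  have h3 : d ^ θ ≤ m ^ (n + 1) * t₀ ^ θ := by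
    rw [← pow_rpow_logb hlam hm0, ← Real.mul_rpow (by positivity) ht₀.le]
    exact Real.rpow_le_rpow hd0.le ((div_lt_iff₀ ht₀).1 hn2).le hθ
  calc (t₀ ^ θ * m)⁻¹ * d ^ θ ≤ (t₀ ^ θ * m)⁻¹ * (m ^ (n + 1) * t₀ ^ θ) := by gcongr
    _ = m ^ n := by
      have : t₀ ^ θ ≠ 0 := (Real.rpow_pos_of_pos ht₀ _).ne'
      rw [pow_succ']
      field_simp
    _ ≤ f (lam ^ n * t₀) := hiter n
    _ ≤ f d := hf ((le_div_iff₀ ht₀).1 hn1)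

theorem exists_rpow_le_of_mul_le_add (hf : Monotone f) (hm : 1 ≤ m) (hlam : 1 < lam)
    (hc : 0 ≤ c) {d₁ : ℝ} (h1 : 1 ≤ f d₁) (h : ∀ e, c ≤ lam * e → m * f e ≤ f (lam * e + c)) :
    ∃ r > 0, ∃ d₀ > 0, ∀ d ≥ d₀, r * d ^ Real.logb lam m ≤ f d := by
  have hlam1 : 0 < lam - 1 := by linarith
  -- `-s` is the fixed point of `e ↦ lam * e + c`
  set s := c / (lam - 1) with hs
  have hs0 : 0 ≤ s := by positivity
  set t₀ := max (d₁ + s) (c + s + 1)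
  have hd₁ : d₁ + s ≤ t₀ := le_max_left _ _
  have hcs : c + s + 1 ≤ t₀ := le_max_right _ _
  have hmul : ∀ t ≥ t₀, m * f (t - s) ≤ f (lam * t - s) := by
    intro t ht
    have hshift : lam * (t - s) + c = lam * t - s := by
      rw [hs]
      field_simp
      ring
    rw [← hshift]
    exact h _ (by nlinarith)
  obtain ⟨r, hr, hle⟩ := exists_rpow_le_of_mul_le (f := fun t => f (t - s))
    (fun x y hxy => hf (by linarith)) hm hlam (by linarith : 0 < t₀)
    (h1.trans (hf (by linarith))) hmul
  exact ⟨r, hr, t₀, by linarith, fun d hd => (hle d hd).trans (hf (by linarith))⟩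

end RealGrowth

section Grading

variable {k L : Type*} [Field k] [LieRing L] [LieAlgebra k L] {ℒ : ℝ → Submodule k L}

theorem degLE_mono (ℒ : ℝ → Submodule k L) : Monotone (degLE ℒ) := fun _ _ h =>
  iSup₂_le fun e he => le_iSup₂_of_le e (he.trans h) le_rfl

theorem le_degLE (ℒ : ℝ → Submodule k L) {e d : ℝ} (h : e ≤ d) : ℒ e ≤ degLE ℒ d :=
  le_iSup₂_of_le e h le_rfl

theorem exists_mem_degLE (hint : DirectSum.IsInternal ℒ) (a : L) : ∃ d, a ∈ degLE ℒ d := by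
  have ha : a ∈ ⨆ d, ℒ d := by
    rw [hint.submodule_iSup_eq_top]
    trivial
  induction ha using Submodule.iSup_induction' with
  | mem i x hx => exact ⟨i, le_degLE ℒ le_rfl hx⟩
  | zero => exact ⟨0, zero_mem _⟩
  | add x y _ _ hx hy =>
    obtain ⟨d, hd⟩ := hx
    obtain ⟨e, he⟩ := hy
    exact ⟨max d e, add_mem (degLE_mono ℒ (le_max_left _ _) hd)
      (degLE_mono ℒ (le_max_right _ _) he)⟩

theorem exists_le_degLE_of_fg (hint : DirectSum.IsInternal ℒ) {N : Submodule k L} (hN : N.FG) :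
    ∃ d, N ≤ degLE ℒ d := by
  obtain ⟨B, rfl⟩ := hN
  choose D hD using exists_mem_degLE hint
  obtain ⟨M, hM⟩ := (B.finite_toSet.image D).bddAbove
  exact ⟨M, Submodule.span_le.2 fun a ha => degLE_mono ℒ (hM ⟨a, ha, rfl⟩) (hD a)⟩

theorem exists_common_degree_bound {S : Finset L} (hS : ∀ s ∈ S, ∃ d > 0, s ∈ ℒ d) :
    ∃ δ > 0, ∀ s ∈ S, ∃ d ≥ δ, s ∈ ℒ d := by
  choose! D hD0 hD using hS
  have hne : (insert 1 (S.image D)).Nonempty := Finset.insert_nonempty _ _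
  refine ⟨(insert 1 (S.image D)).min' hne, (Finset.lt_min'_iff _ hne).2 fun y hy => ?_,
    fun s hs => ⟨D s, Finset.min'_le _ _ ?_, hD s hs⟩⟩
  · obtain rfl | hy := Finset.mem_insert.1 hy
    · exact one_pos
    · obtain ⟨s, hs, rfl⟩ := Finset.mem_image.1 hy
      exact hD0 s hs
  · exact Finset.mem_insert_of_mem (Finset.mem_image_of_mem D hs)

theorem exists_forall_abs_le_of_ne_bot {V : Type*} [AddCommGroup V] [Module k V]
    [FiniteDimensional k V] {𝒱 : ℝ → Submodule k V} (hint : DirectSum.IsInternal 𝒱) :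
    ∃ c ≥ 0, ∀ i, 𝒱 i ≠ ⊥ → |i| ≤ c := by
  have hfin : {i | 𝒱 i ≠ ⊥}.Finite :=
    WellFoundedGT.finite_ne_bot_of_iSupIndep hint.submodule_iSupIndep
  obtain ⟨M, hM⟩ := (hfin.image fun i => |i|).bddAbove
  exact ⟨max M 0, le_max_right _ _, fun i hi => (hM ⟨i, hi, rfl⟩).trans (le_max_left _ _)⟩

end Grading

section GrowthUpperBound

variable {k X L : Type*} [Field k] [CommRing X] [Algebra k X] [LieRing L] [LieAlgebra k L]
  {p : ℕ} {pw : L → L} {ψ : L →ₗ⁅k⁆ Wreath k X L} {lam : ℝ} {𝒳 : ℝ → Submodule k X}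
  {ℒ : ℝ → Submodule k L}

theorem IsGraded.isMultiplicative (hgraded : IsGraded p pw ψ lam 𝒳 ℒ) :
    IsMultiplicative p pw ℒ :=
  ⟨hgraded.lie_mem, fun hp _ _ ha => by rw [nsmul_eq_mul]; exact hgraded.pw_mem hp ha⟩

theorem exists_generation_bound (hpm : p ≠ 0 → IsPMap k p pw)
    (hgraded : IsGraded p pw ψ lam 𝒳 ℒ) (hgen : GeneratedInPositiveDegree p pw ℒ) :
    ∃ δ > 0, ∃ S : Submodule k L, S.FG ∧ (∀ d < δ, ℒ d = ⊥) ∧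
      ∀ d, degLE ℒ d ≤ powSpaceLE k p pw S ⌊d / δ⌋₊ := by
  obtain ⟨S, hSpos, hS⟩ := hgen
  obtain ⟨δ, hδ, hSδ⟩ := exists_common_degree_bound hSpos
  have hle : ∀ d, ℒ d ≤ powFiltration p pw (Submodule.span k S) δ d :=
    component_le_powFiltration hpm hgraded.internal.submodule_iSupIndep
      hgraded.isMultiplicative hS hSδ
  refine ⟨δ, hδ, Submodule.span k S, ⟨S, rfl⟩, fun d hd => ?_, fun d => ?_⟩
  · refine eq_bot_iff.2 ((hle d).trans (iSup_le fun m => ?_))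
    have hm : (1 : ℝ) ≤ m := by exact_mod_cast m.2.1
    nlinarith [m.2.2]
  · refine iSup₂_le fun e he => (hle e).trans (iSup_le fun m => ?_)
    refine le_iSup₂_of_le (f := fun m (_ : m ∈ Finset.Icc 1 ⌊d / δ⌋₊) =>
      powSpace k p pw (Submodule.span k S) m) m (Finset.mem_Icc.2 ⟨m.2.1, ?_⟩) le_rfl
    exact Nat.le_floor ((le_div_iff₀ hδ).2 (m.2.2.trans he))

variable (X) in
theorem range_lTensor_subtype (W : Submodule k L) :
    LinearMap.range (W.subtype.lTensor X) = Submodule.map₂ (TensorProduct.mk k X L) ⊤ W := by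
  rw [LinearMap.lTensor, TensorProduct.range_map, LinearMap.range_id, Submodule.range_subtype]

theorem coord_mem_range_lTensor (hlam : 0 < lam) (hgraded : IsGraded p pw ψ lam 𝒳 ℒ) {c : ℝ}
    (hc : ∀ i, 𝒳 i ≠ ⊥ → |i| ≤ c) {d : ℝ} {a : L} (ha : a ∈ degLE ℒ d) :
    coord ψ a ∈ LinearMap.range ((degLE ℒ ((d + c) / lam)).subtype.lTensor X) := by
  rw [range_lTensor_subtype]
  suffices h : degLE ℒ d ≤ (Submodule.map₂ (TensorProduct.mk k X L) ⊤
      (degLE ℒ ((d + c) / lam))).comap (coord ψ) from h ha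
  refine iSup₂_le fun e he a ha => ?_
  refine (iSup_le fun i => iSup₂_le fun j hij => ?_ : _ ≤ Submodule.map₂ _ _ _)
    (hgraded.coord_mem ha)
  rw [TensorProduct.range_map, Submodule.range_subtype, Submodule.range_subtype]
  by_cases hi : 𝒳 i = ⊥
  · simp [hi]
  · have hj : j ≤ (d + c) / lam := by
      rw [le_div_iff₀ hlam]
      linarith [neg_abs_le i, hc i hi]
    exact Submodule.map₂_le_map₂ le_top (le_degLE ℒ hj)

variable [FiniteDimensional k X]

theorem finrank_range_lTensor (W : Submodule k L) :
    Module.finrank k (LinearMap.range (W.subtype.lTensor X)) =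
      Module.finrank k X * Module.finrank k W := by
  rw [LinearMap.finrank_range_of_inj (Module.Flat.lTensor_preserves_injective_linearMap _
    W.injective_subtype), Module.finrank_tensorProduct]

theorem exists_finrank_degLE_le_mul_add (hfaith : IsFaithful ψ) (hlam : 0 < lam)
    (hgraded : IsGraded p pw ψ lam 𝒳 ℒ) (hfin : ∀ d, FiniteDimensional k (degLE ℒ d)) :
    ∃ c ≥ 0, ∀ d, Module.finrank k (degLE ℒ d) ≤
      Module.finrank k X * Module.finrank k (degLE ℒ ((d + c) / lam)) +
        Module.finrank k (X →ₗ[k] X) := by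
  obtain ⟨c, hc0, hc⟩ := exists_forall_abs_le_of_ne_bot hgraded.alphabet_internal
  refine ⟨c, hc0, fun d => ?_⟩
  set R := LinearMap.range ((degLE ℒ ((d + c) / lam)).subtype.lTensor X) with hR
  let topEnd : L →ₗ[k] (X →ₗ[k] X) :=
    { toFun := fun a => (top ψ a : X →ₗ[k] X)
      map_add' := fun a b => by ext; simp
      map_smul' := fun r a => by ext; simp }
  let f : degLE ℒ d →ₗ[k] R × (X →ₗ[k] X) :=
    LinearMap.prod ((coord ψ ∘ₗ (degLE ℒ d).subtype).codRestrict R fun a =>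
      coord_mem_range_lTensor hlam hgraded hc a.2) (topEnd ∘ₗ (degLE ℒ d).subtype)
  have hf : Function.Injective f := by
    refine (injective_iff_map_eq_zero f).2 fun a ha => ?_
    have hcoord : coord ψ a = 0 := congrArg (fun z => (z.1 : X ⊗[k] L)) ha
    have htop : topEnd a = 0 := congrArg (fun z => z.2) ha
    have hψ : ψ a = 0 := LieAlgebra.SemiDirectSum.ext hcoord
      (Derivation.ext fun x => LinearMap.congr_fun htop x)
    exact Subtype.ext ((map_eq_zero_iff ψ hfaith.injective).1 hψ)
  have := LinearMap.finrank_le_finrank_of_injective hf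
  rwa [Module.finrank_prod, hR, finrank_range_lTensor] at this

theorem derivation_eq_zero_of_finrank_le_one (h : Module.finrank k X ≤ 1)
    (δ : Derivation k X X) : δ = 0 := by
  obtain ⟨v, hv⟩ := finrank_le_one_iff.1 h
  obtain ⟨r, hr⟩ := hv 1
  ext x
  obtain ⟨s, rfl⟩ := hv x
  by_cases hr0 : r = 0
  · rw [hr0, zero_smul] at hr
    have := subsingleton_of_zero_eq_one hr
    exact Subsingleton.elim _ _
  · rw [← inv_smul_smul₀ hr0 v, hr]
    simp

theorem IsFaithful.subsingleton_of_finrank_le_one (hfaith : IsFaithful ψ)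
    (h : Module.finrank k X ≤ 1) : Subsingleton L := by
  refine ⟨fun a b => IsFaithful.actHom_injective hfaith (LinearMap.ext fun w => ?_)⟩
  suffices hact : ∀ a, act ψ a w = 0 from (hact a).trans (hact b).symm
  intro a
  induction w using tensorAlgebra_induction_left generalizing a with
  | one => exact act_one ψ a
  | add v w hv hw => rw [map_add, hv, hw, add_zero]
  | smul r w hw => rw [map_smul, hw, smul_zero]
  | ι_mul x w hw =>
    have hflip : (act ψ).flip w = 0 := LinearMap.ext hw
    rw [act_ι_mul, derivation_eq_zero_of_finrank_le_one h (top ψ a), hflip]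
    generalize coord ψ a = u
    induction u with
    | zero => simp
    | tmul y b => simp
    | add u v hu hv =>
      simp only [Derivation.zero_apply, map_zero, zero_mul, add_zero] at hu hv
      simp [hu, hv]

theorem exists_finrank_degLE_le_rpow (hfaith : IsFaithful ψ) (hlam : 1 < lam)
    (hgraded : IsGraded p pw ψ lam 𝒳 ℒ) (hfin : ∀ d, FiniteDimensional k (degLE ℒ d)) :
    ∃ C > 0, ∀ d ≥ 1, (Module.finrank k (degLE ℒ d) : ℝ) ≤
      C * d ^ Real.logb lam (Module.finrank k X) := by
  by_cases hX : Module.finrank k X ≤ 1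
  · have := hfaith.subsingleton_of_finrank_le_one hX
    refine ⟨1, one_pos, fun d hd => ?_⟩
    rw [Module.finrank_zero_of_subsingleton, Nat.cast_zero]
    have : 0 ≤ d := by linarith
    positivity
  · obtain ⟨c, hc0, hc⟩ :=
      exists_finrank_degLE_le_mul_add hfaith (one_pos.trans hlam) hgraded hfin
    exact exists_le_rpow_of_le_mul_add (f := fun d => (Module.finrank k (degLE ℒ d) : ℝ))
      (fun d e h => Nat.cast_le.2 (Submodule.finrank_mono (degLE_mono ℒ h)))
      (fun d => Nat.cast_nonneg _) (by exact_mod_cast not_le.1 hX) hlam hc0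
      (Nat.cast_nonneg _) fun d => by exact_mod_cast hc d

end GrowthUpperBound

/-! ### Growth of weakly branched self-similar Lie algebras -/

section GradedBasis

variable {k V W : Type*} [Field k] [AddCommGroup V] [Module k V] [AddCommGroup W] [Module k W]
  {𝒱 : ℝ → Submodule k V} {𝒲 : ℝ → Submodule k W}

/-- The index type of `gradedBasis`; the first component of an index is the degree. -/
abbrev GradedIndex (𝒱 : ℝ → Submodule k V) : Type _ :=
  Σ d : ℝ, Module.Basis.ofVectorSpaceIndex k (𝒱 d)

/-- A basis of a graded vector space that consists of homogeneous elements. -/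
def gradedBasis (hint : DirectSum.IsInternal 𝒱) : Module.Basis (GradedIndex 𝒱) k V :=
  hint.collectedBasis fun d => Module.Basis.ofVectorSpace k (𝒱 d)

theorem gradedBasis_mem (hint : DirectSum.IsInternal 𝒱) (i : GradedIndex 𝒱) :
    gradedBasis hint i ∈ 𝒱 i.1 :=
  hint.collectedBasis_mem _ i

theorem gradedBasis_repr_of_ne (hint : DirectSum.IsInternal 𝒱) {d : ℝ} {v : V} (hv : v ∈ 𝒱 d)
    {i : GradedIndex 𝒱} (hi : i.1 ≠ d) :
    (gradedBasis hint).repr v i = 0 :=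
  hint.collectedBasis_repr_of_mem_ne _ hi.symm hv

/-- The span of the homogeneous elements of `V ⊗ W` whose degree is in `A`, where the degrees of
`W` are scaled by `lam`: the elements whose coordinates in degrees outside `A` vanish. -/
def tensorDegree (hV : DirectSum.IsInternal 𝒱) (hW : DirectSum.IsInternal 𝒲) (lam : ℝ)
    (A : Set ℝ) : Submodule k (V ⊗[k] W) :=
  ⨅ (q) (_ : q.1.1 + lam * q.2.1 ∉ A),
    LinearMap.ker (((gradedBasis hV).tensorProduct (gradedBasis hW)).coord q)

variable (hV : DirectSum.IsInternal 𝒱) (hW : DirectSum.IsInternal 𝒲) (lam : ℝ)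

theorem map₂_mk_le_tensorDegree {A : Set ℝ} {i j : ℝ} (h : i + lam * j ∈ A) :
    Submodule.map₂ (TensorProduct.mk k V W) (𝒱 i) (𝒲 j) ≤ tensorDegree hV hW lam A := by
  refine Submodule.map₂_le.2 fun x hx y hy => ?_
  simp only [tensorDegree, Submodule.mem_iInf, LinearMap.mem_ker, Module.Basis.coord_apply,
    TensorProduct.mk_apply]
  intro q hq
  rw [Module.Basis.tensorProduct_repr_tmul_apply]
  by_cases hi : q.1.1 = i
  · have hj : q.2.1 ≠ j := by
      rintro rfl
      exact hq (hi ▸ h)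
    rw [gradedBasis_repr_of_ne hW hy hj, zero_smul]
  · rw [gradedBasis_repr_of_ne hV hx hi, smul_zero]

theorem disjoint_tensorDegree_compl (A : Set ℝ) :
    Disjoint (tensorDegree hV hW lam A) (tensorDegree hV hW lam Aᶜ) := by
  refine Submodule.disjoint_def.2 fun z h1 h2 => ?_
  refine ((gradedBasis hV).tensorProduct (gradedBasis hW)).ext_elem fun q => ?_
  rw [map_zero, Finsupp.zero_apply]
  simp only [tensorDegree, Submodule.mem_iInf, LinearMap.mem_ker, Module.Basis.coord_apply]
    at h1 h2
  by_cases hq : q.1.1 + lam * q.2.1 ∈ A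
  · exact h2 q fun h => h hq
  · exact h1 q hq

end GradedBasis

section WeaklyBranched

variable {k X L : Type*} [Field k] [CommRing X] [Algebra k X] [LieRing L] [LieAlgebra k L]
  {p : ℕ} {pw : L → L} {ψ : L →ₗ⁅k⁆ Wreath k X L} {lam : ℝ} {𝒳 : ℝ → Submodule k X}
  {ℒ : ℝ → Submodule k L} {c e : ℝ}

/-- `L` is weakly branched: there is a non-zero subspace `K` of `L` with `X ⊗ K ≤ ψ(K)`. -/
def IsWeaklyBranched (ψ : L →ₗ⁅k⁆ Wreath k X L) : Prop :=
  ∃ K : Submodule k L, K ≠ ⊥ ∧ ∀ u ∈ LinearMap.range (K.subtype.lTensor X), ∃ b ∈ K, ψ b = ⟨u, 0⟩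

theorem IsRegularlyWeaklyBranched.isWeaklyBranched (h : IsRegularlyWeaklyBranched ψ) :
    IsWeaklyBranched ψ := by
  obtain ⟨-, -, -, -, -, -, -, -, -, K, hK, hψK⟩ := h
  exact ⟨K.toSubmodule, fun hbot => hK ((LieSubmodule.toSubmodule_eq_bot K).1 hbot), hψK⟩

theorem IsWeaklyBranched.one_lt_finrank [FiniteDimensional k X] (hbr : IsWeaklyBranched ψ)
    (hfaith : IsFaithful ψ) : 1 < Module.finrank k X := by
  obtain ⟨K, hK, -⟩ := hbr
  by_contra! h
  have := hfaith.subsingleton_of_finrank_le_one h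
  exact hK (Subsingleton.elim _ _)

theorem top_eq_zero_of_mem (hgraded : IsGraded p pw ψ lam 𝒳 ℒ) (hc : ∀ i, 𝒳 i ≠ ⊥ → |i| ≤ c)
    {d : ℝ} (hd : 2 * c < d) {a : L} (ha : a ∈ ℒ d) : top ψ a = 0 := by
  ext x
  have hx : x ∈ ⨆ i, 𝒳 i := by
    rw [hgraded.alphabet_internal.submodule_iSup_eq_top]
    trivial
  induction hx using Submodule.iSup_induction' with
  | zero => simp
  | add x y _ _ hx hy => simp only [map_add, hx, hy]
  | mem i x hx =>
    by_cases hi : 𝒳 i = ⊥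
    · rw [hi, Submodule.mem_bot] at hx
      simp [hx]
    · have hid : 𝒳 (i + d) = ⊥ := by
        by_contra h
        linarith [(abs_le.1 (hc _ h)).2, (abs_le.1 (hc _ hi)).1]
      have := hgraded.top_mem ha hx
      rwa [hid, Submodule.mem_bot] at this

theorem coord_mem_tensorDegree (hgraded : IsGraded p pw ψ lam 𝒳 ℒ) {A : Set ℝ} {a : L}
    (ha : a ∈ ⨆ d ∈ A, ℒ d) :
    coord ψ a ∈ tensorDegree hgraded.alphabet_internal hgraded.internal lam A := by
  suffices h : ⨆ d ∈ A, ℒ d ≤ (tensorDegree hgraded.alphabet_internal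
      hgraded.internal lam A).comap (coord ψ) from h ha
  refine iSup₂_le fun d hd a ha => ?_
  refine (iSup_le fun i => iSup₂_le fun j hij => ?_ : _ ≤ tensorDegree _ _ lam A)
    (hgraded.coord_mem ha)
  rw [TensorProduct.range_map, Submodule.range_subtype, Submodule.range_subtype]
  exact map₂_mk_le_tensorDegree _ _ _ (hij ▸ hd)

theorem range_lTensor_degLE_le_tensorDegree (hV : DirectSum.IsInternal 𝒳)
    (hW : DirectSum.IsInternal ℒ) (hlam : 0 ≤ lam) (hc : ∀ i, 𝒳 i ≠ ⊥ → |i| ≤ c) :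
    LinearMap.range ((degLE ℒ e).subtype.lTensor X) ≤
      tensorDegree hV hW lam (Set.Iic (lam * e + c)) := by
  rw [range_lTensor_subtype, ← hV.submodule_iSup_eq_top, degLE, Submodule.map₂_iSup_left]
  refine iSup_le fun i => ?_
  by_cases hi : 𝒳 i = ⊥
  · simp [hi]
  simp only [Submodule.map₂_iSup_right]
  refine iSup₂_le fun j hj => map₂_mk_le_tensorDegree hV hW lam ?_
  have hij : lam * j ≤ lam * e := by gcongr
  exact Set.mem_Iic.2 (by linarith [(abs_le.1 (hc i hi)).2])

theorem mem_degLE_of_coord_mem (hfaith : IsFaithful ψ) (hlam : 0 ≤ lam)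
    (hgraded : IsGraded p pw ψ lam 𝒳 ℒ) (hc : ∀ i, 𝒳 i ≠ ⊥ → |i| ≤ c) (he : c ≤ lam * e) {a : L}
    (ha : coord ψ a ∈ LinearMap.range ((degLE ℒ e).subtype.lTensor X)) :
    a ∈ degLE ℒ (lam * e + c) := by
  set A := Set.Iic (lam * e + c)
  have hsplit : a ∈ (⨆ d ∈ A, ℒ d) ⊔ ⨆ d ∈ Aᶜ, ℒ d := by
    have := iSup_split ℒ (· ∈ A)
    rw [hgraded.internal.submodule_iSup_eq_top] at this
    exact this.le trivial
  obtain ⟨b, hb, b', hb', rfl⟩ := Submodule.mem_sup.1 hsplit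
  have hcoord : coord ψ b' = 0 := by
    refine Submodule.disjoint_def.1 (disjoint_tensorDegree_compl _ _ lam A) _ ?_
      (coord_mem_tensorDegree hgraded hb')
    rw [map_add] at ha
    simpa using sub_mem (range_lTensor_degLE_le_tensorDegree hgraded.alphabet_internal
      hgraded.internal hlam hc ha) (coord_mem_tensorDegree hgraded hb)
  have htop : top ψ b' = 0 := by
    suffices h : ⨆ d ∈ Aᶜ, ℒ d ≤ LinearMap.ker (top ψ) from h hb'
    refine iSup₂_le fun d hd b hb => top_eq_zero_of_mem hgraded hc ?_ hb
    linarith [not_le.1 (Set.mem_Iic.not.1 hd)]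
  have hb'0 : b' = 0 :=
    (map_eq_zero_iff ψ hfaith.injective).1 (LieAlgebra.SemiDirectSum.ext hcoord htop)
  rw [hb'0, add_zero]
  exact hb

variable [FiniteDimensional k X]

theorem finrank_mul_finrank_inf_degLE_le (hfaith : IsFaithful ψ) (hlam : 0 ≤ lam)
    (hgraded : IsGraded p pw ψ lam 𝒳 ℒ) (hfin : ∀ d, FiniteDimensional k (degLE ℒ d))
    {K : Submodule k L} (hψK : ∀ u ∈ LinearMap.range (K.subtype.lTensor X), ∃ b ∈ K, ψ b = ⟨u, 0⟩)
    (hc : ∀ i, 𝒳 i ≠ ⊥ → |i| ≤ c) (he : c ≤ lam * e) :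
    Module.finrank k X * Module.finrank k (K ⊓ degLE ℒ e : Submodule k L) ≤
      Module.finrank k (K ⊓ degLE ℒ (lam * e + c) : Submodule k L) := by
  have := Submodule.finiteDimensional_of_le (inf_le_right : K ⊓ degLE ℒ (lam * e + c) ≤ _)
  have hmono : ∀ {V W : Submodule k L}, V ≤ W →
      LinearMap.range (V.subtype.lTensor X) ≤ LinearMap.range (W.subtype.lTensor X) := fun h => by
    simpa only [range_lTensor_subtype] using Submodule.map₂_le_map₂_right h
  rw [← finrank_range_lTensor]
  refine (Submodule.finrank_mono fun u hu => ?_).trans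
    (Submodule.finrank_map_le (coord ψ) (K ⊓ degLE ℒ (lam * e + c)))
  obtain ⟨b, hbK, hb⟩ := hψK u (hmono inf_le_left hu)
  have hcoord : coord ψ b = u := congrArg (·.left) hb
  refine ⟨b, ⟨hbK, mem_degLE_of_coord_mem hfaith hlam hgraded hc he ?_⟩, hcoord⟩
  rw [hcoord]
  exact hmono inf_le_right hu

theorem IsWeaklyBranched.exists_rpow_le_finrank_degLE (hbr : IsWeaklyBranched ψ)
    (hfaith : IsFaithful ψ) (hlam : 1 < lam) (hgraded : IsGraded p pw ψ lam 𝒳 ℒ)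
    (hfin : ∀ d, FiniteDimensional k (degLE ℒ d)) :
    ∃ r > 0, ∃ d₀ > 0, ∀ d ≥ d₀,
      r * d ^ Real.logb lam (Module.finrank k X) ≤ (Module.finrank k (degLE ℒ d) : ℝ) := by
  have hX := hbr.one_lt_finrank hfaith
  obtain ⟨K, hK, hψK⟩ := hbr
  obtain ⟨b, hb, hb0⟩ := Submodule.exists_mem_ne_zero_of_ne_bot hK
  obtain ⟨d₁, hd₁⟩ := exists_mem_degLE hgraded.internal b
  obtain ⟨c, hc0, hc⟩ := exists_forall_abs_le_of_ne_bot hgraded.alphabet_internal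
  have hfinK : ∀ d, FiniteDimensional k (K ⊓ degLE ℒ d : Submodule k L) := fun d =>
    Submodule.finiteDimensional_of_le inf_le_right
  let f : ℝ → ℝ := fun d => (Module.finrank k (K ⊓ degLE ℒ d : Submodule k L) : ℝ)
  have hf : Monotone f := fun d e h =>
    Nat.cast_le.2 (Submodule.finrank_mono (inf_le_inf_left K (degLE_mono ℒ h)))
  have hf1 : 1 ≤ f d₁ := Nat.one_le_cast.2
    (Submodule.one_le_finrank_iff.2 ((Submodule.ne_bot_iff _).2 ⟨b, ⟨hb, hd₁⟩, hb0⟩))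
  obtain ⟨r, hr, d₀, hd₀, hle⟩ := exists_rpow_le_of_mul_le_add (m := Module.finrank k X) hf
    (by exact_mod_cast hX.le) hlam hc0 hf1 fun e he => by
      unfold f
      exact_mod_cast finrank_mul_finrank_inf_degLE_le hfaith (zero_le_one.trans hlam.le)
        hgraded hfin hψK hc he
  exact ⟨r, hr, d₀, hd₀, fun d hd =>
    (hle d hd).trans (Nat.cast_le.2 (Submodule.finrank_mono inf_le_right))⟩

end WeaklyBranched

/-! ### Counting multisets of weights -/

section Counting

theorem exp_neg_le_rpow_neg {a t : ℝ} (ha : 0 < a) (ht : 0 < t) :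
    Real.exp (-t) ≤ a ^ a * t ^ (-a) := by
  have hexp : (t / a) ^ a ≤ Real.exp t :=
    calc (t / a) ^ a ≤ Real.exp (t / a) ^ a :=
          Real.rpow_le_rpow (by positivity) (by linarith [Real.add_one_le_exp (t / a)]) ha.le
      _ = Real.exp t := by rw [← Real.exp_mul, div_mul_cancel₀ _ ha.ne']
  calc Real.exp (-t) = (Real.exp t)⁻¹ := Real.exp_neg t
    _ ≤ ((t / a) ^ a)⁻¹ := inv_anti₀ (by positivity) hexp
    _ = a ^ a * t ^ (-a) := by
      rw [Real.div_rpow ht.le ha.le, inv_div, Real.rpow_neg ht.le, div_eq_mul_inv]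

theorem exists_neg_log_one_sub_exp_le {a : ℝ} (ha : 0 < a) :
    ∃ A > 0, ∀ y > 0, -Real.log (1 - Real.exp (-y)) ≤ A * y ^ (-a) := by
  have hsum : Summable fun n : ℕ => ((n + 1 : ℕ) : ℝ) ^ (-(1 + a)) :=
    (summable_nat_add_iff 1 (f := fun n : ℕ => (n : ℝ) ^ (-(1 + a)))).2
      (Real.summable_nat_rpow.2 (by linarith))
  set Z := ∑' n : ℕ, ((n + 1 : ℕ) : ℝ) ^ (-(1 + a))
  have : 0 ≤ Z := tsum_nonneg fun n => by positivity
  refine ⟨a ^ a * (Z + 1), by positivity, fun y hy => ?_⟩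
  have hx : |Real.exp (-y)| < 1 := by
    rw [abs_of_pos (Real.exp_pos _), Real.exp_lt_one_iff]
    linarith
  have hterm : ∀ n : ℕ, Real.exp (-y) ^ (n + 1) / (n + 1) ≤
      a ^ a * y ^ (-a) * ((n + 1 : ℕ) : ℝ) ^ (-(1 + a)) := by
    intro n
    have hn : (0 : ℝ) < ((n + 1 : ℕ) : ℝ) := by positivity
    have hexp := exp_neg_le_rpow_neg ha (mul_pos hn hy)
    rw [Real.mul_rpow hn.le hy.le] at hexp
    rw [← Real.exp_nat_mul, neg_add, Real.rpow_add hn, Real.rpow_neg_one,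
      div_le_iff₀ (by exact_mod_cast hn), mul_neg]
    refine hexp.trans (le_of_eq ?_)
    push_cast
    field_simp
  have hle := hasSum_le hterm (Real.hasSum_pow_div_log_of_abs_lt_one hx)
    (hsum.hasSum.mul_left (a ^ a * y ^ (-a)))
  have hnonneg : 0 ≤ a ^ a * y ^ (-a) := by positivity
  linarith

theorem sum_le_sum_range_of_card_le {ι : Type*} {φ : ℝ → ℝ}
    (hφ : AntitoneOn φ (Set.Ioi 0)) (v : ι → ℝ) (J : Finset ι)
    (hJ : ∀ i ∈ J, ((J.filter fun j => v j ≤ v i).card : ℝ) ≤ v i) :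
    ∑ i ∈ J, φ (v i) ≤ ∑ r ∈ Finset.range J.card, φ (r + 1) := by
  classical
  obtain ⟨M, hM⟩ : ∃ M, J.card = M := ⟨_, rfl⟩
  induction M generalizing J with
  | zero => simp [Finset.card_eq_zero.1 hM]
  | succ M ih =>
    have hne : J.Nonempty := Finset.card_pos.1 (by lia)
    obtain ⟨i, hi, hmax⟩ := J.exists_max_image v hne
    have hcard : (J.erase i).card = M := by rw [Finset.card_erase_of_mem hi, hM]; rfl
    have hvi : ((M : ℝ) + 1) ≤ v i := by
      have := hJ i hi
      rw [Finset.filter_true_of_mem hmax, hM] at this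
      exact_mod_cast this
    have hM0 : (0 : ℝ) < M + 1 := by positivity
    have herase := ih (J.erase i) (fun j hj => ?_) hcard
    · rw [← Finset.add_sum_erase J _ hi, hM, Finset.sum_range_succ, add_comm]
      rw [hcard] at herase
      exact add_le_add herase (hφ hM0 (hM0.trans_le hvi) hvi)
    · refine le_trans ?_ (hJ j (Finset.mem_of_mem_erase hj))
      exact_mod_cast Finset.card_le_card (Finset.filter_subset_filter _ (Finset.erase_subset _ _))

theorem sum_range_inv_sqrt_le (n : ℕ) :
    ∑ r ∈ Finset.range n, (√(r + 1))⁻¹ ≤ 2 * √n := by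
  induction n with
  | zero => simp
  | succ n ih =>
    rw [Finset.sum_range_succ]
    push_cast
    have hmono : √n ≤ √(n + 1 : ℝ) := Real.sqrt_le_sqrt (by linarith)
    have hpos : 0 < √(n + 1 : ℝ) := Real.sqrt_pos.2 (by positivity)
    have hstep : (√(n + 1 : ℝ))⁻¹ ≤ 2 * (√(n + 1 : ℝ) - √n) := by
      rw [inv_le_iff_one_le_mul₀ hpos]
      nlinarith [Real.sqrt_nonneg (n : ℝ), Real.sq_sqrt (by positivity : (0 : ℝ) ≤ n + 1),
        Real.sq_sqrt (Nat.cast_nonneg (α := ℝ) n)]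
    linarith

theorem sum_range_inv_sq_le {κ : ℕ} (hκ : κ ≠ 0) (M : ℕ) :
    ∑ r ∈ Finset.range M, ((κ + r + 1 : ℝ) ^ 2)⁻¹ ≤ (κ : ℝ)⁻¹ := by
  have hκ0 : (0 : ℝ) < κ := by positivity
  suffices h : ∑ r ∈ Finset.range M, ((κ + r + 1 : ℝ) ^ 2)⁻¹ ≤ (κ : ℝ)⁻¹ - (κ + M : ℝ)⁻¹ from
    h.trans (sub_le_self _ (by positivity))
  induction M with
  | zero => simp
  | succ M ih =>
    have hstep : ((κ + M + 1 : ℝ) ^ 2)⁻¹ ≤ (κ + M : ℝ)⁻¹ - (κ + M + 1 : ℝ)⁻¹ := by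
      rw [inv_sub_inv (by positivity) (by positivity), add_sub_cancel_left, one_div]
      exact inv_anti₀ (by positivity) (by nlinarith)
    rw [Finset.sum_range_succ]
    push_cast
    rw [← add_assoc]
    linarith

theorem sum_range_min_sqrt_sq_le {R : ℝ} (hR : 1 ≤ R) (M : ℕ) :
    ∑ r ∈ Finset.range M, min (√(R / (r + 1))) ((R / (r + 1)) ^ 2) ≤ 5 * R := by
  have hR0 : 0 < R := by linarith
  set κ := ⌈R⌉₊
  have hκR : R ≤ κ := Nat.le_ceil R
  have hκ2R : (κ : ℝ) ≤ 2 * R := by linarith [Nat.ceil_lt_add_one hR0.le]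
  have hκ : κ ≠ 0 := (Nat.ceil_pos.2 hR0).ne'
  have hhead : ∑ r ∈ Finset.range κ, √(R / (r + 1)) ≤ 4 * R :=
    calc _ = √R * ∑ r ∈ Finset.range κ, (√(r + 1))⁻¹ := by
          rw [Finset.mul_sum]
          exact Finset.sum_congr rfl fun r _ => by rw [Real.sqrt_div hR0.le, div_eq_mul_inv]
      _ ≤ √R * (2 * √κ) := by gcongr; exact sum_range_inv_sqrt_le κ
      _ ≤ √R * (2 * (2 * √R)) := by
        gcongr
        exact Real.sqrt_le_iff.2 ⟨by positivity, by nlinarith [Real.sq_sqrt hR0.le]⟩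
      _ = 4 * R := by nlinarith [Real.mul_self_sqrt hR0.le]
  have htail : ∑ r ∈ Finset.range M, (R / ((κ + r : ℕ) + 1)) ^ 2 ≤ R :=
    calc _ = R ^ 2 * ∑ r ∈ Finset.range M, ((κ + r + 1 : ℝ) ^ 2)⁻¹ := by
          rw [Finset.mul_sum]
          exact Finset.sum_congr rfl fun r _ => by rw [Nat.cast_add, div_pow, div_eq_mul_inv]
      _ ≤ R ^ 2 * (κ : ℝ)⁻¹ := by gcongr; exact sum_range_inv_sq_le hκ M
      _ ≤ R ^ 2 * R⁻¹ := by gcongr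
      _ = R := by field_simp
  calc _ ≤ ∑ r ∈ Finset.range (κ + M), min (√(R / (r + 1))) ((R / (r + 1)) ^ 2) :=
        Finset.sum_le_sum_of_subset_of_nonneg
          (Finset.range_subset_range.2 (Nat.le_add_left _ _))
          fun r _ _ => le_min (by positivity) (by positivity)
    _ ≤ ∑ r ∈ Finset.range κ, √(R / (r + 1)) +
        ∑ r ∈ Finset.range M, (R / ((κ + r : ℕ) + 1)) ^ 2 := by
      rw [Finset.sum_range_add]
      exact add_le_add (Finset.sum_le_sum fun r _ => min_le_left _ _)
        (Finset.sum_le_sum fun r _ => min_le_right _ _)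
    _ ≤ 5 * R := by linarith

theorem exists_neg_log_one_sub_exp_le_min {η : ℝ} (hη : 0 < η) :
    ∃ A > 0, ∀ y > 0, -Real.log (1 - Real.exp (-y)) ≤
      A * min (√(y ^ (-η))) ((y ^ (-η)) ^ 2) := by
  obtain ⟨A₁, hA₁, h₁⟩ := exists_neg_log_one_sub_exp_le (a := η / 2) (by positivity)
  obtain ⟨A₂, -, h₂⟩ := exists_neg_log_one_sub_exp_le (a := η * 2) (by positivity)
  have hA : 0 < max A₁ A₂ := lt_max_of_lt_left hA₁
  refine ⟨max A₁ A₂, hA, fun y hy => ?_⟩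
  rw [mul_min_of_nonneg _ _ hA.le, Real.sqrt_eq_rpow, ← Real.rpow_mul hy.le,
    ← Real.rpow_mul_natCast hy.le]
  refine le_min ((h₁ y hy).trans ?_) ((h₂ y hy).trans ?_)
  · rw [show -η * (1 / 2) = -(η / 2) by ring]
    gcongr
    exact le_max_left _ _
  · rw [show -η * (2 : ℕ) = -(η * 2) by push_cast; ring]
    gcongr
    exact le_max_right _ _

theorem antitoneOn_min_sqrt_sq {R : ℝ} (hR : 0 ≤ R) :
    AntitoneOn (fun v => min (√(R / v)) ((R / v) ^ 2)) (Set.Ioi 0) := by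
  intro x (hx : 0 < x) y (hy : 0 < y) hxy
  have h : R / y ≤ R / x := by gcongr
  exact min_le_min (by gcongr) (by gcongr)

theorem exists_sum_neg_log_le {η : ℝ} (hη : 0 < η) :
    ∃ A > 0, ∀ {ι : Type*} (deg : ι → ℝ) (J : Finset ι) (C s : ℝ),
      0 < C → 0 < s → 1 ≤ C * s ^ (-η) → (∀ i ∈ J, 0 < deg i) →
      (∀ i ∈ J, ((J.filter fun j => deg j ≤ deg i).card : ℝ) ≤ C * deg i ^ η) →
      ∑ i ∈ J, -Real.log (1 - Real.exp (-(s * deg i))) ≤ A * (C * s ^ (-η)) := by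
  obtain ⟨A, hA, hlog⟩ := exists_neg_log_one_sub_exp_le_min hη
  refine ⟨A * 5, by positivity, fun deg J C s hC hs hR hpos hcard => ?_⟩
  set R := C * s ^ (-η) with hRdef
  set φ : ℝ → ℝ := fun v => min (√(R / v)) ((R / v) ^ 2)
  calc _ ≤ ∑ i ∈ J, A * φ (C * deg i ^ η) := by
        refine Finset.sum_le_sum fun i hi => (hlog _ (mul_pos hs (hpos i hi))).trans_eq ?_
        have hu : R / (C * deg i ^ η) = (s * deg i) ^ (-η) := by
          have hd := hpos i hi
          rw [hRdef, Real.mul_rpow hs.le hd.le, Real.rpow_neg hd.le]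
          field_simp
        simp only [φ, hu]
    _ = A * ∑ i ∈ J, φ (C * deg i ^ η) := (Finset.mul_sum _ _ _).symm
    _ ≤ A * ∑ r ∈ Finset.range J.card, φ (r + 1) := by
        gcongr
        refine sum_le_sum_range_of_card_le (antitoneOn_min_sqrt_sq (by linarith)) _ J
          fun i hi => ?_
        refine le_trans (Nat.cast_le.2 (Finset.card_le_card fun j hj => ?_)) (hcard i hi)
        rw [Finset.mem_filter] at hj ⊢
        exact ⟨hj.1, (Real.rpow_le_rpow_iff (hpos j hj.1).le (hpos i hi).le hη).1
          (le_of_mul_le_mul_left hj.2 hC)⟩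
    _ ≤ A * (5 * R) := by gcongr; exact sum_range_min_sqrt_sq_le hR _
    _ = A * 5 * R := (mul_assoc _ _ _).symm

/-- The tuples of exponents in `{0, …, N}` whose weight, with respect to the degrees `deg`, is at
most `d`. -/
def exponentsLE {J : Type*} [Fintype J] [DecidableEq J] (deg : J → ℝ) (N : ℕ) (d : ℝ) :
    Finset (J → ℕ) :=
  (Fintype.piFinset fun _ => Finset.range (N + 1)).filter fun n => ∑ i, n i * deg i ≤ d

theorem card_exponentsLE_le {J : Type*} [Fintype J] [DecidableEq J] {deg : J → ℝ}
    (hdeg : ∀ i, 0 < deg i) (N : ℕ) (d : ℝ) {s : ℝ} (hs : 0 < s) :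
    ((exponentsLE deg N d).card : ℝ) ≤
      Real.exp (s * d + ∑ i, -Real.log (1 - Real.exp (-(s * deg i)))) := by
  set q : J → ℝ := fun i => Real.exp (-(s * deg i))
  have hq0 : ∀ i, 0 ≤ q i := fun i => (Real.exp_pos _).le
  have hq1 : ∀ i, q i < 1 := fun i =>
    Real.exp_lt_one_iff.2 (neg_lt_zero.2 (mul_pos hs (hdeg i)))
  calc ((exponentsLE deg N d).card : ℝ) = ∑ n ∈ exponentsLE deg N d, 1 := by simp
    _ ≤ ∑ n ∈ exponentsLE deg N d, Real.exp (s * d) * ∏ i, q i ^ n i := by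
        refine Finset.sum_le_sum fun n hn => ?_
        have hweight := (Finset.mem_filter.1 hn).2
        simp_rw [q, ← Real.exp_nat_mul]
        rw [← Real.exp_sum, ← Real.exp_add, Real.one_le_exp_iff]
        have hexponent : ∑ i, (n i : ℝ) * -(s * deg i) = -(s * ∑ i, n i * deg i) := by
          rw [Finset.mul_sum, ← Finset.sum_neg_distrib]
          exact Finset.sum_congr rfl fun i _ => by ring
        rw [hexponent]
        nlinarith
    _ ≤ ∑ n ∈ Fintype.piFinset fun _ => Finset.range (N + 1),
          Real.exp (s * d) * ∏ i, q i ^ n i :=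
        Finset.sum_le_sum_of_subset_of_nonneg (Finset.filter_subset _ _)
          fun n _ _ => by positivity
    _ = Real.exp (s * d) * ∏ i, ∑ n ∈ Finset.range (N + 1), q i ^ n := by
        rw [← Finset.mul_sum, Finset.prod_univ_sum]
    _ ≤ Real.exp (s * d) * ∏ i, (1 - q i)⁻¹ := by
        gcongr with i
        rw [← tsum_geometric_of_lt_one (hq0 i) (hq1 i)]
        exact (summable_geometric_of_lt_one (hq0 i) (hq1 i)).sum_le_tsum _
          fun n _ => pow_nonneg (hq0 i) n
    _ = Real.exp (s * d + ∑ i, -Real.log (1 - q i)) := by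
        rw [Real.exp_add, Real.exp_sum]
        congr 1
        refine Finset.prod_congr rfl fun i _ => ?_
        rw [Real.exp_neg, Real.exp_log (by linarith [hq1 i])]

section Multisets

variable {ι : Type*} {deg : ι → ℝ} {δ d : ℝ} {J : Finset ι}

theorem degree_le_of_mem_multiset (hdeg : ∀ i, 0 ≤ deg i) {m : Multiset ι}
    (hm : (m.map deg).sum ≤ d) {i : ι} (hi : i ∈ m) : deg i ≤ d := by
  refine (Multiset.single_le_sum (fun x hx => ?_) _ (Multiset.mem_map_of_mem deg hi)).trans hm
  obtain ⟨j, -, rfl⟩ := Multiset.mem_map.1 hx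
  exact hdeg j

theorem sum_count_mul_eq [DecidableEq ι] {m : Multiset ι} (hm : ∀ i ∈ m, i ∈ J) :
    ∑ i : J, m.count (i : ι) * deg i = (m.map deg).sum := by
  rw [Finset.sum_multiset_map_count, Finset.sum_coe_sort J fun i => (m.count i : ℝ) * deg i]
  simp_rw [nsmul_eq_mul]
  refine (Finset.sum_subset (fun i hi => hm i (Multiset.mem_toFinset.1 hi)) fun i _ hi => ?_).symm
  rw [Multiset.count_eq_zero_of_notMem fun h => hi (Multiset.mem_toFinset.2 h), Nat.cast_zero,
    zero_mul]

theorem count_mem_exponentsLE [DecidableEq ι] (hδ : 0 < δ) (hdeg : ∀ i, δ ≤ deg i) {m : Multiset ι}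
    (hmJ : ∀ i ∈ m, i ∈ J) (hm : (m.map deg).sum ≤ d) :
    (fun i : J => m.count (i : ι)) ∈ exponentsLE (fun i : J => deg i) ⌊d / δ⌋₊ d := by
  have hle : ∑ i : J, m.count (i : ι) * deg i ≤ d := (sum_count_mul_eq hmJ).trans_le hm
  refine Finset.mem_filter.2 ⟨Fintype.mem_piFinset.2 fun i => ?_, hle⟩
  rw [Finset.mem_range, Nat.lt_succ_iff]
  refine Nat.le_floor ((le_div_iff₀ hδ).2 ?_)
  calc (m.count (i : ι) : ℝ) * δ ≤ m.count (i : ι) * deg i := by gcongr; exact hdeg i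
    _ ≤ ∑ i : J, m.count (i : ι) * deg i := Finset.single_le_sum
      (f := fun i : J => (m.count (i : ι) : ℝ) * deg i)
      (fun j _ => mul_nonneg (Nat.cast_nonneg _) (hδ.le.trans (hdeg j))) (Finset.mem_univ i)
    _ ≤ d := hle

theorem finite_and_ncard_multiset_le (hδ : 0 < δ) (hdeg : ∀ i, δ ≤ deg i)
    (hJ : ∀ i, deg i ≤ d → i ∈ J) {s : ℝ} (hs : 0 < s) :
    {m : Multiset ι | (m.map deg).sum ≤ d}.Finite ∧
      ({m : Multiset ι | (m.map deg).sum ≤ d}.ncard : ℝ) ≤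
        Real.exp (s * d + ∑ i ∈ J, -Real.log (1 - Real.exp (-(s * deg i)))) := by
  classical
  let count (m : Multiset ι) (i : J) : ℕ := m.count (i : ι)
  have hmem (m : Multiset ι) (hm : (m.map deg).sum ≤ d) : ∀ i ∈ m, i ∈ J := fun i hi =>
    hJ i (degree_le_of_mem_multiset (fun i => hδ.le.trans (hdeg i)) hm hi)
  have hmaps : Set.MapsTo count {m | (m.map deg).sum ≤ d}
      (exponentsLE (fun i : J => deg i) ⌊d / δ⌋₊ d : Set (J → ℕ)) := fun m hm =>
    Finset.mem_coe.2 (count_mem_exponentsLE hδ hdeg (hmem m hm) hm)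
  have hinj : Set.InjOn count {m | (m.map deg).sum ≤ d} := by
    intro m hm m' hm' h
    refine Multiset.ext.2 fun i => ?_
    by_cases hi : i ∈ J
    · exact congrFun h ⟨i, hi⟩
    · rw [Multiset.count_eq_zero_of_notMem fun h => hi (hmem m hm i h),
        Multiset.count_eq_zero_of_notMem fun h => hi (hmem m' hm' i h)]
  refine ⟨Set.Finite.of_injOn hmaps hinj (Finset.finite_toSet _), ?_⟩
  have hcard := Set.ncard_le_ncard_of_injOn count hmaps hinj (Finset.finite_toSet _)
  rw [Set.ncard_coe_finset] at hcard
  refine (Nat.cast_le.2 hcard).trans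
    ((card_exponentsLE_le (deg := fun i : J => deg i) (fun i => hδ.trans_le (hdeg i)) _ d
      hs).trans_eq ?_)
  rw [Finset.sum_coe_sort J fun i => -Real.log (1 - Real.exp (-(s * deg i)))]

end Multisets

end Counting

/-! ### Ordered monomials span the enveloping algebra -/

section Spanning

attribute [local instance] LieRing.ofAssociativeRing

variable {k L A : Type*} [Field k] [LieRing L] [LieAlgebra k L] [Ring A] [Algebra k A]
  {ℒ : ℝ → Submodule k L}

theorem mem_span_gradedBasis (hint : DirectSum.IsInternal ℒ) {d : ℝ} {a : L} (ha : a ∈ ℒ d) :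
    a ∈ Submodule.span k (gradedBasis hint '' {i | i.1 = d}) := by
  rw [Module.Basis.mem_span_image]
  intro i hi
  by_contra h
  exact (Finsupp.mem_support_iff.1 hi) (gradedBasis_repr_of_ne hint ha h)

/-- The product in `A` of the images under `ρ` of a word in homogeneous basis elements of `L`. -/
def wordProd (ρ : L →ₗ⁅k⁆ A) (hint : DirectSum.IsInternal ℒ) (l : List (GradedIndex ℒ)) : A :=
  (l.map fun i => ρ (gradedBasis hint i)).prod

/-- The span of the words of length less than `n` and degree `e` in homogeneous basis elements. -/
def shortWords (ρ : L →ₗ⁅k⁆ A) (hint : DirectSum.IsInternal ℒ) (n : ℕ) (e : ℝ) :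
    Submodule k A :=
  Submodule.span k {u | ∃ l, l.length < n ∧ (l.map Sigma.fst).sum = e ∧ wordProd ρ hint l = u}

variable (ρ : L →ₗ⁅k⁆ A) (hint : DirectSum.IsInternal ℒ)

theorem wordProd_cons (i : GradedIndex ℒ) (l : List (GradedIndex ℒ)) :
    wordProd ρ hint (i :: l) = ρ (gradedBasis hint i) * wordProd ρ hint l := by
  simp [wordProd]

theorem wordProd_mem_shortWords (l : List (GradedIndex ℒ)) {n : ℕ} (hn : l.length < n) :
    wordProd ρ hint l ∈ shortWords ρ hint n (l.map Sigma.fst).sum :=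
  Submodule.subset_span ⟨l, hn, rfl, rfl⟩

theorem mul_mem_shortWords {d e : ℝ} {a : L} (ha : a ∈ ℒ d) {n : ℕ} {u : A}
    (hu : u ∈ shortWords ρ hint n e) : ρ a * u ∈ shortWords ρ hint (n + 1) (d + e) := by
  refine Submodule.span_induction₂ (p := fun a u _ _ => ρ a * u ∈ shortWords ρ hint (n + 1) (d + e))
    ?_ ?_ ?_ ?_ ?_ ?_ ?_ (mem_span_gradedBasis hint ha) hu
  · rintro _ _ ⟨i, rfl, rfl⟩ ⟨l, hl, rfl, rfl⟩
    exact Submodule.subset_span ⟨i :: l, Nat.succ_lt_succ hl, by simp, wordProd_cons ρ hint i l⟩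
  · intro u _
    rw [map_zero, zero_mul]
    exact zero_mem _
  · intro a _
    rw [mul_zero]
    exact zero_mem _
  · intro a b u _ _ _ hau hbu
    rw [map_add, add_mul]
    exact add_mem hau hbu
  · intro a u v _ _ _ hau hav
    rw [mul_add]
    exact add_mem hau hav
  · intro c a u _ _ hau
    rw [map_smul, smul_mul_assoc]
    exact Submodule.smul_mem _ c hau
  · intro c a u _ _ hau
    rw [mul_smul_comm]
    exact Submodule.smul_mem _ c hau

variable (hlie : ∀ {i j : ℝ} {a b : L}, a ∈ ℒ i → b ∈ ℒ j → ⁅a, b⁆ ∈ ℒ (i + j))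

include hlie

theorem wordProd_sub_mem_of_perm {l l' : List (GradedIndex ℒ)} (h : l.Perm l') :
    wordProd ρ hint l - wordProd ρ hint l' ∈
      shortWords ρ hint l.length (l.map Sigma.fst).sum := by
  induction h with
  | nil => rw [sub_self]; exact zero_mem _
  | cons i _ ih =>
    rw [wordProd_cons, wordProd_cons, ← mul_sub, List.map_cons, List.sum_cons, List.length_cons]
    exact mul_mem_shortWords ρ hint (gradedBasis_mem hint i) ih
  | swap i j l =>
    simp only [wordProd_cons, ← mul_assoc]
    rw [← sub_mul, ← LieRing.of_associative_ring_bracket, ← LieHom.map_lie]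
    simp only [List.map_cons, List.sum_cons, ← add_assoc]
    exact mul_mem_shortWords ρ hint (hlie (gradedBasis_mem hint j) (gradedBasis_mem hint i))
      (wordProd_mem_shortWords ρ hint l (Nat.lt_succ_self _))
  | trans h₁ _ ih₁ ih₂ =>
    rw [← h₁.length_eq, ← (h₁.map Sigma.fst).sum_eq] at ih₂
    rw [← sub_add_sub_cancel]
    exact add_mem ih₁ ih₂

theorem shortWords_le_span_multiset (n : ℕ) (e : ℝ) :
    shortWords ρ hint n e ≤ Submodule.span k ((fun m => wordProd ρ hint m.toList) ''
      {m : Multiset (GradedIndex ℒ) | (m.map Sigma.fst).sum = e}) := by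
  induction n with
  | zero =>
    refine Submodule.span_le.2 ?_
    rintro _ ⟨l, hl, -⟩
    exact absurd hl (Nat.not_lt_zero _)
  | succ n ih =>
    refine Submodule.span_le.2 ?_
    rintro _ ⟨l, hl, rfl, rfl⟩
    have hperm : l.Perm (l : Multiset _).toList :=
      Multiset.coe_eq_coe.1 (Multiset.coe_toList _).symm
    rw [← sub_add_cancel (wordProd ρ hint l) (wordProd ρ hint (l : Multiset _).toList)]
    refine add_mem (ih ?_) (Submodule.subset_span ⟨(l : Multiset _), by simp, rfl⟩)
    refine Submodule.span_mono ?_ (wordProd_sub_mem_of_perm ρ hint hlie hperm)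
    rintro _ ⟨l', hlen, hdeg, rfl⟩
    exact ⟨l', by lia, hdeg, rfl⟩

end Spanning

section EnvGrowth

attribute [local instance] LieRing.ofAssociativeRing

variable {k L : Type*} [Field k] [LieRing L] [LieAlgebra k L] {p : ℕ} {pw : L → L}
  {ℒ : ℝ → Submodule k L}

theorem growthLE_exp_rpow {f : ℝ → ℝ} {E α : ℝ} (hE : 1 ≤ E) (hα : 0 < α)
    (hf : ∀ d ≥ 1, f d ≤ Real.exp (E * d ^ α)) : GrowthLE f fun d => Real.exp (d ^ α) := by
  have hE0 : 0 < E := by linarith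
  refine ⟨E ^ α⁻¹, by positivity, fun d hd => ?_⟩
  have hpow : (E ^ α⁻¹ * d) ^ α = E * d ^ α := by
    rw [Real.mul_rpow (by positivity) (by linarith), ← Real.rpow_mul hE0.le,
      inv_mul_cancel₀ hα.ne', Real.rpow_one]
  beta_reduce
  rw [hpow]
  exact (hf d hd).trans (le_mul_of_one_le_left (Real.exp_pos _).le
    (Real.one_le_rpow hE (by positivity)))

theorem exists_finrank_degLE_le_mul_rpow {δ η C : ℝ} (hδ : 0 < δ) (hη : 0 ≤ η)
    (hfin : ∀ d, FiniteDimensional k (degLE ℒ d))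
    (hgrowth : ∀ d ≥ 1, (Module.finrank k (degLE ℒ d) : ℝ) ≤ C * d ^ η) :
    ∃ B ≥ 1, ∀ d ≥ δ, (Module.finrank k (degLE ℒ d) : ℝ) ≤ B * d ^ η := by
  refine ⟨max (max C (C * δ ^ (-η))) 1, le_max_right _ _, fun d hd => ?_⟩
  have hd0 : 0 < d := hδ.trans_le hd
  obtain h | h := le_total 1 d
  · refine (hgrowth d h).trans ?_
    gcongr
    exact (le_max_left _ _).trans (le_max_left _ _)
  · calc (Module.finrank k (degLE ℒ d) : ℝ) ≤ Module.finrank k (degLE ℒ 1) :=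
          Nat.cast_le.2 (Submodule.finrank_mono (degLE_mono ℒ h))
      _ ≤ C * δ ^ (-η) * δ ^ η := by
        rw [mul_assoc, ← Real.rpow_add hδ, neg_add_cancel, Real.rpow_zero, mul_one]
        simpa using hgrowth 1 le_rfl
      _ ≤ max (max C (C * δ ^ (-η))) 1 * d ^ η := by
        gcongr
        exact (le_max_right _ _).trans (le_max_left _ _)

variable (k p pw) in
/-- The canonical map `envι : L → U(L)` as a homomorphism of Lie algebras. -/
def envHom : L →ₗ⁅k⁆ Env k p pw :=
  (RingQuot.mkAlgHom k (PowRel k p pw)).toLieHom.comp (UniversalEnvelopingAlgebra.ι k)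

theorem envHom_apply (a : L) : envHom k p pw a = envι k p pw a := rfl

variable (hint : DirectSum.IsInternal ℒ)

theorem prod_envι_mem_shortWords {l : List (ℝ × L)} (hl : ∀ t ∈ l, t.2 ∈ ℒ t.1) :
    (l.map fun t => envι k p pw t.2).prod ∈
      shortWords (envHom k p pw) hint (l.length + 1) (l.map Prod.fst).sum := by
  induction l with
  | nil => exact Submodule.subset_span ⟨[], by simp [wordProd]⟩
  | cons t l ih =>
    simp only [List.map_cons, List.prod_cons, List.sum_cons, List.length_cons]
    exact mul_mem_shortWords _ hint (hl t List.mem_cons_self)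
      (ih fun s hs => hl s (List.mem_cons_of_mem _ hs))

theorem envDegLE_le_span_multiset
    (hlie : ∀ {i j : ℝ} {a b : L}, a ∈ ℒ i → b ∈ ℒ j → ⁅a, b⁆ ∈ ℒ (i + j)) (d : ℝ) :
    envDegLE p pw ℒ d ≤
      Submodule.span k ((fun m => wordProd (envHom k p pw) hint m.toList) ''
        {m : Multiset (GradedIndex ℒ) | (m.map Sigma.fst).sum ≤ d}) := by
  refine iSup₂_le fun e he => Submodule.span_le.2 ?_
  rintro _ ⟨l, hl, rfl, rfl⟩
  have hspan := shortWords_le_span_multiset (envHom k p pw) hint hlie _ _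
    (prod_envι_mem_shortWords hint hl)
  exact Submodule.span_mono (Set.image_mono fun m hm => le_of_eq_of_le hm he) hspan

include hint

theorem le_degree_gradedBasis {δ : ℝ} (hδ : ∀ d < δ, ℒ d = ⊥) (i : GradedIndex ℒ) :
    δ ≤ i.1 := by
  by_contra! h
  have hzero := gradedBasis_mem hint i
  rw [hδ _ h, Submodule.mem_bot] at hzero
  exact (gradedBasis hint).ne_zero i hzero

theorem card_le_finrank_degLE {d : ℝ} [FiniteDimensional k (degLE ℒ d)]
    {J : Finset (GradedIndex ℒ)} (hJ : ∀ i ∈ J, i.1 ≤ d) :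
    J.card ≤ Module.finrank k (degLE ℒ d) := by
  let v : J → degLE ℒ d := fun i => ⟨gradedBasis hint i, le_degLE ℒ (hJ i i.2)
    (gradedBasis_mem hint i)⟩
  have hv : LinearIndependent k v := LinearIndependent.of_comp (degLE ℒ d).subtype
    ((gradedBasis hint).linearIndependent.comp (fun i : J => i.1) Subtype.val_injective)
  simpa using hv.fintype_card_le_finrank

theorem exists_finset_mem_iff_degree_le (d : ℝ) [FiniteDimensional k (degLE ℒ d)] :
    ∃ J : Finset (GradedIndex ℒ), ∀ i, i ∈ J ↔ i.1 ≤ d := by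
  have hfin : {i : GradedIndex ℒ | i.1 ≤ d}.Finite := by
    by_contra hinf
    obtain ⟨J, hJ, hcard⟩ := Set.Infinite.exists_subset_card_eq hinf
      (Module.finrank k (degLE ℒ d) + 1)
    have := card_le_finrank_degLE hint fun i hi => hJ hi
    lia
  exact ⟨hfin.toFinset, fun i => by simp⟩

variable (hlie : ∀ {i j : ℝ} {a b : L}, a ∈ ℒ i → b ∈ ℒ j → ⁅a, b⁆ ∈ ℒ (i + j))
  {δ : ℝ} (hδ0 : 0 < δ) (hδ : ∀ d < δ, ℒ d = ⊥)

include hlie hδ0 hδ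

theorem finiteDimensional_and_finrank_envDegLE_le {d : ℝ} {J : Finset (GradedIndex ℒ)}
    (hJ : ∀ i, i.1 ≤ d → i ∈ J) {s : ℝ} (hs : 0 < s) :
    FiniteDimensional k (envDegLE p pw ℒ d) ∧
      (Module.finrank k (envDegLE p pw ℒ d) : ℝ) ≤
        Real.exp (s * d + ∑ i ∈ J, -Real.log (1 - Real.exp (-(s * i.1)))) := by
  obtain ⟨hfinite, hcard⟩ :=
    finite_and_ncard_multiset_le hδ0 (le_degree_gradedBasis hint hδ) hJ hs
  have hle := envDegLE_le_span_multiset (p := p) (pw := pw) hint hlie d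
  set F := (fun m => wordProd (envHom k p pw) hint m.toList) ''
    {m : Multiset (GradedIndex ℒ) | (m.map Sigma.fst).sum ≤ d}
  have hF : F.Finite := hfinite.image _
  have := FiniteDimensional.span_of_finite k hF
  refine ⟨Submodule.finiteDimensional_of_le hle, le_trans (Nat.cast_le.2 ?_) hcard⟩
  calc _ ≤ Module.finrank k (Submodule.span k F) := Submodule.finrank_mono hle
    _ ≤ F.ncard := by
      rw [← hF.coe_toFinset, Set.ncard_coe_finset]
      exact finrank_span_finset_le_card _
    _ ≤ _ := Set.ncard_image_le hfinite

variable (hfin : ∀ d, FiniteDimensional k (degLE ℒ d))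

include hfin

theorem envDegLE_finiteDimensional (d : ℝ) : FiniteDimensional k (envDegLE p pw ℒ d) := by
  obtain ⟨J, hJ⟩ := exists_finset_mem_iff_degree_le hint d
  exact (finiteDimensional_and_finrank_envDegLE_le hint hlie hδ0 hδ (fun i => (hJ i).2)
    one_pos).1

theorem exists_finrank_envDegLE_le_exp {η C : ℝ} (hη : 0 < η)
    (hgrowth : ∀ d ≥ 1, (Module.finrank k (degLE ℒ d) : ℝ) ≤ C * d ^ η) :
    ∃ E ≥ 1, ∀ d ≥ 1,
      (Module.finrank k (envDegLE p pw ℒ d) : ℝ) ≤ Real.exp (E * d ^ (η / (η + 1))) := by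
  obtain ⟨A, hA, hsum⟩ := exists_sum_neg_log_le hη
  obtain ⟨B, hB, hbound⟩ := exists_finrank_degLE_le_mul_rpow hδ0 hη.le hfin hgrowth
  refine ⟨1 + A * B, by nlinarith, fun d hd => ?_⟩
  obtain ⟨J, hJ⟩ := exists_finset_mem_iff_degree_le hint d
  have hd0 : 0 < d := by linarith
  have hdα : 1 ≤ d ^ (η / (η + 1)) := Real.one_le_rpow hd (by positivity)
  -- This choice of `s` balances the two summands `s * d` and `A * (B * s ^ (-η))` of the exponent.
  set s := d ^ (-(η + 1)⁻¹) with hs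
  have hs0 : 0 < s := by positivity
  have hsη : s ^ (-η) = d ^ (η / (η + 1)) := by
    rw [hs, ← Real.rpow_mul hd0.le]
    congr 1
    field_simp
  have hsd : s * d = d ^ (η / (η + 1)) := by
    rw [hs, ← Real.rpow_add_one hd0.ne']
    congr 1
    field_simp
    ring
  have hlog := hsum (fun i : GradedIndex ℒ => i.1) J B s (by linarith) hs0
    (by rw [hsη]; nlinarith) (fun i _ => hδ0.trans_le (le_degree_gradedBasis hint hδ i))
    fun i _ => le_trans
      (Nat.cast_le.2 (card_le_finrank_degLE hint fun j hj => (Finset.mem_filter.1 hj).2))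
      (hbound i.1 (le_degree_gradedBasis hint hδ i))
  refine (finiteDimensional_and_finrank_envDegLE_le hint hlie hδ0 hδ (fun i => (hJ i).2)
    hs0).2.trans (Real.exp_le_exp.2 ?_)
  rw [hsη] at hlog
  rw [hsd]
  linarith

theorem finrank_envDegLE_growthLE {η C : ℝ} (hη : 0 < η)
    (hgrowth : ∀ d ≥ 1, (Module.finrank k (degLE ℒ d) : ℝ) ≤ C * d ^ η) :
    GrowthLE (fun d => (Module.finrank k (envDegLE p pw ℒ d) : ℝ))
      (fun d => Real.exp (d ^ (η / (η + 1)))) := by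
  obtain ⟨E, hE, hle⟩ := exists_finrank_envDegLE_le_exp hint hlie hδ0 hδ hfin hη hgrowth
  exact growthLE_exp_rpow hE (by positivity) hle

end EnvGrowth

/-! ### Linear independence of square-free monomials -/

section Contraction

variable {k A B : Type*} [Field k] [Ring A] [Algebra k A] [Ring B] [Algebra k B]

/-- The linear map `B → B` obtained from a coaction `Δ : B → A ⊗ B` by contraction with a linear
form on `A`. -/
def contract (Δ : B →ₐ[k] A ⊗[k] B) (f : A →ₗ[k] k) : B →ₗ[k] B :=
  (TensorProduct.lid k B).toLinearMap ∘ₗ f.rTensor B ∘ₗ Δ.toLinearMap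

theorem lid_rTensor_mul (f : A →ₗ[k] k) (x : A) (u : B) (z : A ⊗[k] B) :
    TensorProduct.lid k B (f.rTensor B (x ⊗ₜ u * z)) =
      u * TensorProduct.lid k B ((f ∘ₗ LinearMap.mulLeft k x).rTensor B z) := by
  induction z with
  | zero => simp
  | add y z hy hz => rw [mul_add, map_add, map_add, map_add, map_add, mul_add, hy, hz]
  | tmul y v => simp [Algebra.TensorProduct.tmul_mul_tmul]

variable {ι : Type*} {ρ : ι → A} {τ : ι → B}

variable (k τ) in
/-- The span of the products of at most `n - 2` of the elements `τ i`; it is zero for `n ≤ 1`. The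
shift is such that removing two factors from a product of length `n` leads to `lowProducts k τ n`,
without truncated subtraction. -/
def lowProducts (n : ℕ) : Submodule k B :=
  Submodule.span k {u | ∃ l : List ι, l.length + 2 ≤ n ∧ (l.map τ).prod = u}

theorem lowProducts_mono : Monotone (lowProducts k τ) := fun _ _ h =>
  Submodule.span_mono fun _ ⟨l, hl, hu⟩ => ⟨l, hl.trans h, hu⟩

theorem prod_mem_lowProducts {l : List ι} {n : ℕ} (hl : l.length + 2 ≤ n) :
    (l.map τ).prod ∈ lowProducts k τ n :=
  Submodule.subset_span ⟨l, hl, rfl⟩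

theorem mul_mem_lowProducts (i : ι) {n : ℕ} {u : B} (hu : u ∈ lowProducts k τ n) :
    τ i * u ∈ lowProducts k τ (n + 1) := by
  suffices h : lowProducts k τ n ≤
      (lowProducts k τ (n + 1)).comap (LinearMap.mulLeft k (τ i)) from h hu
  refine Submodule.span_le.2 ?_
  rintro _ ⟨l, hl, rfl⟩
  exact Submodule.subset_span ⟨i :: l, Nat.succ_le_succ hl, by simp⟩

variable (ρ τ) in
/-- The part `∑ᵢ f (ρ aᵢ) • (τ a₁ ⋯ τ aᵢ₋₁ τ aᵢ₊₁ ⋯ τ aₙ)` of the contraction of `τ a₁ ⋯ τ aₙ`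
with `f` that comes from the terms of the coproduct with exactly one factor on the left. -/
def linearPart (f : A →ₗ[k] k) : List ι → B
  | [] => 0
  | i :: l => f (ρ i) • (l.map τ).prod + τ i * linearPart f l

theorem linearPart_mem (f : A →ₗ[k] k) (l : List ι) :
    linearPart ρ τ f l ∈ lowProducts k τ (l.length + 1) := by
  induction l with
  | nil => exact zero_mem _
  | cons i l ih =>
    exact add_mem (Submodule.smul_mem _ _ (prod_mem_lowProducts le_rfl))
      (mul_mem_lowProducts i ih)

theorem linearPart_of_nodup [DecidableEq ι] {f : A →ₗ[k] k} {j : ι}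
    (hf : ∀ i, f (ρ i) = if i = j then 1 else 0) {l : List ι} (hl : l.Nodup) :
    linearPart ρ τ f l = if j ∈ l then ((l.erase j).map τ).prod else 0 := by
  induction l with
  | nil => simp [linearPart]
  | cons i l ih =>
    obtain ⟨hi, hl⟩ := List.nodup_cons.1 hl
    rw [linearPart, ih hl, hf]
    by_cases hij : i = j
    · subst hij
      simp [hi]
    · rw [if_neg hij, zero_smul, zero_add, List.erase_cons_tail (by simpa using hij)]
      by_cases hj : j ∈ l
      · simp [hj]
      · simp [hj, Ne.symm hij]

variable {Δ : B →ₐ[k] A ⊗[k] B} (hΔ : ∀ i, Δ (τ i) = ρ i ⊗ₜ 1 + 1 ⊗ₜ τ i)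

include hΔ

theorem contract_mul (f : A →ₗ[k] k) (i : ι) (u : B) :
    contract Δ f (τ i * u) =
      contract Δ (f ∘ₗ LinearMap.mulLeft k (ρ i)) u + τ i * contract Δ f u := by
  simp only [contract, LinearMap.comp_apply, AlgHom.toLinearMap_apply, map_mul, hΔ, add_mul,
    map_add, LinearEquiv.coe_coe, lid_rTensor_mul, one_mul, LinearMap.mulLeft_one,
    LinearMap.comp_id]

theorem contract_prod_sub_mem (f : A →ₗ[k] k) (l : List ι) :
    contract Δ f (l.map τ).prod - f 1 • (l.map τ).prod - linearPart ρ τ f l ∈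
      lowProducts k τ l.length := by
  induction l generalizing f with
  | nil =>
    have h : contract Δ f 1 - f 1 • 1 - 0 = 0 := by
      simp [contract, Algebra.TensorProduct.one_def]
    exact h ▸ zero_mem _
  | cons i l ih =>
    set fi := f ∘ₗ LinearMap.mulLeft k (ρ i)
    have hfi : fi 1 = f (ρ i) := by simp [fi]
    have hsplit : contract Δ f ((i :: l).map τ).prod - f 1 • ((i :: l).map τ).prod -
        linearPart ρ τ f (i :: l) =
        (contract Δ fi (l.map τ).prod - fi 1 • (l.map τ).prod - linearPart ρ τ fi l) +
        linearPart ρ τ fi l +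
        τ i * (contract Δ f (l.map τ).prod - f 1 • (l.map τ).prod - linearPart ρ τ f l) := by
      rw [List.map_cons, List.prod_cons, contract_mul hΔ, linearPart, hfi, mul_sub, mul_sub,
        mul_smul_comm]
      abel
    rw [hsplit]
    exact add_mem (add_mem (lowProducts_mono (Nat.le_succ _) (ih fi)) (linearPart_mem fi l))
      (mul_mem_lowProducts i (ih f))

theorem contract_mem_lowProducts {f : A →ₗ[k] k} (hf : f 1 = 0) {n : ℕ} {u : B}
    (hu : u ∈ lowProducts k τ (n + 1)) : contract Δ f u ∈ lowProducts k τ n := by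
  suffices h : lowProducts k τ (n + 1) ≤ (lowProducts k τ n).comap (contract Δ f) from h hu
  refine Submodule.span_le.2 ?_
  rintro _ ⟨l, hl, rfl⟩
  have h := add_mem (lowProducts_mono (Nat.le_succ _) (contract_prod_sub_mem hΔ f l))
    (linearPart_mem (ρ := ρ) f l)
  rw [sub_add_cancel, hf, zero_smul, sub_zero] at h
  exact lowProducts_mono (by lia) h

omit hΔ in
/-- Successive contraction of a coaction with the linear forms of a list. -/
def contractAll (Δ : B →ₐ[k] A ⊗[k] B) (f : ι → A →ₗ[k] k) : List ι → (B →ₗ[k] B)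
  | [] => LinearMap.id
  | j :: J => contractAll Δ f J ∘ₗ contract Δ (f j)

variable {f : ι → A →ₗ[k] k} (hf : ∀ j, f j 1 = 0)

include hf

theorem contractAll_eq_zero (J : List ι) {u : B} (hu : u ∈ lowProducts k τ (J.length + 1)) :
    contractAll Δ f J u = 0 := by
  induction J generalizing u with
  | nil =>
    have h : lowProducts k τ 1 ≤ ⊥ := by
      refine Submodule.span_le.2 ?_
      rintro _ ⟨l, hl, -⟩
      lia
    exact (Submodule.mem_bot k).1 (h hu)
  | cons j J ih => exact ih (contract_mem_lowProducts hΔ (hf j) hu)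

theorem contractAll_prod [DecidableEq ι] (hfρ : ∀ j i, f j (ρ i) = if i = j then 1 else 0)
    (J : List ι) {I : List ι} (hI : I.Nodup) (hIJ : I.length ≤ J.length) :
    contractAll Δ f J (I.map τ).prod = if J.Perm I then 1 else 0 := by
  induction J generalizing I with
  | nil =>
    obtain rfl := List.length_eq_zero_iff.1 (Nat.le_zero.1 hIJ)
    simp [contractAll]
  | cons j J ih =>
    have hcontract : contractAll Δ f J (contract Δ (f j) (I.map τ).prod) =
        contractAll Δ f J (if j ∈ I then ((I.erase j).map τ).prod else 0) := by
      rw [← sub_eq_zero, ← map_sub, ← linearPart_of_nodup (hfρ j) hI]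
      refine contractAll_eq_zero hΔ hf J (lowProducts_mono hIJ ?_)
      simpa only [hf, zero_smul, sub_zero] using contract_prod_sub_mem hΔ (f j) I
    refine hcontract.trans ?_
    by_cases hj : j ∈ I
    · have hlen : (I.erase j).length ≤ J.length := by
        rw [List.length_erase_of_mem hj]
        exact Nat.sub_le_of_le_add hIJ
      simp [ih (hI.erase j) hlen, List.cons_perm_iff_perm_erase, hj]
    · rw [if_neg hj, map_zero, if_neg fun h => hj (h.subset List.mem_cons_self)]

omit hΔ hf in
theorem exists_dual_forms [DecidableEq ι]
    (hρ : LinearIndependent k fun o : Option ι => o.casesOn' 1 ρ) :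
    ∃ f : ι → A →ₗ[k] k, (∀ j, f j 1 = 0) ∧ ∀ j i, f j (ρ i) = if i = j then 1 else 0 := by
  have hdual : ∀ j, ∃ g : A →ₗ[k] k, ∀ o : Option ι,
      g (o.casesOn' 1 ρ) = if o = some j then 1 else 0 := by
    intro j
    obtain ⟨g, hg⟩ := LinearMap.exists_extend (Finsupp.lapply (some j) ∘ₗ hρ.repr)
    refine ⟨g, fun o => (LinearMap.congr_fun hg ⟨_, Submodule.subset_span ⟨o, rfl⟩⟩).trans ?_⟩
    rw [LinearMap.comp_apply, Finsupp.lapply_apply, hρ.repr_eq_single o _ rfl,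
      Finsupp.single_apply]
  choose g hg using hdual
  exact ⟨g, fun j => by simpa using hg j none, fun j i => by simpa using hg j (some i)⟩

omit hf in
theorem linearIndependent_prod_of_coaction [Nontrivial B]
    (hρ : LinearIndependent k fun o : Option ι => o.casesOn' 1 ρ) :
    LinearIndependent k fun I : Finset ι => (I.toList.map τ).prod := by
  classical
  obtain ⟨f, hf, hfρ⟩ := exists_dual_forms hρ
  rw [linearIndependent_iff']
  intro s c hc I hI
  by_contra hcI
  obtain ⟨I₀, hI₀, hmax⟩ := (s.filter fun I => c I ≠ 0).exists_max_image Finset.card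
    ⟨I, Finset.mem_filter.2 ⟨hI, hcI⟩⟩
  obtain ⟨hI₀s, hI₀c⟩ := Finset.mem_filter.1 hI₀
  -- Contraction along a monomial of maximal length kills all the other monomials.
  have hcontract := congrArg (contractAll Δ f I₀.toList) hc
  rw [map_sum, map_zero, Finset.sum_eq_single_of_mem I₀ hI₀s] at hcontract
  · rw [map_smul, contractAll_prod hΔ hf hfρ _ I₀.nodup_toList le_rfl,
      if_pos (List.Perm.refl _)] at hcontract
    exact hI₀c ((smul_eq_zero.1 hcontract).resolve_right one_ne_zero)
  · intro I' hI' hne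
    by_cases hc' : c I' = 0
    · rw [hc', zero_smul, map_zero]
    · have hcard := hmax I' (Finset.mem_filter.2 ⟨hI', hc'⟩)
      rw [map_smul, contractAll_prod hΔ hf hfρ _ I'.nodup_toList (by simpa using hcard),
        if_neg fun h => hne (Finset.perm_toList.1 h).symm, smul_zero]

end Contraction

section EnvLowerBound

attribute [local instance] LieRing.ofAssociativeRing

variable {k L A : Type*} [Field k] [LieRing L] [LieAlgebra k L] [Ring A] [Algebra k A] {p : ℕ}
  {pw : L → L}

theorem exists_env_lift (ρ : L →ₗ⁅k⁆ A) (hpw : p ≠ 0 → ∀ a, ρ (pw a) = ρ a ^ p) :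
    ∃ F : Env k p pw →ₐ[k] A, ∀ a, F (envHom k p pw a) = ρ a := by
  have hlift : ∀ a, UniversalEnvelopingAlgebra.lift k ρ (UniversalEnvelopingAlgebra.ι k a) = ρ a :=
    UniversalEnvelopingAlgebra.lift_ι_apply' k ρ
  refine ⟨RingQuot.liftAlgHom k ⟨UniversalEnvelopingAlgebra.lift k ρ, ?_⟩, fun a => ?_⟩
  · rintro _ _ ⟨a, hp⟩
    rw [map_pow, hlift, hlift, hpw hp]
  · rw [envHom_apply, envι, RingQuot.liftAlgHom_mkAlgHom_apply, hlift]

theorem envHom_pw (hp : p ≠ 0) (a : L) : envHom k p pw (pw a) = envHom k p pw a ^ p := by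
  rw [envHom_apply, envHom_apply, envι, envι, ← map_pow]
  exact (RingQuot.mkAlgHom_rel k (PowRel.pow_eq a hp)).symm

/-- The coproduct `a ↦ ρ a ⊗ 1 + 1 ⊗ σ a` of two representations of `L` in associative algebras. -/
def coproductHom {B : Type*} [Ring B] [Algebra k B] (ρ : L →ₗ⁅k⁆ A) (σ : L →ₗ⁅k⁆ B) :
    L →ₗ⁅k⁆ A ⊗[k] B where
  toLinearMap := (TensorProduct.mk k A B).flip 1 ∘ₗ (ρ : L →ₗ[k] A) +
    TensorProduct.mk k A B 1 ∘ₗ (σ : L →ₗ[k] B)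
  map_lie' {a b} := by
    simp only [AddHom.toFun_eq_coe, LinearMap.coe_toAddHom, LinearMap.add_apply,
      LinearMap.coe_comp, LieHom.coe_toLinearMap, Function.comp_apply, LieHom.map_lie,
      LieRing.of_associative_ring_bracket, LinearMap.flip_apply, map_sub,
      TensorProduct.mk_apply, mul_add, add_mul,
      Algebra.TensorProduct.tmul_mul_tmul, mul_one, one_mul]
    abel

theorem coproductHom_apply {B : Type*} [Ring B] [Algebra k B] (ρ : L →ₗ⁅k⁆ A) (σ : L →ₗ⁅k⁆ B)
    (a : L) : coproductHom ρ σ a = ρ a ⊗ₜ 1 + 1 ⊗ₜ σ a := rfl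

theorem exists_coaction [CharP k p] (ρ : L →ₗ⁅k⁆ A) (hpw : p ≠ 0 → ∀ a, ρ (pw a) = ρ a ^ p) :
    ∃ Δ : Env k p pw →ₐ[k] A ⊗[k] Env k p pw,
      ∀ a, Δ (envHom k p pw a) = ρ a ⊗ₜ 1 + 1 ⊗ₜ envHom k p pw a := by
  refine exists_env_lift (coproductHom ρ (envHom k p pw)) fun hp a => ?_
  have : Fact p.Prime := ⟨(CharP.char_is_prime_or_zero k p).resolve_right hp⟩
  obtain _ | _ := subsingleton_or_nontrivial (A ⊗[k] Env k p pw)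
  · exact Subsingleton.elim _ _
  have : CharP (A ⊗[k] Env k p pw) p :=
    charP_of_injective_algebraMap (algebraMap k _).injective p
  have hcomm : Commute (ρ a ⊗ₜ[k] (1 : Env k p pw)) (1 ⊗ₜ envHom k p pw a) := by
    simp [Commute, SemiconjBy, Algebra.TensorProduct.tmul_mul_tmul]
  calc coproductHom ρ (envHom k p pw) (pw a)
      = (ρ a ⊗ₜ 1) ^ p + (1 ⊗ₜ envHom k p pw a) ^ p := by
        rw [coproductHom_apply, hpw hp, envHom_pw hp, Algebra.TensorProduct.tmul_pow,
          Algebra.TensorProduct.tmul_pow, one_pow, one_pow]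
    _ = coproductHom ρ (envHom k p pw) a ^ p := (add_pow_char_of_commute p hcomm).symm

theorem linearIndependent_prod_envHom [CharP k p] {ρ : L →ₗ⁅k⁆ A}
    (hpw : p ≠ 0 → ∀ a, ρ (pw a) = ρ a ^ p) (hinj : Function.Injective ρ)
    (hone : ∀ a, ρ a ≠ 1) {ι : Type*} {v : ι → L} (hv : LinearIndependent k v) :
    LinearIndependent k fun I : Finset ι => (I.toList.map fun i => envHom k p pw (v i)).prod := by
  obtain ⟨Δ, hΔ⟩ := exists_coaction (pw := pw) ρ hpw
  obtain ⟨F, -⟩ := exists_env_lift (pw := pw) ρ hpw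
  have : Nontrivial A := ⟨ρ 0, 1, hone 0⟩
  have : Nontrivial (Env k p pw) := F.toRingHom.domain_nontrivial
  refine linearIndependent_prod_of_coaction (ρ := ρ ∘ v) (fun i => hΔ (v i))
    (linearIndependent_option'.2
      ⟨hv.map' (ρ : L →ₗ[k] A) (LinearMap.ker_eq_bot.2 hinj), fun hmem => ?_⟩)
  have hle : Submodule.span k (Set.range (ρ ∘ v)) ≤ LinearMap.range (ρ : L →ₗ[k] A) := by
    refine Submodule.span_le.2 ?_
    rintro _ ⟨i, rfl⟩
    exact ⟨v i, rfl⟩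
  obtain ⟨a, ha⟩ := hle hmem
  exact hone a ha

variable {ℒ : ℝ → Submodule k L}

theorem envDegLE_mono : Monotone (envDegLE p pw ℒ) := fun _ _ h =>
  iSup₂_le fun e he => le_iSup₂_of_le e (he.trans h) le_rfl

theorem mul_mem_envDegLE {a : L} {d e : ℝ} (ha : a ∈ degLE ℒ d) {u : Env k p pw}
    (hu : u ∈ envDegLE p pw ℒ e) : envHom k p pw a * u ∈ envDegLE p pw ℒ (d + e) := by
  suffices h : envDegLE p pw ℒ e ≤ (envDegLE p pw ℒ (d + e)).comap
      (LinearMap.mulLeft k (envHom k p pw a)) from h hu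
  refine iSup₂_le fun e' he' => Submodule.span_le.2 ?_
  rintro _ ⟨l, hl, hle, rfl⟩
  suffices h : degLE ℒ d ≤ (envDegLE p pw ℒ (d + e)).comap
      (LinearMap.mulRight k (l.map fun t => envι k p pw t.2).prod ∘ₗ
        (envHom k p pw : L →ₗ[k] Env k p pw)) from h ha
  refine iSup₂_le fun d' hd' b hb => ?_
  refine Submodule.mem_iSup_of_mem (d' + e') (Submodule.mem_iSup_of_mem (add_le_add hd' he')
    (Submodule.subset_span ⟨(d', b) :: l, ?_, ?_, ?_⟩))
  · exact List.forall_mem_cons.2 ⟨hb, hl⟩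
  · simp [hle]
  · simp [envHom_apply]

theorem prod_envHom_mem_envDegLE {d : ℝ} {l : List L} (hl : ∀ a ∈ l, a ∈ degLE ℒ d) :
    (l.map (envHom k p pw)).prod ∈ envDegLE p pw ℒ (l.length * d) := by
  induction l with
  | nil =>
    exact Submodule.mem_iSup_of_mem 0 (Submodule.mem_iSup_of_mem (by simp)
      (Submodule.subset_span ⟨[], by simp⟩))
  | cons a l ih =>
    rw [List.map_cons, List.prod_cons, List.length_cons, Nat.cast_succ, add_one_mul, add_comm]
    exact mul_mem_envDegLE (hl a List.mem_cons_self)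
      (ih fun b hb => hl b (List.mem_cons_of_mem _ hb))

theorem two_pow_le_finrank_envDegLE [CharP k p] {ρ : L →ₗ⁅k⁆ A}
    (hpw : p ≠ 0 → ∀ a, ρ (pw a) = ρ a ^ p) (hinj : Function.Injective ρ)
    (hone : ∀ a, ρ a ≠ 1) {d e : ℝ} (hd : 0 ≤ d) [FiniteDimensional k (envDegLE p pw ℒ e)]
    {M : ℕ} (hM : M ≤ Module.finrank k (degLE ℒ d)) (hMe : M * d ≤ e) :
    2 ^ M ≤ Module.finrank k (envDegLE p pw ℒ e) := by
  obtain ⟨v, hv⟩ := exists_linearIndependent_of_le_finrank hM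
  have hli := linearIndependent_prod_envHom hpw hinj hone
    (hv.map' (degLE ℒ d).subtype (Submodule.ker_subtype _))
  have hmem (I : Finset (Fin M)) :
      (I.toList.map fun i => envHom k p pw (v i)).prod ∈ envDegLE p pw ℒ e := by
    have hprod := prod_envHom_mem_envDegLE (p := p) (pw := pw)
      (l := I.toList.map fun i => (v i : L)) (ℒ := ℒ) (d := d) (by simp)
    rw [List.map_map, List.length_map, Finset.length_toList] at hprod
    refine envDegLE_mono (le_trans ?_ hMe) hprod
    gcongr
    simpa using I.card_le_univ
  have hli' : LinearIndependent k fun I =>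
      (⟨_, hmem I⟩ : envDegLE p pw ℒ e) := LinearIndependent.of_comp (envDegLE p pw ℒ e).subtype hli
  simpa using hli'.fintype_card_le_finrank

end EnvLowerBound

/-! ### Gelfand–Kirillov dimension -/

section LogGrowth

variable {f : ℕ → ℕ} {θ : ℝ}

theorem log_natCast_le_log {m : ℕ} {x : ℝ} (hx : 1 ≤ x) (h : m ≤ x) :
    Real.log m ≤ Real.log x := by
  obtain rfl | hm := Nat.eq_zero_or_pos m
  · simpa using Real.log_nonneg hx
  · exact Real.log_le_log (Nat.cast_pos.2 hm) h

theorem limsup_log_mul_rpow_div_log {c : ℝ} (hc : 0 < c) (θ : ℝ) :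
    Filter.limsup (fun n : ℕ => ((Real.log (c * (n : ℝ) ^ θ) / Real.log n : ℝ) : EReal))
      Filter.atTop = θ := by
  refine Filter.Tendsto.limsup_eq ((continuous_coe_real_ereal.tendsto θ).comp ?_)
  have hlog := Real.tendsto_log_atTop.comp (tendsto_natCast_atTop_atTop (R := ℝ))
  have hlim : Filter.Tendsto (fun n : ℕ => Real.log c / Real.log n + θ) Filter.atTop (nhds θ) := by
    simpa using (hlog.const_div_atTop (Real.log c)).add_const θ
  refine hlim.congr' ?_
  filter_upwards [Filter.eventually_gt_atTop 1] with n hn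
  have hn1 : (1 : ℝ) < n := by exact_mod_cast hn
  have hn0 : (0 : ℝ) < n := one_pos.trans hn1
  rw [Real.log_mul hc.ne' (by positivity), Real.log_rpow hn0, add_div,
    mul_div_cancel_right₀ _ (Real.log_pos hn1).ne']

theorem limsup_log_div_log_le {B : ℝ} (hθ : 0 ≤ θ)
    (h : ∀ᶠ n : ℕ in Filter.atTop, f n ≤ B * (n : ℝ) ^ θ) :
    Filter.limsup (fun n : ℕ => ((Real.log (f n) / Real.log n : ℝ) : EReal)) Filter.atTop ≤ θ := by
  rw [← limsup_log_mul_rpow_div_log (one_pos.trans_le (le_max_right B 1)) θ]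
  refine Filter.limsup_le_limsup ?_
  filter_upwards [h, Filter.eventually_ge_atTop 1] with n hn hn1
  have hrpow : 1 ≤ (n : ℝ) ^ θ := Real.one_le_rpow (Nat.one_le_cast.2 hn1) hθ
  have hlog : Real.log (f n) ≤ Real.log (max B 1 * (n : ℝ) ^ θ) := by
    refine log_natCast_le_log (one_le_mul_of_one_le_of_one_le (le_max_right _ _) hrpow)
      (hn.trans ?_)
    gcongr
    exact le_max_left _ _
  exact EReal.coe_le_coe_iff.2 (div_le_div_of_nonneg_right hlog (Real.log_natCast_nonneg n))

theorem le_limsup_log_div_log {c : ℝ} (hc : 0 < c)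
    (h : ∀ᶠ n : ℕ in Filter.atTop, c * (n : ℝ) ^ θ ≤ f n) :
    θ ≤ Filter.limsup (fun n : ℕ => ((Real.log (f n) / Real.log n : ℝ) : EReal)) Filter.atTop := by
  rw [← limsup_log_mul_rpow_div_log hc θ]
  refine Filter.limsup_le_limsup ?_
  filter_upwards [h, Filter.eventually_ge_atTop 1] with n hn hn1
  have : (0 : ℝ) < n := Nat.cast_pos.2 hn1
  exact EReal.coe_le_coe_iff.2 (div_le_div_of_nonneg_right
    (Real.log_le_log (by positivity) hn) (Real.log_natCast_nonneg n))

theorem eventually_le_rpow_of_limsup_lt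
    (h : Filter.limsup (fun n : ℕ => ((Real.log (f n) / Real.log n : ℝ) : EReal)) Filter.atTop
      < θ) : ∀ᶠ n : ℕ in Filter.atTop, f n ≤ (n : ℝ) ^ θ := by
  filter_upwards [Filter.eventually_lt_of_limsup_lt h, Filter.eventually_gt_atTop 1] with n hn hn1
  have hn1 : (1 : ℝ) < n := by exact_mod_cast hn1
  have hn0 : (0 : ℝ) < n := one_pos.trans hn1
  obtain hf | hf := Nat.eq_zero_or_pos (f n)
  · rw [hf, Nat.cast_zero]
    positivity
  · have hlog := (div_lt_iff₀ (Real.log_pos hn1)).1 (EReal.coe_lt_coe_iff.1 hn)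
    rw [← Real.log_rpow hn0] at hlog
    exact ((Real.log_lt_log_iff (Nat.cast_pos.2 hf) (by positivity)).1 hlog).le

end LogGrowth

section GelfandKirillov

variable {k L : Type*} [Field k] [LieRing L] [LieAlgebra k L] {p : ℕ} {pw : L → L}
  {ℒ : ℝ → Submodule k L}

theorem isMultiplicative_degLE (hpm : p ≠ 0 → IsPMap k p pw) (hℒ : IsMultiplicative p pw ℒ) :
    IsMultiplicative p pw (degLE ℒ) := by
  have hsub : ∀ d, degLE ℒ d = ⨆ i : {i : ℝ // i ≤ d}, ℒ i := fun _ => iSup_subtype'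
  have hlie : ∀ {s t : ℝ} {a b : L}, a ∈ degLE ℒ s → b ∈ degLE ℒ t →
      ⁅a, b⁆ ∈ degLE ℒ (s + t) := by
    intro s t a b ha hb
    rw [hsub] at ha hb
    exact lie_mem_of_mem_iSup
      (fun i j _ ha _ hb => le_degLE ℒ (add_le_add i.2 j.2) (hℒ.lie_mem ha hb)) ha hb
  refine ⟨hlie, fun hp t a ha => ?_⟩
  have hjac : ∀ a ∈ degLE ℒ t, ∀ b ∈ degLE ℒ t, ∀ r, jacobsonTerm k p r a b ∈ degLE ℒ (p • t) :=
    fun a ha b hb r => jacobsonTerm_mem (P := degLE ℒ) hlie ha hb hp r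
  rw [hsub t] at ha hjac
  exact pw_mem_of_mem_iSup hp (hpm hp)
    (fun i a ha => le_degLE ℒ (nsmul_le_nsmul_right i.2 p) (hℒ.pw_mem hp ha)) hjac ha

theorem powSpace_le_of_isMultiplicative {ι : Type*} [AddMonoid ι] {P : ι → Submodule k L}
    (hP : IsMultiplicative p pw P) {S : Submodule k L} {i : ι} (hS : S ≤ P i) (n : ℕ) :
    powSpace k p pw S n ≤ P (n • i) := by
  intro a ha
  change MemPow k p pw S n a at ha
  induction ha with
  | of h => rw [one_nsmul]; exact hS h
  | zero => exact zero_mem _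
  | add _ _ iha ihb => exact add_mem iha ihb
  | smul c _ iha => exact Submodule.smul_mem _ c iha
  | lie _ _ iha ihb => rw [add_nsmul]; exact hP.lie_mem iha ihb
  | pw hp _ iha => rw [mul_nsmul']; exact hP.pw_mem hp iha

theorem powSpaceLE_le_degLE (hpm : p ≠ 0 → IsPMap k p pw) (hℒ : IsMultiplicative p pw ℒ)
    {S : Submodule k L} {e : ℝ} (he : 0 ≤ e) (hS : S ≤ degLE ℒ e) (n : ℕ) :
    powSpaceLE k p pw S n ≤ degLE ℒ (n * e) := by
  refine iSup₂_le fun m hm => ?_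
  rw [← nsmul_eq_mul]
  exact (powSpace_le_of_isMultiplicative (isMultiplicative_degLE hpm hℒ) hS m).trans
    (degLE_mono ℒ (nsmul_le_nsmul_left he (Finset.mem_Icc.1 hm).2))

theorem powSpaceLE_mono (S : Submodule k L) : Monotone (powSpaceLE k p pw S) := fun _ _ h =>
  biSup_mono fun _ hi => Finset.Icc_subset_Icc_right h hi

theorem limsup_le_gkDim (S : Submodule k L) [hS : FiniteDimensional k S] :
    Filter.limsup (fun n : ℕ =>
      ((Real.log (Module.finrank k (powSpaceLE k p pw S n)) / Real.log n : ℝ) : EReal))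
      Filter.atTop ≤ gkDim k p pw :=
  le_iSup₂ (f := fun (S : Submodule k L) (_ : FiniteDimensional k S) =>
    Filter.limsup (fun n : ℕ =>
      ((Real.log (Module.finrank k (powSpaceLE k p pw S n)) / Real.log n : ℝ) : EReal))
      Filter.atTop) S hS

theorem gkDim_nonneg : 0 ≤ gkDim k p pw := by
  refine le_trans ?_ (limsup_le_gkDim (⊥ : Submodule k L))
  refine Filter.le_limsup_of_frequently_le (Filter.Frequently.of_forall fun n => ?_)
  exact_mod_cast div_nonneg (Real.log_natCast_nonneg _) (Real.log_natCast_nonneg _)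

theorem gkDim_le (hint : DirectSum.IsInternal ℒ) (hpm : p ≠ 0 → IsPMap k p pw)
    (hℒ : IsMultiplicative p pw ℒ) (hfin : ∀ d, FiniteDimensional k (degLE ℒ d)) {C θ : ℝ}
    (hθ : 0 ≤ θ) (hgrowth : ∀ d ≥ 1, (Module.finrank k (degLE ℒ d) : ℝ) ≤ C * d ^ θ) :
    gkDim k p pw ≤ θ := by
  refine iSup₂_le fun S hS => ?_
  obtain ⟨e', he'⟩ := exists_le_degLE_of_fg hint ((Submodule.fg_iff_finiteDimensional S).2 hS)
  set e := max e' 1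
  have he1 : 1 ≤ e := le_max_right _ _
  have hSe : S ≤ degLE ℒ e := he'.trans (degLE_mono ℒ (le_max_left _ _))
  refine limsup_log_div_log_le (B := C * e ^ θ) hθ ?_
  filter_upwards [Filter.eventually_ge_atTop 1] with n hn
  calc (Module.finrank k (powSpaceLE k p pw S n) : ℝ)
      ≤ Module.finrank k (degLE ℒ (n * e)) := Nat.cast_le.2 (Submodule.finrank_mono
        (powSpaceLE_le_degLE hpm hℒ (by linarith) hSe n))
    _ ≤ C * (n * e) ^ θ :=
      hgrowth _ (one_le_mul_of_one_le_of_one_le (Nat.one_le_cast.2 hn) he1)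
    _ = C * e ^ θ * (n : ℝ) ^ θ := by
      rw [Real.mul_rpow (Nat.cast_nonneg n) (by linarith)]
      ring

theorem IsGraded.exists_gkDim_eq_coe {X : Type*} [CommRing X] [Algebra k X]
    [FiniteDimensional k X] {ψ : L →ₗ⁅k⁆ Wreath k X L} {lam : ℝ} {𝒳 : ℝ → Submodule k X}
    (hgraded : IsGraded p pw ψ lam 𝒳 ℒ) (hpm : p ≠ 0 → IsPMap k p pw) (hfaith : IsFaithful ψ)
    (hlam : 1 < lam) (hfin : ∀ d, FiniteDimensional k (degLE ℒ d)) :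
    ∃ θ : ℝ, gkDim k p pw = θ ∧ 0 ≤ θ ∧ θ ≤ Real.logb lam (Module.finrank k X) := by
  obtain ⟨C, -, hC⟩ := exists_finrank_degLE_le_rpow hfaith hlam hgraded hfin
  have hle := gkDim_le hgraded.internal hpm hgraded.isMultiplicative hfin
    (div_nonneg (Real.log_natCast_nonneg _) (Real.log_nonneg hlam.le)) hC
  have hcoe : ((gkDim k p pw).toReal : EReal) = gkDim k p pw :=
    EReal.coe_toReal (ne_top_of_le_ne_top (EReal.coe_ne_top _) hle)
      (ne_bot_of_le_ne_bot EReal.zero_ne_bot gkDim_nonneg)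
  refine ⟨_, hcoe.symm, EReal.toReal_nonneg gkDim_nonneg, ?_⟩
  rwa [← EReal.coe_le_coe_iff, hcoe]

section Generated

variable {S : Submodule k L} [FiniteDimensional k S]
  (hfin : ∀ n, FiniteDimensional k (powSpaceLE k p pw S n)) {δ : ℝ} (hδ : 0 < δ)
  (hgen : ∀ d, degLE ℒ d ≤ powSpaceLE k p pw S ⌊d / δ⌋₊)
include hfin hδ hgen

theorem le_gkDim {r d₀ θ : ℝ} (hr : 0 < r)
    (hgrowth : ∀ d ≥ d₀, r * d ^ θ ≤ Module.finrank k (degLE ℒ d)) :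
    θ ≤ gkDim k p pw := by
  refine le_trans ?_ (limsup_le_gkDim S)
  refine le_limsup_log_div_log (c := r * δ ^ θ) (by positivity) ?_
  filter_upwards [Filter.eventually_ge_atTop ⌈d₀ / δ⌉₊] with n hn
  have hle : degLE ℒ (n * δ) ≤ powSpaceLE k p pw S n := by
    simpa only [mul_div_cancel_right₀ _ hδ.ne', Nat.floor_natCast] using hgen (n * δ)
  calc r * δ ^ θ * (n : ℝ) ^ θ = r * (n * δ) ^ θ := by
        rw [Real.mul_rpow (Nat.cast_nonneg n) hδ.le]
        ring
    _ ≤ Module.finrank k (degLE ℒ (n * δ)) :=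
      hgrowth _ ((div_le_iff₀ hδ).1 (Nat.ceil_le.1 hn))
    _ ≤ Module.finrank k (powSpaceLE k p pw S n) := Nat.cast_le.2 (Submodule.finrank_mono hle)

theorem exists_finrank_degLE_le_of_gkDim_lt {η : ℝ} (hη : 0 ≤ η) (h : gkDim k p pw < η) :
    ∃ C : ℝ, ∀ d ≥ 1, (Module.finrank k (degLE ℒ d) : ℝ) ≤ C * d ^ η := by
  obtain ⟨n₀, hn₀⟩ := Filter.eventually_atTop.1
    (eventually_le_rpow_of_limsup_lt ((limsup_le_gkDim S).trans_lt h))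
  refine ⟨(1 / δ + n₀) ^ η, fun d hd => ?_⟩
  have hd0 : 0 < d := by linarith
  have hmax : ((max ⌊d / δ⌋₊ n₀ : ℕ) : ℝ) ≤ (1 / δ + n₀) * d := by
    have hfloor : (⌊d / δ⌋₊ : ℝ) ≤ d / δ := Nat.floor_le (by positivity)
    have hn : (n₀ : ℝ) ≤ n₀ * d := le_mul_of_one_le_right (Nat.cast_nonneg n₀) hd
    rw [Nat.cast_max, add_mul, one_div_mul_eq_div]
    have : 0 ≤ d / δ := by positivity
    have : 0 ≤ n₀ * d := by positivity
    exact max_le (by linarith) (by linarith)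
  calc (Module.finrank k (degLE ℒ d) : ℝ)
      ≤ Module.finrank k (powSpaceLE k p pw S (max ⌊d / δ⌋₊ n₀)) :=
        Nat.cast_le.2 (Submodule.finrank_mono
          ((hgen d).trans (powSpaceLE_mono S (le_max_left _ _))))
    _ ≤ ((max ⌊d / δ⌋₊ n₀ : ℕ) : ℝ) ^ η := hn₀ _ (le_max_right _ _)
    _ ≤ ((1 / δ + n₀) * d) ^ η := by gcongr
    _ = (1 / δ + n₀) ^ η * d ^ η := Real.mul_rpow (by positivity) hd0.le

end Generated

end GelfandKirillov

/-! ### Growth of the enveloping algebra -/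

theorem tendsto_log_div_of_growthLE {f : ℝ → ℕ} {α : ℝ} (hα : α < 1)
    (h : GrowthLE (fun d => (f d : ℝ)) fun d => Real.exp (d ^ α)) :
    Filter.Tendsto (fun d => Real.log (f d) / d) Filter.atTop (nhds 0) := by
  obtain ⟨C, hC, h⟩ := h
  set B := max C 1
  have hB : 1 ≤ B := le_max_right _ _
  have hlim : Filter.Tendsto (fun d : ℝ => Real.log B / d + C ^ α * d ^ (-(1 - α)))
      Filter.atTop (nhds 0) := by
    simpa using (Filter.tendsto_id.const_div_atTop (Real.log B)).add
      ((tendsto_rpow_neg_atTop (sub_pos.2 hα)).const_mul (C ^ α))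
  refine tendsto_of_tendsto_of_tendsto_of_le_of_le' tendsto_const_nhds hlim ?_ ?_
  · filter_upwards [Filter.eventually_ge_atTop 0] with d hd
    exact div_nonneg (Real.log_natCast_nonneg _) hd
  filter_upwards [Filter.eventually_ge_atTop 1] with d hd
  have hd0 : 0 < d := by linarith
  have hlog : Real.log (f d) ≤ Real.log B + (C * d) ^ α := by
    have hexp : 1 ≤ Real.exp ((C * d) ^ α) := Real.one_le_exp (by positivity)
    rw [← Real.log_exp ((C * d) ^ α), ← Real.log_mul (by positivity) (Real.exp_pos _).ne']
    refine log_natCast_le_log (one_le_mul_of_one_le_of_one_le hB hexp) ((h d hd).trans ?_)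
    gcongr
    exact le_max_left _ _
  calc Real.log (f d) / d ≤ (Real.log B + (C * d) ^ α) / d := by gcongr
    _ = Real.log B / d + C ^ α * d ^ (-(1 - α)) := by
      rw [add_div, Real.mul_rpow hC.le hd0.le, mul_div_assoc, neg_sub, Real.rpow_sub_one hd0.ne']

theorem exp_le_two_mul_two_pow_floor {t x : ℝ} (h : t ≤ x * Real.log 2) :
    Real.exp t ≤ 2 * 2 ^ ⌊x⌋₊ := by
  have hlog : 0 ≤ Real.log 2 := Real.log_nonneg (by norm_num)
  rw [← pow_succ', ← Real.exp_log (show (0 : ℝ) < 2 ^ (⌊x⌋₊ + 1) by positivity), Real.log_pow,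
    Real.exp_le_exp]
  push_cast
  exact h.trans (mul_le_mul_of_nonneg_right (Nat.lt_floor_add_one x).le hlog)

theorem exp_rpow_growthLE_of_two_pow_le {f : ℝ → ℝ} {α b e₀ : ℝ} (hα : 0 < α) (hb : 0 < b)
    (h : ∀ e ≥ e₀, 2 ^ ⌊b * e ^ α⌋₊ ≤ f e) : GrowthLE (fun d => Real.exp (d ^ α)) f := by
  have : 0 < Real.log 2 := Real.log_pos (by norm_num)
  set C := max 2 (max e₀ ((b * Real.log 2)⁻¹ ^ α⁻¹))
  have hC2 : 2 ≤ C := le_max_left _ _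
  have hCe : e₀ ≤ C := (le_max_left _ _).trans (le_max_right _ _)
  have hC0 : 0 < C := by linarith
  have hCα : 1 ≤ b * Real.log 2 * C ^ α := by
    rw [← inv_le_iff_one_le_mul₀' (by positivity)]
    exact (Real.rpow_inv_le_iff_of_pos (by positivity) hC0.le hα).1
      ((le_max_right _ _).trans (le_max_right _ _))
  refine ⟨C, hC0, fun d hd => ?_⟩
  have hd0 : 0 ≤ d := by linarith
  have hdα : d ^ α ≤ b * (C * d) ^ α * Real.log 2 := by
    calc d ^ α ≤ b * Real.log 2 * C ^ α * d ^ α := le_mul_of_one_le_left (by positivity) hCα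
      _ = b * (C * d) ^ α * Real.log 2 := by
        rw [Real.mul_rpow hC0.le hd0]
        ring
  have hfe := h (C * d) (hCe.trans (le_mul_of_one_le_right hC0.le hd))
  have : 0 ≤ f (C * d) := le_trans (by positivity) hfe
  calc Real.exp (d ^ α) ≤ 2 * 2 ^ ⌊b * (C * d) ^ α⌋₊ := exp_le_two_mul_two_pow_floor hdα
    _ ≤ C * f (C * d) := by gcongr

section EnvelopingGrowth

variable {k L : Type*} [Field k] [LieRing L] [LieAlgebra k L] {p : ℕ} {pw : L → L}
  {ℒ : ℝ → Submodule k L}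

theorem finrank_envDegLE_le_one [Subsingleton L] (d : ℝ) :
    Module.finrank k (envDegLE p pw ℒ d) ≤ 1 := by
  have hle : envDegLE p pw ℒ d ≤ Submodule.span k {1} := by
    refine iSup₂_le fun e _ => Submodule.span_le.2 ?_
    rintro _ ⟨l, -, -, rfl⟩
    cases l with
    | nil => exact Submodule.mem_span_singleton_self 1
    | cons t l =>
      rw [List.map_cons, List.prod_cons, ← envHom_apply, Subsingleton.elim t.2 0, map_zero,
        zero_mul]
      exact zero_mem _
  exact (Submodule.finrank_mono hle).trans (by simpa using finrank_span_le_card (R := k) {1})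

section LowerBound

attribute [local instance] LieRing.ofAssociativeRing

theorem exp_growthLE_finrank_envDegLE [CharP k p] {A : Type*} [Ring A] [Algebra k A]
    {ρ : L →ₗ⁅k⁆ A} (hpw : p ≠ 0 → ∀ a, ρ (pw a) = ρ a ^ p) (hinj : Function.Injective ρ)
    (hone : ∀ a, ρ a ≠ 1) (hfin : ∀ d, FiniteDimensional k (envDegLE p pw ℒ d)) {r d₀ θ : ℝ}
    (hr : 0 < r) (hθ : 0 < θ) (hgrowth : ∀ d ≥ d₀, r * d ^ θ ≤ Module.finrank k (degLE ℒ d)) :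
    GrowthLE (fun d => Real.exp (d ^ (θ / (θ + 1))))
      (fun d => (Module.finrank k (envDegLE p pw ℒ d) : ℝ)) := by
  refine exp_rpow_growthLE_of_two_pow_le (e₀ := max 1 (|d₀| ^ (θ + 1))) (by positivity)
    (lt_min hr one_pos) fun e he => ?_
  have he0 : 0 < e := one_pos.trans_le ((le_max_left _ _).trans he)
  -- products of `e ^ (θ / (θ + 1))` basis vectors of degree at most `e ^ (1 / (θ + 1))`
  set D := e ^ (θ + 1)⁻¹
  have hD0 : 0 ≤ D := by positivity
  have hDθ : D ^ θ = e ^ (θ / (θ + 1)) := by rw [← Real.rpow_mul he0.le, inv_mul_eq_div]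
  have hDe : e ^ (θ / (θ + 1)) * D = e := by
    rw [← Real.rpow_add he0, ← one_div, ← add_div, div_self (by positivity), Real.rpow_one]
  have hDd : d₀ ≤ D := (le_abs_self d₀).trans
    ((Real.le_rpow_inv_iff_of_pos (abs_nonneg _) he0.le (by positivity)).2
      ((le_max_right _ _).trans he))
  have hfloor : (⌊min r 1 * e ^ (θ / (θ + 1))⌋₊ : ℝ) ≤ min r 1 * e ^ (θ / (θ + 1)) :=
    Nat.floor_le (by positivity)
  refine mod_cast two_pow_le_finrank_envDegLE hpw hinj hone hD0 ?_ ?_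
  · have hle : min r 1 * e ^ (θ / (θ + 1)) ≤ r * e ^ (θ / (θ + 1)) := by
      gcongr
      exact min_le_left _ _
    exact_mod_cast (hfloor.trans hle).trans (hDθ ▸ hgrowth D hDd)
  · calc ⌊min r 1 * e ^ (θ / (θ + 1))⌋₊ * D ≤ min r 1 * e ^ (θ / (θ + 1)) * D := by gcongr
      _ ≤ 1 * e ^ (θ / (θ + 1)) * D := by
        gcongr
        exact min_le_right _ _
      _ = e := by rw [one_mul, hDe]

end LowerBound

theorem finrank_envDegLE_growthLE_of_growthLE (hint : DirectSum.IsInternal ℒ)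
    (hlie : ∀ {i j : ℝ} {a b : L}, a ∈ ℒ i → b ∈ ℒ j → ⁅a, b⁆ ∈ ℒ (i + j)) {δ : ℝ}
    (hδ0 : 0 < δ) (hδ : ∀ d < δ, ℒ d = ⊥) (hfin : ∀ d, FiniteDimensional k (degLE ℒ d)) {η : ℝ}
    (hη : 0 < η) (hgrowth : GrowthLE (fun d => (Module.finrank k (degLE ℒ d) : ℝ)) (· ^ η)) :
    GrowthLE (fun d => (Module.finrank k (envDegLE p pw ℒ d) : ℝ))
      (fun d => Real.exp (d ^ (η / (η + 1)))) := by
  obtain ⟨B, hB, hle⟩ := hgrowth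
  refine finrank_envDegLE_growthLE hint hlie hδ0 hδ hfin hη (C := B * B ^ η) fun d hd => ?_
  rw [mul_assoc, ← Real.mul_rpow hB.le (by linarith)]
  exact hle d hd

theorem finrank_envDegLE_growthLE_logb {X : Type*} [CommRing X] [Algebra k X]
    [FiniteDimensional k X] {ψ : L →ₗ⁅k⁆ Wreath k X L} {lam : ℝ} {𝒳 : ℝ → Submodule k X}
    (hfaith : IsFaithful ψ) (hlam : 1 < lam) (hgraded : IsGraded p pw ψ lam 𝒳 ℒ) {δ : ℝ}
    (hδ0 : 0 < δ) (hδ : ∀ d < δ, ℒ d = ⊥) (hfin : ∀ d, FiniteDimensional k (degLE ℒ d)) :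
    GrowthLE (fun d => (Module.finrank k (envDegLE p pw ℒ d) : ℝ))
      (fun d => Real.exp (d ^ (Real.logb lam (Module.finrank k X) /
        (Real.logb lam (Module.finrank k X) + 1)))) := by
  obtain hX | hX := le_or_gt (Module.finrank k X) 1
  · have := hfaith.subsingleton_of_finrank_le_one hX
    refine ⟨1, one_pos, fun d hd => ?_⟩
    rw [one_mul, one_mul]
    exact (Nat.cast_le.2 (finrank_envDegLE_le_one d)).trans
      (by simpa using Real.rpow_nonneg (zero_le_one.trans hd) _)
  · obtain ⟨C, -, hC⟩ := exists_finrank_degLE_le_rpow hfaith hlam hgraded hfin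
    exact finrank_envDegLE_growthLE hgraded.internal hgraded.lie_mem hδ0 hδ hfin
      (Real.logb_pos hlam (Nat.one_lt_cast.2 hX)) hC

end EnvelopingGrowth

end SelfSimilarLie

end

open SelfSimilarLie in
theorem mainTheorem9_general {k X L : Type*} [Field k] (p : ℕ) [CharP k p]
    [CommRing X] [Algebra k X] [FiniteDimensional k X] [LieRing L] [LieAlgebra k L]
    (pw : L → L) (ψ : L →ₗ⁅k⁆ Wreath k X L)
    (hres : IsRestricted p pw ψ) (hfaith : IsFaithful ψ)
    (lam : ℝ) (hlam : 1 < lam) (𝒳 : ℝ → Submodule k X) (ℒ : ℝ → Submodule k L)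
    (hgraded : IsGraded p pw ψ lam 𝒳 ℒ)
    (hgen : GeneratedInPositiveDegree p pw ℒ) :
    (∀ d : ℝ, FiniteDimensional k (degLE ℒ d)) ∧
    (∀ d : ℝ, FiniteDimensional k (envDegLE p pw ℒ d)) ∧
    Filter.Tendsto (fun d : ℝ => Real.log (Module.finrank k (envDegLE p pw ℒ d)) / d)
      Filter.atTop (nhds 0) ∧
    GrowthLE (fun d => (Module.finrank k (envDegLE p pw ℒ d) : ℝ))
      (fun d => Real.exp (d ^
        ((Real.log (Module.finrank k X) / Real.log lam) /
          (Real.log (Module.finrank k X) / Real.log lam + 1)))) ∧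
    ∃ θ : ℝ, gkDim k p pw = (θ : EReal) ∧ 0 ≤ θ ∧
      θ ≤ Real.log (Module.finrank k X) / Real.log lam ∧
      (∀ η > θ, GrowthLE (fun d => (Module.finrank k (envDegLE p pw ℒ d) : ℝ))
        (fun d => Real.exp (d ^ (η / (η + 1))))) ∧
      (0 < θ → GrowthLE (fun d => (Module.finrank k (degLE ℒ d) : ℝ)) (fun d => d ^ θ) →
        GrowthLE (fun d => (Module.finrank k (envDegLE p pw ℒ d) : ℝ))
          (fun d => Real.exp (d ^ (θ / (θ + 1))))) ∧
      (IsWeaklyBranched ψ →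
        θ = Real.log (Module.finrank k X) / Real.log lam ∧ 0 < θ ∧
        GrowthLE (fun d => (Module.finrank k (envDegLE p pw ℒ d) : ℝ))
          (fun d => Real.exp (d ^ (θ / (θ + 1)))) ∧
        GrowthLE (fun d => Real.exp (d ^ (θ / (θ + 1))))
          (fun d => (Module.finrank k (envDegLE p pw ℒ d) : ℝ))) := by
  have hpm : p ≠ 0 → IsPMap k p pw := fun hp => (hres hp).1
  obtain ⟨δ, hδ0, S, hS, hδ, hle⟩ := exists_generation_bound hpm hgraded hgen
  have : FiniteDimensional k S := (Submodule.fg_iff_finiteDimensional S).1 hS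
  have hpowfin := powSpaceLE_finiteDimensional (p := p) hpm hS
  have hfin : ∀ d, FiniteDimensional k (degLE ℒ d) := fun d =>
    Submodule.finiteDimensional_of_le (hle d)
  have hUfin : ∀ d, FiniteDimensional k (envDegLE p pw ℒ d) :=
    envDegLE_finiteDimensional hgraded.internal hgraded.lie_mem hδ0 hδ hfin
  have hU := finrank_envDegLE_growthLE_logb hfaith hlam hgraded hδ0 hδ hfin
  obtain ⟨θ, hθ, hθ0, hθ1⟩ := hgraded.exists_gkDim_eq_coe hpm hfaith hlam hfin
  refine ⟨hfin, hUfin, tendsto_log_div_of_growthLE ((div_lt_one (by linarith)).2 (lt_add_one _)) hU,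
    hU, θ, hθ, hθ0, hθ1, fun η hη => ?_, finrank_envDegLE_growthLE_of_growthLE hgraded.internal
      hgraded.lie_mem hδ0 hδ hfin, fun hbr => ?_⟩
  · obtain ⟨B, hB⟩ := exists_finrank_degLE_le_of_gkDim_lt hpowfin hδ0 hle (hθ0.trans hη.le)
      (hθ.trans_lt (EReal.coe_lt_coe_iff.2 hη))
    exact finrank_envDegLE_growthLE hgraded.internal hgraded.lie_mem hδ0 hδ hfin
      (hθ0.trans_lt hη) hB
  · obtain ⟨r, hr, d₀, -, hlow⟩ := hbr.exists_rpow_le_finrank_degLE hfaith hlam hgraded hfin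
    obtain rfl : θ = Real.logb lam (Module.finrank k X) :=
      hθ1.antisymm (EReal.coe_le_coe_iff.1 ((le_gkDim hpowfin hδ0 hle hr hlow).trans_eq hθ))
    have hpos := Real.logb_pos hlam (Nat.one_lt_cast.2 (hbr.one_lt_finrank hfaith))
    exact ⟨rfl, hpos, hU, exp_growthLE_finrank_envDegLE (fun hp => act_pw hp hres)
      hfaith.actHom_injective (actHom_ne_one ψ) hUfin hr hpos hlow⟩

open SelfSimilarLie in
theorem mainTheorem9 {k X L : Type*} [Field k] (p : ℕ) [CharP k p]
    [CommRing X] [Algebra k X] [FiniteDimensional k X] [LieRing L] [LieAlgebra k L]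
    (pw : L → L) (ψ : L →ₗ⁅k⁆ Wreath k X L)
    (hres : IsRestricted p pw ψ) (hfaith : IsFaithful ψ) (hcontr : IsContracting ψ)
    (lam : ℝ) (hlam : 1 < lam) (𝒳 : ℝ → Submodule k X) (ℒ : ℝ → Submodule k L)
    (hgraded : IsGraded p pw ψ lam 𝒳 ℒ) (hnonneg : ∀ d < 0, ℒ d = ⊥)
    (hgen : GeneratedInPositiveDegree p pw ℒ) :
    (∀ d : ℝ, FiniteDimensional k (degLE ℒ d)) ∧
    (∀ d : ℝ, FiniteDimensional k (envDegLE p pw ℒ d)) ∧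
    Filter.Tendsto (fun d : ℝ => Real.log (Module.finrank k (envDegLE p pw ℒ d)) / d)
      Filter.atTop (nhds 0) ∧
    GrowthLE (fun d => (Module.finrank k (envDegLE p pw ℒ d) : ℝ))
      (fun d => Real.exp (d ^
        ((Real.log (Module.finrank k X) / Real.log lam) /
          (Real.log (Module.finrank k X) / Real.log lam + 1)))) ∧
    ∃ θ : ℝ, gkDim k p pw = (θ : EReal) ∧ 0 ≤ θ ∧
      θ ≤ Real.log (Module.finrank k X) / Real.log lam ∧
      (∀ η > θ, GrowthLE (fun d => (Module.finrank k (envDegLE p pw ℒ d) : ℝ))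
        (fun d => Real.exp (d ^ (η / (η + 1))))) ∧
      (0 < θ → GrowthLE (fun d => (Module.finrank k (degLE ℒ d) : ℝ)) (fun d => d ^ θ) →
        GrowthLE (fun d => (Module.finrank k (envDegLE p pw ℒ d) : ℝ))
          (fun d => Real.exp (d ^ (θ / (θ + 1))))) ∧
      (IsRegularlyWeaklyBranched ψ →
        θ = Real.log (Module.finrank k X) / Real.log lam ∧ 0 < θ ∧
        GrowthLE (fun d => (Module.finrank k (envDegLE p pw ℒ d) : ℝ))
          (fun d => Real.exp (d ^ (θ / (θ + 1)))) ∧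
        GrowthLE (fun d => Real.exp (d ^ (θ / (θ + 1))))
          (fun d => (Module.finrank k (envDegLE p pw ℒ d) : ℝ))) := by
  obtain ⟨hfin, hUfin, hlim, hU, θ, hθ, hθ0, hθ1, hgt, hattained, hbranched⟩ :=
    mainTheorem9_general p pw ψ hres hfaith lam hlam 𝒳 ℒ hgraded hgen
  exact ⟨hfin, hUfin, hlim, hU, θ, hθ, hθ0, hθ1, hgt, hattained,
    fun hbr => hbranched hbr.isWeaklyBranched⟩
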